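/- Let $H$ be a finite abelian group, let $n\ge 0$, and let $G$ be either a finite abelian group with a given homomorphism $\sigma\colon G\to S_n$, or $G=S_n$ with its natural action on $n$ points (so $\sigma=\mathrm{id}$). Let $W=H\wr G=H^{n}\rtimes G$ be the wreath product, where $G$ permutes the $n$ factors through $\sigma$. Then there is a split global solution to the Donald--Flanigan problem for $W$ over some finite integral extension $k$ of $\mathbb Z$ (a subring of $\mathbb C$ which is finitely generated as a $\mathbb Z$-module). That is, there are such a $k$, a deformation $B$ of the group algebra $kW$ and a multiplicatively closed subset $S\subset k[[t]]$ with the following properties. (1) $B$ is an associative unital $k[[t]]$-algebra whose underlying module is identified with $(kW)[[t]]$ in such a way that setting $t=0$ turns the multiplication of $B$ into that of $kW$. (2) $0\notin S$, and for every prime ideal $\mathfrak p$ of $k$ containing a rational prime that divides $|W|$, $S$ does not meet $\mathfrak p\,k[[t]]$; in particular $S$ does not meet the ideal of $k[[t]]$ generated by any rational prime dividing $|W|$. (3) $S^{-1}B$ is a separable algebra over $R=S^{-1}k[[t]]$, i.e. there is an element $e=\sum x_i\otimes y_i\in S^{-1}B\otimes_R S^{-1}B$ with $\sum x_iy_i=1$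 and $\sum ax_i\otimes y_i=\sum x_i\otimes y_ia$ for all $a\in S^{-1}B$. (4) $S^{-1}B$ is split, i.e. isomorphic as an $R$-algebra to a finite direct sum of matrix algebras $M_{d_1}(R)\oplus\cdots\oplus M_{d_r}(R)$ with all $d_i\ge 1$. -/

import Mathlib

open scoped TensorProduct PowerSeries

universe u v w

/-- The wreath product `H ≀ G = (H × ⋯ × H) ⋊ G` (`n` factors), where `G` permutes the factors
through `σ : G →* Sₙ`, that is `(g • a) i = a (σ g⁻¹ i)`. -/
abbrev WreathProduct {n : ℕ} (H : Type u) [Group H] {G : Type v} [Group G]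
    (σ : G →* Equiv.Perm (Fin n)) : Type (max u v) :=
  (Fin n → H) ⋊[(mulAutArrow (G := Equiv.Perm (Fin n)) (A := Fin n) (M := H)).comp σ] G

/-- `B` is a (formal, one-parameter) deformation over `k⟦t⟧` of the group algebra `kG` of the
finite group `G`: as a `k⟦t⟧`-module it is identified with `(kG)⟦t⟧`, which for finite `G` is the
free module on `G`, in such a way that the reduction `t ↦ 0` turns the multiplication of `B` into
the one of `kG`. -/
def IsGroupAlgebraDeformation (k : Type u) [CommRing k] (G : Type v) [Group G]
    (B : Type w) [Ring B] [Algebra k⟦X⟧ B] : Prop :=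
  ∃ φ : B ≃ₗ[k⟦X⟧] MonoidAlgebra k⟦X⟧ G, ∀ x y : B,
    MonoidAlgebra.mapRingHom G (PowerSeries.constantCoeff (R := k)) (φ (x * y)) =
      MonoidAlgebra.mapRingHom G (PowerSeries.constantCoeff (R := k)) (φ x) *
        MonoidAlgebra.mapRingHom G (PowerSeries.constantCoeff (R := k)) (φ y)

/-- An `R`-algebra `A` is separable if there is a separability idempotent: an element
`e = ∑ xᵢ ⊗ yᵢ` of `A ⊗ A` with `∑ a xᵢ ⊗ yᵢ = ∑ xᵢ ⊗ yᵢ a` for all `a` and `∑ xᵢ yᵢ = 1`. -/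
def IsSeparableAlgebra (R : Type u) [CommRing R] (A : Type v) [Ring A] [Algebra R A] : Prop :=
  ∃ e : A ⊗[R] A, (∀ a : A, (a ⊗ₜ[R] (1 : A)) * e = e * ((1 : A) ⊗ₜ[R] a)) ∧
    LinearMap.mul' R A e = 1

/-- An `R`-algebra is split if it is a finite direct sum of matrix algebras over `R`. -/
def IsSplitAlgebra (R : Type u) [CommRing R] (A : Type v) [Ring A] [Algebra R A] : Prop :=
  ∃ (r : ℕ) (d : Fin r → ℕ), (∀ i, 0 < d i) ∧
    Nonempty (A ≃ₐ[R] ((i : Fin r) → Matrix (Fin (d i)) (Fin (d i)) R))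

/-- A global solution over `k` to the Donald-Flanigan problem for the finite group `G`: a
deformation `B` of `kG` over `k⟦t⟧` together with a multiplicatively closed subset `S` of `k⟦t⟧`
not containing `0`, such that `S` does not meet the extension to `k⟦t⟧` of any prime ideal of `k`
that contains a rational prime dividing the order of `G`, and such that the localization `S⁻¹B` is
separable over `S⁻¹k⟦t⟧`. -/
structure IsGlobalSolution (k : Type u) [CommRing k] (G : Type v) [Group G]
    (B : Type w) [Ring B] [Algebra k⟦X⟧ B] (S : Submonoid k⟦X⟧) : Prop where
  isDeformation : IsGroupAlgebraDeformation k G B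
  zero_notMem : (0 : k⟦X⟧) ∉ S
  disjoint_primes : ∀ p : ℕ, p.Prime → p ∣ Nat.card G →
    ∀ P : Ideal k, P.IsPrime → (p : k) ∈ P →
      ∀ s ∈ S, s ∉ P.map (PowerSeries.C (R := k))
  isSeparable : IsSeparableAlgebra (Localization S) (Localization S ⊗[k⟦X⟧] B)

/-- There is a split global solution over `k` to the Donald-Flanigan problem for `G`: a global
solution such that moreover `S⁻¹B` is a direct sum of matrix algebras over `S⁻¹k⟦t⟧`. -/
def HasSplitGlobalSolution (k : Type u) [CommRing k] (G : Type v) [Group G] : Prop :=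
  ∃ (B : Type u) (_ : Ring B) (_ : Algebra k⟦X⟧ B) (S : Submonoid k⟦X⟧),
    IsGlobalSolution k G B S ∧ IsSplitAlgebra (Localization S) (Localization S ⊗[k⟦X⟧] B)

/-- There is a split global solution to the Donald-Flanigan problem for `G` over some finite
integral extension of `ℤ`, that is over some subring of `ℂ` that is finite as a `ℤ`-module. -/
def DonaldFlaniganSplitSolvable (G : Type v) [Group G] : Prop :=
  ∃ k : Subalgebra ℤ ℂ, Module.Finite ℤ k ∧ HasSplitGlobalSolution k G

/-! Let `S` consist of the power series that are nonzero modulo every prime ideal of `k`, and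
construct `B` inside the split algebra it should become. In a product of matrix algebras over
`S⁻¹k⟦t⟧` of total rank |W|, it is enough to find elements `b w` that span over the localization and
satisfy `b v * b w = b (v * w)` modulo `t` times their `k⟦t⟧`-span. By rank they form a basis, their
`k⟦t⟧`-span is the deformation, and its localization is the whole product. Separability follows from
splitness (`hasSplitGlobalSolution_of_span`, `hasSplitGlobalSolution_of_blocks`).

The units come from θ = ζ(1 + tD) with D in `S`. For n > 0, θ^n - 1 is a unit times a monic
polynomial in tD, hence lies in `S`, even in characteristics dividing n. So distinct integer powers
of θ have invertible differences, although the corresponding powers of ζ may coincide. The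
characters of an abelian group are written as ζ^e(g) with integer exponents, and ζ is replaced by θ.
The values now separate the characters over the localization, while the group law survives modulo
the parameter, because a product of factors X - y^j, with y a suitable power of θ, reduces to X^m -
1 (`exists_deformed_characters`).

For `H ≀ G`, the group algebra of `H^n` becomes a lattice of functions on `J^n` with |J| = |H|. Some
D in `S` multiplies every `k⟦t⟧`-valued function into this lattice. Therefore `G` is deformed with
parameter tD instead of t: its error terms may then have arbitrary functions on `J^n` as
coefficients (`hasSplitGlobalSolution_wreathProduct`).

When `G` is abelian, Clifford theory supplies the matrices: the irreducible modules are indexed by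
orbits of a point of `J^n` together with a character of its stabilizer. When `G = Sₙ`, they come
from Young's seminormal form on standard multitableaux at q = 1 + tD. Its generators satisfy the
braid relations and T² = 1 + (q - 1)e(1 + T), where e is the indicator of equality of two
neighbouring coordinates, so normal forms deform the permutations (`exists_deformed_perm_basis`).
Jucys-Murphy elements and exchanges of letters give all matrix units
(`single_mem_of_heckeMatrix_mem`), and the identity |J|^n n! for pairs of multitableaux of the same
shape gives the rank (`sum_wordCount_standardWords`). -/

/-! ### Primitive power series and the units they create. -/

open PowerSeries in
/-- The power series that do not vanish modulo any prime ideal of the base ring. -/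
def primitiveSeries (k : Type u) [CommRing k] : Submonoid k⟦X⟧ where
  carrier := {f | ∀ P : Ideal k, P.IsPrime → PowerSeries.map (Ideal.Quotient.mk P) f ≠ 0}
  one_mem' P hP := by
    have := hP
    rw [map_one]
    exact one_ne_zero
  mul_mem' {f g} hf hg P hP := by
    have := hP
    rw [map_mul]
    exact mul_ne_zero (hf P hP) (hg P hP)

lemma PowerSeries.map_mk_eq_zero_of_mem_map_C {k : Type u} [CommRing k] {P : Ideal k} {f : k⟦X⟧}
    (hf : f ∈ P.map (PowerSeries.C (R := k))) : PowerSeries.map (Ideal.Quotient.mk P) f = 0 := by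
  have h : P.map (PowerSeries.C (R := k)) ≤ RingHom.ker (PowerSeries.map (Ideal.Quotient.mk P)) := by
    rw [Ideal.map_le_iff_le_comap]
    intro a ha
    rw [Ideal.mem_comap, RingHom.mem_ker, PowerSeries.map_C, Ideal.Quotient.eq_zero_iff_mem.2 ha,
      map_zero]
  exact h hf

lemma zero_notMem_primitiveSeries (k : Type u) [CommRing k] [Nontrivial k] :
    (0 : k⟦X⟧) ∉ primitiveSeries k := by
  obtain ⟨P, hP⟩ := Ideal.exists_maximal k
  exact fun h ↦ h P hP.isPrime (map_zero _)

lemma primitiveSeries_le_nonZeroDivisors (k : Type u) [CommRing k] [IsDomain k] :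
    primitiveSeries k ≤ nonZeroDivisors k⟦X⟧ := by
  intro f hf
  rw [mem_nonZeroDivisors_iff_ne_zero]
  rintro rfl
  exact zero_notMem_primitiveSeries k hf

/-- The localization of `k⟦X⟧` at the primitive power series. -/
abbrev PrimitiveLocalization (k : Type u) [CommRing k] : Type u :=
  Localization (primitiveSeries k)

/-- Split off from `g` the largest power of `X`. The cofactor has nonzero constant term, and this is
also the constant term of its value at `e`. -/
lemma Polynomial.aeval_powerSeries_ne_zero {F : Type u} [CommRing F] [IsDomain F] {e : F⟦X⟧}
    (he : e ≠ 0) (he0 : PowerSeries.constantCoeff e = 0) {g : Polynomial F} (hg : g ≠ 0) :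
    Polynomial.aeval e g ≠ 0 := by
  obtain ⟨g', hg', hnd⟩ := Polynomial.exists_eq_pow_rootMultiplicity_mul_and_not_dvd g hg 0
  rw [hg', map_mul, map_pow]
  refine mul_ne_zero (pow_ne_zero _ (by simpa using he)) fun h ↦ hnd ?_
  have h2 := congrArg (PowerSeries.constantCoeff (R := F)) h
  rw [map_zero, Polynomial.aeval_def, Polynomial.hom_eval₂, he0] at h2
  rw [map_zero, sub_zero, Polynomial.X_dvd_iff, ← h2, Polynomial.eval₂_at_zero]
  simp

/-- Being monic survives reduction modulo any prime, so transcendence of `e` applies in every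
quotient at once. -/
lemma Polynomial.Monic.aeval_mem_primitiveSeries {k : Type u} [CommRing k] {e : k⟦X⟧}
    (he : e ∈ primitiveSeries k) (he0 : PowerSeries.constantCoeff e = 0) {g : Polynomial k}
    (hg : g.Monic) : Polynomial.aeval e g ∈ primitiveSeries k := by
  intro P hP
  have h := Polynomial.aeval_powerSeries_ne_zero (F := k ⧸ P) (he P hP)
    (by rw [← PowerSeries.coeff_zero_eq_constantCoeff_apply, PowerSeries.coeff_map,
      PowerSeries.coeff_zero_eq_constantCoeff_apply, he0, map_zero])
    (g := g.map (Ideal.Quotient.mk P)) (hg.map _).ne_zero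
  convert h using 1
  rw [Polynomial.aeval_def, Polynomial.aeval_def, Polynomial.hom_eval₂, Polynomial.eval₂_map]
  congr 1
  ext a : 1
  simp

lemma X_mul_mem_primitiveSeries {k : Type u} [CommRing k] {D : k⟦X⟧}
    (hD : D ∈ primitiveSeries k) : PowerSeries.X * D ∈ primitiveSeries k := by
  refine mul_mem (fun P hP ↦ ?_) hD
  have := hP
  rw [PowerSeries.map_X]
  exact PowerSeries.X_ne_zero

lemma isUnit_C_mul_one_add {k : Type u} [CommRing k] (z : kˣ) (D : k⟦X⟧) :
    IsUnit (PowerSeries.C (z : k) * (1 + PowerSeries.X * D)) := by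
  rw [PowerSeries.isUnit_iff_constantCoeff]
  simp

/-- Up to the unit `z ^ n` this is the monic polynomial (1 + X)^n - z^(-n) evaluated at tD. It does
not matter whether n, or z^n - 1, vanishes modulo some prime. -/
lemma pow_sub_one_mem_primitiveSeries {k : Type u} [CommRing k] [IsDomain k] (z : kˣ) {D : k⟦X⟧}
    (hD : D ∈ primitiveSeries k) {n : ℕ} (hn : n ≠ 0) :
    (PowerSeries.C (z : k) * (1 + PowerSeries.X * D)) ^ n - 1 ∈ primitiveSeries k := by
  have hu (z : kˣ) : PowerSeries.C (z : k) ∈ primitiveSeries k := by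
    intro P hP
    have := hP
    exact (((z.isUnit.map PowerSeries.C).map _)).ne_zero
  have hm : ((1 + Polynomial.X) ^ n - Polynomial.C ((z⁻¹ ^ n : kˣ) : k)).Monic := by
    have h1 : ((1 + Polynomial.X : Polynomial k) ^ n).Monic := by
      rw [add_comm]; exact (Polynomial.monic_X_add_C (1 : k)).pow n
    apply h1.sub_of_left
    refine lt_of_le_of_lt Polynomial.degree_C_le ?_
    rw [add_comm, Polynomial.degree_pow, ← Polynomial.C_1, Polynomial.degree_X_add_C]
    simpa [Nat.pos_iff_ne_zero] using hn
  have h := mul_mem (hu (z ^ n)) (hm.aeval_mem_primitiveSeries (X_mul_mem_primitiveSeries hD)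
    (by simp))
  convert h using 1
  simp only [map_sub, map_pow, map_add, map_one, Polynomial.aeval_X, Polynomial.aeval_C, mul_sub,
    Units.val_pow_eq_pow_val, PowerSeries.algebraMap_apply, Algebra.algebraMap_self,
    RingHom.id_apply, ← mul_pow, ← map_mul, Units.mul_inv, one_pow]

/-- The unit `z (1 + t D)` of the localization. -/
noncomputable def deformedUnit {k : Type u} [CommRing k] (z : kˣ) (D : k⟦X⟧) :
    (PrimitiveLocalization k)ˣ :=
  ((isUnit_C_mul_one_add z D).map (algebraMap k⟦X⟧ (PrimitiveLocalization k))).unit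

lemma val_deformedUnit {k : Type u} [CommRing k] (z : kˣ) (D : k⟦X⟧) :
    (deformedUnit z D : PrimitiveLocalization k) =
      algebraMap k⟦X⟧ _ (PowerSeries.C (z : k) * (1 + PowerSeries.X * D)) := rfl

lemma isUnit_deformedUnit_zpow_sub_one {k : Type u} [CommRing k] [IsDomain k] (z : kˣ) {D : k⟦X⟧}
    (hD : D ∈ primitiveSeries k) {n : ℤ} (hn : n ≠ 0) :
    IsUnit (((deformedUnit z D ^ n : (PrimitiveLocalization k)ˣ) : PrimitiveLocalization k) - 1) := by
  have key (m : ℕ) (hm : m ≠ 0) : IsUnit (((deformedUnit z D ^ m : (PrimitiveLocalization k)ˣ) :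
      PrimitiveLocalization k) - 1) := by
    have := IsLocalization.map_units (PrimitiveLocalization k)
      ⟨_, pow_sub_one_mem_primitiveSeries z hD hm⟩
    simpa [val_deformedUnit] using this
  obtain ⟨m, rfl | rfl⟩ := n.eq_nat_or_neg
  · simpa using key m (by simpa using hn)
  · have h := ((deformedUnit z D ^ (-(m : ℤ)) : (PrimitiveLocalization k)ˣ).isUnit.mul
      (key m (by simpa using hn))).neg
    convert h using 1
    rw [mul_sub, ← Units.val_mul, zpow_neg, zpow_natCast, inv_mul_cancel]
    simp

/-- This is what localization buys: exponents count as integers and no longer modulo the order of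
the root of unity, so distinct deformed character values can be separated. -/
lemma isUnit_deformedUnit_zpow_sub_zpow {k : Type u} [CommRing k] [IsDomain k] (z : kˣ) {D : k⟦X⟧}
    (hD : D ∈ primitiveSeries k) {m n : ℤ} (hmn : m ≠ n) :
    IsUnit (((deformedUnit z D ^ m : (PrimitiveLocalization k)ˣ) : PrimitiveLocalization k) -
      ((deformedUnit z D ^ n : (PrimitiveLocalization k)ˣ) : PrimitiveLocalization k)) := by
  have h := (deformedUnit z D ^ n : (PrimitiveLocalization k)ˣ).isUnit.mul
    (isUnit_deformedUnit_zpow_sub_one z hD (sub_ne_zero.2 hmn))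
  rwa [mul_sub, ← Units.val_mul, ← zpow_add, add_sub_cancel, mul_one] at h

/-! ### Split algebras and lattices spanning them. -/

/-- The model is `f a` = E_{a0}, `g a` = E_{0a}. Columns and rows are transformed by the same matrix
`m x`, so moving its entries across the tensor sign exchanges left and right multiplication. -/
lemma isSeparableAlgebra_of_matrixUnits {R : Type u} [CommRing R] {A : Type v} [Ring A]
    [Algebra R A] {I : Type*} [Fintype I] (f g : I → A) (m : A → I → I → R)
    (hf : ∀ x a, x * f a = ∑ b, m x b a • f b) (hg : ∀ x a, g a * x = ∑ b, m x a b • g b)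
    (h1 : ∑ a, f a * g a = 1) : IsSeparableAlgebra R A := by
  refine ⟨∑ a, f a ⊗ₜ g a, fun x ↦ ?_, by simpa using h1⟩
  rw [Finset.mul_sum, Finset.sum_mul]
  simp only [Algebra.TensorProduct.tmul_mul_tmul, one_mul, mul_one, hf, hg, TensorProduct.sum_tmul,
    TensorProduct.tmul_sum, TensorProduct.smul_tmul, TensorProduct.tmul_smul]
  exact Finset.sum_comm

/-- The idempotent is the sum of E_{a0} ⊗ E_{0a} over the rows of all blocks. Positivity of the
block sizes provides the index 0. -/
lemma IsSplitAlgebra.isSeparableAlgebra {R : Type u} [CommRing R] {A : Type v} [Ring A]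
    [Algebra R A] (h : IsSplitAlgebra R A) : IsSeparableAlgebra R A := by
  obtain ⟨r, d, hd, ⟨φ⟩⟩ := h
  refine isSeparableAlgebra_of_matrixUnits (I := Σ i, Fin (d i))
    (fun a ↦ φ.symm (Pi.single a.1 (Matrix.single a.2 ⟨0, hd a.1⟩ 1)))
    (fun a ↦ φ.symm (Pi.single a.1 (Matrix.single ⟨0, hd a.1⟩ a.2 1)))
    (fun x ↦ Matrix.blockDiagonal' (φ x)) ?_ ?_ ?_
  · rintro x ⟨i, a⟩
    apply φ.injective
    simp only [map_mul, map_sum, map_smul, AlgEquiv.apply_symm_apply]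
    rw [Fintype.sum_sigma, Finset.sum_eq_single i]
    · ext j p q
      simp only [Matrix.blockDiagonal'_apply_eq]
      by_cases hj : j = i
      · subst hj
        simp [Matrix.sum_apply, Matrix.single_apply, Matrix.mul_apply]
        by_cases hq : ⟨0, hd j⟩ = q <;> simp [hq]
      · simp [Pi.single_eq_of_ne hj]
    · intro j _ hj
      simp [Matrix.blockDiagonal'_apply_ne _ _ _ hj]
    · simp
  · rintro x ⟨i, a⟩
    apply φ.injective
    simp only [map_mul, map_sum, map_smul, AlgEquiv.apply_symm_apply]
    rw [Fintype.sum_sigma, Finset.sum_eq_single i]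
    · ext j p q
      simp only [Matrix.blockDiagonal'_apply_eq]
      by_cases hj : j = i
      · subst hj
        simp [Matrix.sum_apply, Matrix.single_apply, Matrix.mul_apply]
        by_cases hq : ⟨0, hd j⟩ = p <;> simp [hq]
      · simp [Pi.single_eq_of_ne hj]
    · intro j _ hj
      simp [Matrix.blockDiagonal'_apply_ne _ _ _ (Ne.symm hj)]
    · simp
  · apply φ.injective
    simp only [map_mul, map_sum, map_one, AlgEquiv.apply_symm_apply]
    rw [Fintype.sum_sigma]
    ext j p q
    simp only [← Pi.single_mul, Matrix.single_mul_single_same, mul_one]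
    simp only [Finset.sum_apply, Matrix.sum_apply]
    rw [Finset.sum_eq_single j]
    · simp [Matrix.single_apply, Matrix.one_apply]
      by_cases hq : p = q
      · simp [hq, Finset.filter_eq']
      · have h (x : Fin (d j)) : ¬ (x = p ∧ x = q) := by
          rintro ⟨rfl, h⟩
          exact hq h
        simp [hq, h]
    · intro i _ hi
      simp [Pi.single_eq_of_ne (Ne.symm hi)]
    · simp

/-- A family of elements of a split algebra over the localization, indexed by `W` and multiplying
like the elements of `W` modulo `t`, spans a split global solution as soon as it spans the whole
split algebra over the localization. -/
theorem hasSplitGlobalSolution_of_span {k : Type u} [CommRing k] [IsDomain k] {W : Type v} [Group W]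
    [Finite W] {r : ℕ} {d : Fin r → ℕ} (hd : ∀ i, 0 < d i)
    (b : W → ((i : Fin r) → Matrix (Fin (d i)) (Fin (d i)) (PrimitiveLocalization k)))
    (hspan : Submodule.span (PrimitiveLocalization k) (Set.range b) = ⊤)
    (hcard : Nat.card W = ∑ i, d i ^ 2) (h1 : b 1 = 1)
    (hmul : ∀ v w, ∃ m ∈ Submodule.span k⟦X⟧ (Set.range b),
      b v * b w = b (v * w) + (PowerSeries.X : k⟦X⟧) • m) :
    HasSplitGlobalSolution k W := by
  have := Fintype.ofFinite W
  have hdom : IsDomain (PrimitiveLocalization k) :=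
    IsLocalization.isDomain_localization (primitiveSeries_le_nonZeroDivisors k)
  -- The family has as many members as the rank of the split algebra, so spanning already makes it a
  -- basis.
  let bR := basisOfTopLeSpanOfCardEqFinrank b hspan.ge (by
    rw [← Nat.card_eq_fintype_card, hcard, Module.finrank_pi_fintype]
    simp [Module.finrank_matrix, sq])
  have hbR : ⇑bR = b := coe_basisOfTopLeSpanOfCardEqFinrank ..
  have hinj := IsLocalization.injective (PrimitiveLocalization k)
    (primitiveSeries_le_nonZeroDivisors k)
  have hli : LinearIndependent k⟦X⟧ b := by
    refine LinearIndependent.restrict_scalars (R := k⟦X⟧) (K := PrimitiveLocalization k) ?_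
      (hbR ▸ bR.linearIndependent)
    simpa [← Algebra.algebraMap_eq_smul_one] using hinj
  let N := Submodule.span k⟦X⟧ (Set.range b)
  have hN : ∀ x y, x ∈ N → y ∈ N → x * y ∈ N := by
    intro x y hx hy
    induction hx using Submodule.span_induction with
    | mem x hx =>
      obtain ⟨v, rfl⟩ := hx
      induction hy using Submodule.span_induction with
      | mem y hy =>
        obtain ⟨w, rfl⟩ := hy
        obtain ⟨m, hm, h⟩ := hmul v w
        rw [h]
        exact add_mem (Submodule.subset_span ⟨_, rfl⟩) (Submodule.smul_mem _ _ hm)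
      | zero => simp
      | add y z _ _ hy hz => rw [mul_add]; exact add_mem hy hz
      | smul c y _ hy => rw [mul_smul_comm]; exact Submodule.smul_mem _ _ hy
    | zero => simp
    | add y z _ _ hy hz => rw [add_mul]; exact add_mem hy hz
    | smul c y _ hy => rw [smul_mul_assoc]; exact Submodule.smul_mem _ _ hy
  let B := N.toSubalgebra (h1 ▸ Submodule.subset_span ⟨_, rfl⟩) hN
  let bB : Module.Basis W k⟦X⟧ B := Module.Basis.span hli
  have hbB (w : W) : (bB w : (i : Fin r) → Matrix (Fin (d i)) (Fin (d i)) _) = b w :=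
    congrArg Subtype.val (Module.Basis.span_apply hli w)
  let φ : B ≃ₗ[k⟦X⟧] MonoidAlgebra k⟦X⟧ W :=
    bB.repr.trans (MonoidAlgebra.coeffLinearEquiv k⟦X⟧).symm
  have hφ (w : W) : φ (bB w) = MonoidAlgebra.single w 1 := by
    simp [φ]
  have hdef : IsGroupAlgebraDeformation k W B := by
    refine ⟨φ, fun x y ↦ ?_⟩
    have hsm (c : k⟦X⟧) (x : B) : MonoidAlgebra.mapRingHom W (PowerSeries.constantCoeff (R := k))
        (φ (c • x)) = PowerSeries.constantCoeff c •
          MonoidAlgebra.mapRingHom W (PowerSeries.constantCoeff (R := k)) (φ x) := by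
      ext w
      simp
    have hx : x ∈ Submodule.span k⟦X⟧ (Set.range bB) := by rw [bB.span_eq]; trivial
    have hy : y ∈ Submodule.span k⟦X⟧ (Set.range bB) := by rw [bB.span_eq]; trivial
    induction hx using Submodule.span_induction with
    | mem x hx =>
      obtain ⟨v, rfl⟩ := hx
      induction hy using Submodule.span_induction with
      | mem y hy =>
        obtain ⟨w, rfl⟩ := hy
        obtain ⟨m, hm, h⟩ := hmul v w
        have h2 : bB v * bB w = bB (v * w) + (PowerSeries.X : k⟦X⟧) • (⟨m, hm⟩ : B) := by
          apply Subtype.ext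
          simpa [hbB] using h
        rw [h2, map_add, map_add, hsm, hφ, hφ, hφ]
        simp [MonoidAlgebra.single_mul_single]
      | zero => simp
      | add y z _ _ hy hz => simp only [mul_add, map_add, hy, hz]
      | smul c y _ hy => rw [mul_smul_comm, hsm, hy, hsm, mul_smul_comm]
    | zero => simp
    | add y z _ _ hy hz => simp only [add_mul, map_add, hy, hz]
    | smul c y _ hy => rw [smul_mul_assoc, hsm, hy, hsm, smul_mul_assoc]
  have hcomm (x : PrimitiveLocalization k) (y : B) :
      Commute (Algebra.ofId (PrimitiveLocalization k)
        ((i : Fin r) → Matrix (Fin (d i)) (Fin (d i)) (PrimitiveLocalization k)) x) (B.val y) :=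
    Algebra.commutes _ _
  let F : PrimitiveLocalization k ⊗[k⟦X⟧] B →ₐ[PrimitiveLocalization k]
      ((i : Fin r) → Matrix (Fin (d i)) (Fin (d i)) (PrimitiveLocalization k)) :=
    Algebra.TensorProduct.lift (Algebra.ofId _ _) B.val hcomm
  let bT := Algebra.TensorProduct.basis (PrimitiveLocalization k) bB
  -- The multiplication map sends the base change of the basis of `B` to `bR`, hence is bijective.
  have hF : F.toLinearMap = (bT.equiv bR (Equiv.refl W)).toLinearMap := by
    refine bT.ext fun w ↦ ?_
    rw [LinearEquiv.coe_coe, Module.Basis.equiv_apply, Equiv.refl_apply, hbR,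
      Algebra.TensorProduct.basis_apply]
    refine (Algebra.TensorProduct.lift_tmul (Algebra.ofId _ _) B.val hcomm _ _).trans ?_
    rw [map_one, one_mul]
    exact hbB w
  have hbij : Function.Bijective F := by
    have : ⇑F = bT.equiv bR (Equiv.refl W) := congrArg DFunLike.coe hF
    rw [this]
    exact LinearEquiv.bijective _
  have hsplit : IsSplitAlgebra (PrimitiveLocalization k) (PrimitiveLocalization k ⊗[k⟦X⟧] B) :=
    ⟨r, d, hd, ⟨AlgEquiv.ofBijective F hbij⟩⟩
  refine ⟨B, inferInstance, inferInstance, primitiveSeries k,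
    ⟨hdef, zero_notMem_primitiveSeries k, ?_, hsplit.isSeparableAlgebra⟩, hsplit⟩
  exact fun p _ _ P hP _ s hs hsP ↦ hs P hP (PowerSeries.map_mk_eq_zero_of_mem_map_C hsP)

/-- Version of `hasSplitGlobalSolution_of_span` for matrices that are block diagonal with respect
to the fibres of a map. -/
theorem hasSplitGlobalSolution_of_blocks {k : Type u} [CommRing k] [IsDomain k] {W : Type v}
    [Group W] [Finite W] {X : Type*} [Fintype X] [DecidableEq X] {Λ : Type*} (l : X → Λ)
    (b : W → Matrix X X (PrimitiveLocalization k))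
    (hsupp : ∀ w x y, b w x y ≠ 0 → l x = l y)
    (hspan : ∀ x y, l x = l y →
      Matrix.single x y 1 ∈ Submodule.span (PrimitiveLocalization k) (Set.range b))
    (hcard : Nat.card W = Nat.card {p : X × X // l p.1 = l p.2}) (h1 : b 1 = 1)
    (hmul : ∀ v w, ∃ m ∈ Submodule.span k⟦X⟧ (Set.range b),
      b v * b w = b (v * w) + (PowerSeries.X : k⟦X⟧) • m) :
    HasSplitGlobalSolution k W := by
  classical
  obtain ⟨r, ⟨e0⟩⟩ := Finite.exists_equiv_fin (Set.range l)
  let c (x : X) : Fin r := e0 ⟨l x, x, rfl⟩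
  have hc (x y : X) : c x = c y ↔ l x = l y :=
    e0.injective.eq_iff.trans Subtype.mk_eq_mk
  have hcs (i : Fin r) : ∃ x, c x = i := by
    obtain ⟨x, hx⟩ := (e0.symm i).2
    exact ⟨x, by simp [c, hx]⟩
  let d (i : Fin r) : ℕ := Fintype.card {x // c x = i}
  have hd (i : Fin r) : 0 < d i := Fintype.card_pos_iff.2 ⟨⟨_, (hcs i).choose_spec⟩⟩
  let e : X ≃ Σ i, Fin (d i) :=
    (Equiv.sigmaFiberEquiv c).symm.trans (Equiv.sigmaCongrRight fun i ↦ Fintype.equivFin _)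
  have he (i : Fin r) (a : Fin (d i)) : c (e.symm ⟨i, a⟩) = i :=
    ((Fintype.equivFin {x // c x = i}).symm a).2
  let F : Matrix X X (PrimitiveLocalization k) →ₗ[PrimitiveLocalization k]
      ((i : Fin r) → Matrix (Fin (d i)) (Fin (d i)) (PrimitiveLocalization k)) :=
    { toFun M i := M.submatrix (fun a ↦ e.symm ⟨i, a⟩) (fun a ↦ e.symm ⟨i, a⟩)
      map_add' _ _ := rfl
      map_smul' _ _ := rfl }
  -- Cutting out diagonal blocks is multiplicative only because the left factor has no entries
  -- between different blocks.
  have hFmul (w : W) (M : Matrix X X (PrimitiveLocalization k)) : F (b w * M) = F (b w) * F M := by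
    ext i p q
    change (b w * M) (e.symm ⟨i, p⟩) (e.symm ⟨i, q⟩) = (F (b w) i * F M i) p q
    rw [Matrix.mul_apply, Matrix.mul_apply, ← e.symm.sum_comp, Fintype.sum_sigma, Finset.sum_eq_single i]
    · rfl
    · intro j _ hj
      refine Finset.sum_eq_zero fun a _ ↦ ?_
      rw [show b w (e.symm ⟨i, p⟩) (e.symm ⟨j, a⟩) = 0 from ?_, zero_mul]
      by_contra h
      have := (hc _ _).2 (hsupp _ _ _ h)
      rw [he, he] at this
      exact hj this.symm
    · simp
  refine hasSplitGlobalSolution_of_span hd (fun w ↦ F (b w)) ?_ ?_ ?_ ?_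
  · rw [eq_top_iff]
    rintro n -
    let M : Matrix X X (PrimitiveLocalization k) := (Matrix.blockDiagonal' n).submatrix e e
    have hM : F M = n := by
      ext i p q
      change Matrix.blockDiagonal' n (e (e.symm _)) (e (e.symm _)) = _
      rw [e.apply_symm_apply, e.apply_symm_apply, Matrix.blockDiagonal'_apply_eq]
    have hMs : M ∈ Submodule.span (PrimitiveLocalization k) (Set.range b) := by
      rw [Matrix.matrix_eq_sum_single M]
      refine Submodule.sum_mem _ fun x _ ↦ Submodule.sum_mem _ fun y _ ↦ ?_
      by_cases hxy : l x = l y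
      · rw [← mul_one (M x y), ← smul_eq_mul, ← Matrix.smul_single]
        exact Submodule.smul_mem _ _ (hspan x y hxy)
      · have h0 : M x y = 0 := by
          change Matrix.blockDiagonal' n (e x) (e y) = 0
          refine Matrix.blockDiagonal'_apply_ne n _ _ fun h ↦ hxy ?_
          rw [← hc]
          exact h
        simp [h0]
    have h := Submodule.mem_map_of_mem (f := F) hMs
    rwa [hM, Submodule.map_span, ← Set.range_comp] at h
  · rw [hcard, ← Fintype.card_fin (∑ i, d i ^ 2), ← Nat.card_eq_fintype_card]
    have e1 : {p : X × X // l p.1 = l p.2} ≃ Σ i, {x // c x = i} × {x // c x = i} :=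
      { toFun p := ⟨c p.1.1, ⟨p.1.1, rfl⟩, ⟨p.1.2, ((hc _ _).2 p.2).symm⟩⟩
        invFun s := ⟨(s.2.1.1, s.2.2.1), (hc _ _).1 (s.2.1.2.trans s.2.2.2.symm)⟩
        left_inv p := rfl
        right_inv := by
          rintro ⟨i, ⟨x, rfl⟩, y⟩
          rfl }
    rw [Nat.card_congr e1, Nat.card_eq_fintype_card, Nat.card_eq_fintype_card, Fintype.card_sigma,
      Fintype.card_fin]
    exact Finset.sum_congr rfl fun i _ ↦ by rw [Fintype.card_prod, sq]
  · rw [h1]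
    ext i p q
    change (1 : Matrix X X _) _ _ = _
    simp [Matrix.one_apply]
  · intro v w
    obtain ⟨m, hm, h⟩ := hmul v w
    refine ⟨F m, ?_, ?_⟩
    · have h := Submodule.mem_map_of_mem (f := F.restrictScalars k⟦X⟧) hm
      rwa [Submodule.map_span, ← Set.range_comp] at h
    · rw [← hFmul, h, map_add]
      exact congrArg _ ((F.restrictScalars k⟦X⟧).map_smul _ _)

/-! ### Functions on a finite set and the criterion for wreath products. -/

/-- A subalgebra of functions on a finite set that separates points, with unit differences, is
everything. -/
lemma Subalgebra.pi_eq_top_of_separates {R : Type u} [CommRing R] {X : Type v} [Fintype X]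
    (A : Subalgebra R (X → R)) (h : ∀ x y, x ≠ y → ∃ f ∈ A, IsUnit (f x - f y)) : A = ⊤ := by
  classical
  have hs (x : X) : Pi.single x 1 ∈ A := by
    -- Lagrange interpolation: the product over `y` of functions that are 1 at `x` and 0 at `y` is
    -- the indicator of `x`.
    have h' (y : X) : ∃ g ∈ A, g x = 1 ∧ (y ≠ x → g y = 0) := by
      by_cases hy : x = y
      · exact ⟨1, one_mem _, rfl, fun h ↦ absurd hy.symm h⟩
      · obtain ⟨f, hf, u, hu⟩ := h x y hy
        refine ⟨(↑u⁻¹ : R) • (f - algebraMap R _ (f y)),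
          A.smul_mem (sub_mem hf (A.algebraMap_mem _)) _, ?_, fun _ ↦ ?_⟩
        · simp [Pi.algebraMap_apply, ← hu]
        · simp [Pi.algebraMap_apply]
    choose g hg hg1 hg0 using h'
    convert prod_mem (S := A) (fun y (_ : y ∈ Finset.univ) ↦ hg y) using 1
    ext y
    rw [Finset.prod_apply]
    by_cases hy : y = x
    · subst hy
      rw [Pi.single_eq_same, Finset.prod_eq_one fun z _ ↦ hg1 z]
    · rw [Pi.single_eq_of_ne hy]
      exact (Finset.prod_eq_zero (f := fun c ↦ g c y) (Finset.mem_univ y) (hg0 y hy)).symm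
  rw [eq_top_iff]
  rintro f -
  rw [pi_eq_sum_univ f]
  refine sum_mem fun x _ ↦ A.smul_mem ?_ _
  convert hs x using 1
  ext y
  simp [Pi.single_apply, eq_comm]

/-- The `k⟦X⟧`-span of the products of the matrices `T g` with the diagonal matrices given by
functions with values in `k⟦X⟧` that factor through `π`. -/
noncomputable def diagonalSpan {k : Type u} [CommRing k] {X Y G : Type*} [Fintype X] [DecidableEq X]
    (π : X → Y) (T : G → Matrix X X (PrimitiveLocalization k)) :
    Submodule k⟦X⟧ (Matrix X X (PrimitiveLocalization k)) :=
  Submodule.span k⟦X⟧ {m | ∃ (f : Y → k⟦X⟧) (g : G),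
    m = Matrix.diagonal (fun x ↦ algebraMap k⟦X⟧ (PrimitiveLocalization k) (f (π x))) * T g}

/-- The support condition says that `T` moves base points along `s`, so a function of the base point
passes through `T` at the cost of composing with `s`. This plays the role of the semidirect product
relation. -/
lemma Matrix.mul_diagonal_comp_eq {R X Y : Type*} [CommRing R] [Fintype X] [DecidableEq X]
    (π : X → Y) (s : Y → Y) (T : Matrix X X R) (hT : ∀ x x', T x x' ≠ 0 → π x' = s (π x))
    (f : Y → R) :
    T * Matrix.diagonal (f ∘ π) = Matrix.diagonal ((f ∘ s) ∘ π) * T := by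
  ext x x'
  rw [Matrix.mul_diagonal, Matrix.diagonal_mul, mul_comm]
  by_cases h : T x x' = 0
  · simp [h]
  · simp [hT x x' h]

/-- A criterion for the wreath product `H ≀ G`: the group algebra of `H ^ n` is deformed to the
lattice spanned by the functions `β h` on a finite set, and `G` to a family of matrices
`T g` that permutes these functions. -/
theorem hasSplitGlobalSolution_wreathProduct {k : Type} [CommRing k] [IsDomain k] {n : ℕ}
    {H : Type u} [Group H] [Finite H] {G : Type v} [Group G] [Finite G]
    (σ : G →* Equiv.Perm (Fin n)) {J : Type*}
    (β : (Fin n → H) → (Fin n → J) → PrimitiveLocalization k) (hβ1 : β 1 = 1)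
    (hβmul : ∀ h h', ∃ m ∈ Submodule.span k⟦X⟧ (Set.range β),
      β h * β h' = β (h * h') + (PowerSeries.X : k⟦X⟧) • m)
    (hβact : ∀ g h y, β h (y ∘ σ g) = β (fun i ↦ h ((σ g)⁻¹ i)) y)
    (hβspan : Submodule.span (PrimitiveLocalization k) (Set.range β) = ⊤)
    (D : k⟦X⟧) (hD : ∀ f : (Fin n → J) → k⟦X⟧,
      (fun y ↦ algebraMap k⟦X⟧ (PrimitiveLocalization k) (D * f y)) ∈
        Submodule.span k⟦X⟧ (Set.range β))
    {X Λ : Type*} [Fintype X] [DecidableEq X] (π : X → (Fin n → J)) (l : X → Λ)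
    (T : G → Matrix X X (PrimitiveLocalization k)) (hT1 : T 1 = 1)
    (hTl : ∀ g x x', T g x x' ≠ 0 → l x = l x')
    (hTπ : ∀ g x x', T g x x' ≠ 0 → π x' = π x ∘ σ g)
    (hTmul : ∀ g g', ∃ m ∈ diagonalSpan π T, T g * T g' = T (g * g') + (PowerSeries.X * D) • m)
    (hcard : Nat.card {p : X × X // l p.1 = l p.2} = Nat.card H ^ n * Nat.card G)
    (hgen : ∀ A : Subalgebra (PrimitiveLocalization k) (Matrix X X (PrimitiveLocalization k)),
      (∀ f : (Fin n → J) → PrimitiveLocalization k, Matrix.diagonal (f ∘ π) ∈ A) →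
      (∀ g, T g ∈ A) → ∀ x y, l x = l y → Matrix.single x y 1 ∈ A) :
    HasSplitGlobalSolution k (WreathProduct H σ) := by
  have : Finite (WreathProduct H σ) := Finite.of_equiv _ SemidirectProduct.equivProd.symm
  -- Modelled on the factorization of a group element into its part in `H ^ n` and its part in `G`.
  let b (w : WreathProduct H σ) : Matrix X X (PrimitiveLocalization k) :=
    Matrix.diagonal (β w.left ∘ π) * T w.right
  let Δ : ((Fin n → J) → PrimitiveLocalization k) →ₗ[k⟦X⟧]
      Matrix X X (PrimitiveLocalization k) :=
    { toFun f := Matrix.diagonal (f ∘ π)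
      map_add' f g := by
        rw [Matrix.diagonal_add]
        rfl
      map_smul' c f := by
        rw [RingHom.id_apply, ← Matrix.diagonal_smul]
        rfl }
  have hΔ (f) : Δ f = Matrix.diagonal (f ∘ π) := rfl
  have hΔmul (f g) : Δ (f * g) = Δ f * Δ g := by
    rw [hΔ, hΔ, hΔ, Matrix.diagonal_mul_diagonal]
    rfl
  have hb (w) : b w = Δ (β w.left) * T w.right := rfl
  let B := Submodule.span k⟦X⟧ (Set.range b)
  have hβmul' (u u') (hu : u ∈ Submodule.span k⟦X⟧ (Set.range β))
      (hu' : u' ∈ Submodule.span k⟦X⟧ (Set.range β)) :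
      u * u' ∈ Submodule.span k⟦X⟧ (Set.range β) := by
    induction hu using Submodule.span_induction with
    | mem u hu =>
      obtain ⟨h, rfl⟩ := hu
      induction hu' using Submodule.span_induction with
      | mem u' hu' =>
        obtain ⟨h', rfl⟩ := hu'
        obtain ⟨m, hm, h⟩ := hβmul h h'
        rw [h]
        exact add_mem (Submodule.subset_span ⟨_, rfl⟩) (Submodule.smul_mem _ _ hm)
      | zero => simp
      | add y z _ _ hy hz => rw [mul_add]; exact add_mem hy hz
      | smul c y _ hy => rw [mul_smul_comm]; exact Submodule.smul_mem _ _ hy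
    | zero => simp
    | add y z _ _ hy hz => rw [add_mul]; exact add_mem hy hz
    | smul c y _ hy => rw [smul_mul_assoc]; exact Submodule.smul_mem _ _ hy
  have hc1 (u) (hu : u ∈ Submodule.span k⟦X⟧ (Set.range β)) (g : G) : Δ u * T g ∈ B := by
    induction hu using Submodule.span_induction with
    | mem u hu =>
      obtain ⟨h, rfl⟩ := hu
      exact Submodule.subset_span ⟨⟨h, g⟩, rfl⟩
    | zero => simp
    | add y z _ _ hy hz => rw [map_add, add_mul]; exact add_mem hy hz
    | smul c y _ hy => rw [map_smul, smul_mul_assoc]; exact Submodule.smul_mem _ _ hy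
  -- The coefficients in `diagonalSpan` are arbitrary functions and need not lie in the lattice of
  -- the `β h`. The factor `D` moves them into it, which is why `hTmul` carries `X * D`.
  have hc2 (m) (hm : m ∈ diagonalSpan π T) : D • m ∈ B := by
    induction hm using Submodule.span_induction with
    | mem m hm =>
      obtain ⟨f, g, rfl⟩ := hm
      convert hc1 _ (hD f) g using 1
      rw [hΔ, ← smul_mul_assoc, ← Matrix.diagonal_smul]
      congr 2
      ext x
      simp [Algebra.smul_def]
    | zero => simp
    | add y z _ _ hy hz => rw [smul_add]; exact add_mem hy hz
    | smul c y _ hy => rw [smul_comm]; exact Submodule.smul_mem _ _ hy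
  have hc3 (u) (hu : u ∈ Submodule.span k⟦X⟧ (Set.range β)) (m) (hm : m ∈ B) : Δ u * m ∈ B := by
    induction hm using Submodule.span_induction with
    | mem m hm =>
      obtain ⟨w, rfl⟩ := hm
      rw [hb, ← mul_assoc, ← hΔmul]
      exact hc1 _ (hβmul' _ _ hu (Submodule.subset_span ⟨_, rfl⟩)) _
    | zero => simp
    | add y z _ _ hy hz => rw [mul_add]; exact add_mem hy hz
    | smul c y _ hy => rw [mul_smul_comm]; exact Submodule.smul_mem _ _ hy
  have hmul (v w) : ∃ m ∈ B, b v * b w = b (v * w) + (PowerSeries.X : k⟦X⟧) • m := by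
    have hact : β w.left ∘ (fun y ↦ y ∘ σ v.right) =
        β (((mulAutArrow (G := Equiv.Perm (Fin n)) (A := Fin n) (M := H)).comp σ) v.right
          w.left) := by
      ext y
      exact hβact _ _ _
    obtain ⟨m1, hm1, h1⟩ := hβmul v.left
      (((mulAutArrow (G := Equiv.Perm (Fin n)) (A := Fin n) (M := H)).comp σ) v.right w.left)
    obtain ⟨m2, hm2, h2⟩ := hTmul v.right w.right
    refine ⟨Δ m1 * T (v.right * w.right) + Δ (β v.left * β (((mulAutArrow
      (G := Equiv.Perm (Fin n)) (A := Fin n) (M := H)).comp σ) v.right w.left)) * (D • m2),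
      add_mem (hc1 _ hm1 _) (hc3 _ (hβmul' _ _ (Submodule.subset_span ⟨_, rfl⟩)
        (Submodule.subset_span ⟨_, rfl⟩)) _ (hc2 _ hm2)), ?_⟩
    have h3 : b v * b w = Δ (β v.left) * (T v.right * Δ (β w.left)) * T w.right := by
      simp only [hb, mul_assoc]
    rw [h3, hΔ (β w.left), Matrix.mul_diagonal_comp_eq π (fun y ↦ y ∘ σ v.right) _ (hTπ _), hact,
      ← hΔ, ← mul_assoc, mul_assoc, ← hΔmul, h2, mul_add, hb, SemidirectProduct.mul_left,
      SemidirectProduct.mul_right]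
    nth_rw 1 [h1]
    rw [map_add, add_mul, map_smul, smul_mul_assoc, smul_add, mul_smul, mul_smul_comm, add_assoc]
  have hb1 : b 1 = 1 := by
    rw [hb, SemidirectProduct.one_left, SemidirectProduct.one_right, hβ1, hT1, mul_one, hΔ]
    exact Matrix.diagonal_one
  refine hasSplitGlobalSolution_of_blocks l b ?_ ?_ ?_ hb1 hmul
  · intro w x y h
    refine hTl w.right x y fun h0 ↦ h ?_
    simp [b, Matrix.diagonal_mul, h0]
  · have hBle (m) (hm : m ∈ B) :
        m ∈ Submodule.span (PrimitiveLocalization k) (Set.range b) :=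
      Submodule.span_le_restrictScalars k⟦X⟧ (PrimitiveLocalization k) _ hm
    have hAmul (u u') (hu : u ∈ Submodule.span (PrimitiveLocalization k) (Set.range b))
        (hu' : u' ∈ Submodule.span (PrimitiveLocalization k) (Set.range b)) :
        u * u' ∈ Submodule.span (PrimitiveLocalization k) (Set.range b) := by
      induction hu using Submodule.span_induction with
      | mem u hu =>
        obtain ⟨v, rfl⟩ := hu
        induction hu' using Submodule.span_induction with
        | mem u' hu' =>
          obtain ⟨w, rfl⟩ := hu'
          obtain ⟨m, hm, h⟩ := hmul v w
          rw [h]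
          exact hBle _ (add_mem (Submodule.subset_span ⟨_, rfl⟩) (Submodule.smul_mem _ _ hm))
        | zero => simp
        | add y z _ _ hy hz => rw [mul_add]; exact add_mem hy hz
        | smul c y _ hy => rw [mul_smul_comm]; exact Submodule.smul_mem _ _ hy
      | zero => simp
      | add y z _ _ hy hz => rw [add_mul]; exact add_mem hy hz
      | smul c y _ hy => rw [smul_mul_assoc]; exact Submodule.smul_mem _ _ hy
    refine hgen ((Submodule.span (PrimitiveLocalization k) (Set.range b)).toSubalgebra
      (hb1 ▸ Submodule.subset_span ⟨_, rfl⟩) hAmul) ?_ ?_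
    · intro f
      have hf : f ∈ Submodule.span (PrimitiveLocalization k) (Set.range β) := hβspan ▸ trivial
      change _ ∈ Submodule.span _ _
      induction hf using Submodule.span_induction with
      | mem f hf =>
        obtain ⟨h, rfl⟩ := hf
        refine Submodule.subset_span ⟨⟨h, 1⟩, ?_⟩
        simp [b, hT1]
      | zero => simp
      | add y z _ _ hy hz =>
        convert add_mem hy hz using 1
        rw [Matrix.diagonal_add]
        rfl
      | smul c y _ hy =>
        convert Submodule.smul_mem _ c hy using 1
        rw [← Matrix.diagonal_smul]
        rfl
    · intro g
      change _ ∈ Submodule.span _ _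
      refine Submodule.subset_span ⟨⟨1, g⟩, ?_⟩
      rw [hb, SemidirectProduct.mk_eq_inl_mul_inr]
      simp [hβ1, hΔ]
  · rw [hcard, Nat.card_congr SemidirectProduct.equivProd, Nat.card_prod, Nat.card_fun,
      Nat.card_fin]

/-! ### Deformed characters of finite abelian groups. -/

/-- If the points `y ^ j` are the roots of a deformation of `X ^ m - 1`, then the function
`y ^ j ↦ y ^ (j e)` is a combination of those for `0 ≤ e < m`, which reduces to the obvious one. -/
lemma exists_zpow_eq_sum_of_prod_eq {Q : Type u} [CommRing Q] (ε : Q) {m : ℕ} (hm : 0 < m) (y : Qˣ)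
    (hy : (∏ j ∈ Finset.range m, (Polynomial.X - Polynomial.C ((y ^ j : Qˣ) : Q))).map
      (Ideal.Quotient.mk (Ideal.span {ε})) = Polynomial.X ^ m - 1) (e : ℤ) :
    ∃ c : Fin m → Q, (∀ i, ε ∣ c i - if ((i : ℕ) : ℤ) ≡ e [ZMOD m] then 1 else 0) ∧
      ∀ j < m, (((y ^ j) ^ e : Qˣ) : Q) = ∑ i, c i * ((y ^ j : Qˣ) : Q) ^ (i : ℕ) := by
  set f := ∏ j ∈ Finset.range m, (Polynomial.X - Polynomial.C ((y ^ j : Qˣ) : Q)) with hf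
  set q := Ideal.Quotient.mk (Ideal.span {ε}) with hq
  have hfm : f.Monic := Polynomial.monic_prod_of_monic _ _ fun j _ ↦ Polynomial.monic_X_sub_C _
  have hfd (P : Polynomial Q) : P %ₘ f = 0 ∨ (P %ₘ f).natDegree < m := by
    nontriviality Q
    have h1 : f.natDegree = m := by
      rw [hf, Polynomial.natDegree_prod_of_monic _ _ fun j _ ↦ Polynomial.monic_X_sub_C _]
      simp only [Polynomial.natDegree_X_sub_C]
      simp
    right
    have h2 := Polynomial.natDegree_modByMonic_lt P hfm (by
      intro h
      rw [h, Polynomial.natDegree_one] at h1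
      omega)
    rwa [h1] at h2
  have hroot (j : ℕ) (hj : j < m) : f.eval ((y ^ j : Qˣ) : Q) = 0 := by
    rw [hf, Polynomial.eval_prod]
    exact Finset.prod_eq_zero (Finset.mem_range.2 hj) (by simp)
  -- With invertible constant term, `X` is invertible modulo `f`, which makes negative `e`
  -- accessible to polynomials.
  have hu : IsUnit (f.coeff 0) := by
    rw [Polynomial.coeff_zero_eq_eval_zero, hf, Polynomial.eval_prod]
    refine (IsUnit.prod_iff).2 fun j _ ↦ ?_
    rw [Polynomial.eval_sub, Polynomial.eval_X, Polynomial.eval_C, zero_sub]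
    exact (Units.isUnit _).neg
  obtain ⟨P, N, hPN, hP, hPe⟩ : ∃ (P : Polynomial Q) (N : ℕ), (N : ℤ) ≡ e [ZMOD m] ∧
      P.map q = Polynomial.X ^ N ∧
      ∀ j < m, P.eval ((y ^ j : Qˣ) : Q) = (((y ^ j) ^ e : Qˣ) : Q) := by
    obtain ⟨n, rfl | rfl⟩ := e.eq_nat_or_neg
    · exact ⟨Polynomial.X ^ n, n, rfl, by simp, fun j _ ↦ by simp⟩
    · obtain ⟨v, hv⟩ := hu
      have h0 : q v = -1 := by
        have := congrArg (fun p ↦ Polynomial.coeff p 0) hy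
        simp only [Polynomial.coeff_map] at this
        rw [hv, this]
        simp [hm.ne]
      -- From f = X * divX f + v, the polynomial -v⁻¹ * divX f takes the value 1/x at each root x of
      -- f. It reduces to X^(m-1), so its n-th power reduces to the exponent (m-1)n, which is -n
      -- modulo m.
      refine ⟨(Polynomial.C (-(↑v⁻¹ : Q)) * f.divX) ^ n, (m - 1) * n, ?_, ?_, ?_⟩
      · rw [Int.modEq_iff_dvd]
        refine ⟨-n, ?_⟩
        push_cast [Nat.sub_add_cancel, Nat.cast_sub hm]
        ring
      · have h1 : q (-(↑v⁻¹ : Q)) = 1 := by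
          have h2 : q (v : Q) * q (↑v⁻¹ : Q) = 1 := by rw [← map_mul, Units.mul_inv, map_one]
          rw [h0] at h2
          rw [map_neg]
          linear_combination h2
        have h2 : f.divX.map q = Polynomial.X ^ (m - 1) := by
          ext i
          rw [Polynomial.coeff_map, Polynomial.coeff_divX, ← Polynomial.coeff_map, hy]
          obtain ⟨m, rfl⟩ : ∃ m', m = m' + 1 := ⟨m - 1, by omega⟩
          simp [Polynomial.coeff_X_pow, Polynomial.coeff_one]
        rw [Polynomial.map_pow, Polynomial.map_mul, Polynomial.map_C, h1, h2, map_one, one_mul,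
          pow_mul]
      · intro j hj
        have h3 := hroot j hj
        rw [← Polynomial.X_mul_divX_add f, Polynomial.eval_add, Polynomial.eval_mul,
          Polynomial.eval_X, Polynomial.eval_C, ← hv] at h3
        have h4 : (Polynomial.C (-(↑v⁻¹ : Q)) * f.divX).eval ((y ^ j : Qˣ) : Q) =
            (((y ^ j)⁻¹ : Qˣ) : Q) := by
          apply Units.eq_inv_of_mul_eq_one_left
          rw [Polynomial.eval_mul, Polynomial.eval_C]
          linear_combination -(↑v⁻¹ : Q) * h3 + v.inv_mul
        rw [Polynomial.eval_pow, h4, zpow_neg, zpow_natCast, ← Units.val_pow_eq_pow_val, inv_pow]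
  -- Division by `f` does not change the values at its roots. Modulo `ε` it is division of a power
  -- of `X` by X^m - 1, which reduces the exponent modulo `m`.
  refine ⟨fun i ↦ (P %ₘ f).coeff i, fun i ↦ ?_, fun j hj ↦ ?_⟩
  · rw [← Ideal.mem_span_singleton, ← Ideal.Quotient.eq, ← hq, ← Polynomial.coeff_map,
      Polynomial.map_modByMonic _ hfm, hy, hP]
    nontriviality (Q ⧸ Ideal.span {ε})
    have hd : Polynomial.degree (Polynomial.X ^ m - 1 : Polynomial (Q ⧸ Ideal.span {ε})) = m := by
      rw [← map_one Polynomial.C]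
      exact Polynomial.degree_X_pow_sub_C hm 1
    obtain ⟨s, hs⟩ : (Polynomial.X ^ m - 1 : Polynomial (Q ⧸ Ideal.span {ε})) ∣
        (Polynomial.X ^ m) ^ (N / m) - 1 := by
      simpa using sub_dvd_pow_sub_pow (Polynomial.X ^ m : Polynomial (Q ⧸ Ideal.span {ε})) 1 (N / m)
    have h5 : (Polynomial.X ^ N : Polynomial (Q ⧸ Ideal.span {ε})) %ₘ (Polynomial.X ^ m - 1) =
        Polynomial.X ^ (N % m) := by
      refine (Polynomial.div_modByMonic_unique (Polynomial.X ^ (N % m) * s) _ ?_ ⟨?_, ?_⟩).2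
      · rw [← map_one Polynomial.C]
        exact Polynomial.monic_X_pow_sub_C 1 hm.ne'
      · have h6 : (Polynomial.X ^ N : Polynomial (Q ⧸ Ideal.span {ε})) =
          Polynomial.X ^ (N % m) * (Polynomial.X ^ m) ^ (N / m) := by
          rw [← pow_mul, ← pow_add, Nat.mod_add_div]
        rw [h6]
        linear_combination -Polynomial.X ^ (N % m) * hs
      · rw [hd, Polynomial.degree_X_pow]
        exact_mod_cast Nat.mod_lt _ hm
    rw [h5, Polynomial.coeff_X_pow]
    have h7 : ((i : ℕ) = N % m) ↔ ((i : ℕ) : ℤ) ≡ e [ZMOD m] := by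
      refine Iff.trans ?_ (show ((i : ℕ) : ℤ) ≡ N [ZMOD m] ↔ _ from
        ⟨fun h ↦ h.trans hPN, fun h ↦ h.trans hPN.symm⟩)
      rw [Int.natCast_modEq_iff, Nat.ModEq, Nat.mod_eq_of_lt i.2]
    simp only [h7]
    split_ifs <;> simp
  · have h8 : P.eval ((y ^ j : Qˣ) : Q) = (P %ₘ f).eval ((y ^ j : Qˣ) : Q) := by
      conv_lhs => rw [← Polynomial.modByMonic_add_div P f]
      rw [Polynomial.eval_add, Polynomial.eval_mul, hroot j hj, zero_mul, add_zero]
    rw [← hPe j hj, h8]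
    rcases hfd P with h | h
    · simp [h]
    · rw [Polynomial.eval_eq_sum_range' h, Finset.sum_range]

/-- Several variable version of `exists_zpow_eq_sum_of_prod_eq`. -/
lemma exists_prod_zpow_eq_sum_of_prod_eq {Q : Type u} [CommRing Q] (ε : Q) {ι : Type v} [Fintype ι]
    [DecidableEq ι] (m : ι → ℕ) (hm : ∀ i, 0 < m i) (y : ι → Qˣ)
    (hy : ∀ i, (∏ j ∈ Finset.range (m i), (Polynomial.X - Polynomial.C ((y i ^ j : Qˣ) : Q))).map
      (Ideal.Quotient.mk (Ideal.span {ε})) = Polynomial.X ^ m i - 1) (e : ι → ℤ) :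
    ∃ c : ((i : ι) → Fin (m i)) → Q,
      (∀ κ, ε ∣ c κ - if ∀ i, ((κ i : ℕ) : ℤ) ≡ e i [ZMOD m i] then 1 else 0) ∧
      ∀ ψ : (i : ι) → Fin (m i), (∏ i, (((y i ^ (ψ i : ℕ)) ^ e i : Qˣ) : Q)) =
        ∑ κ, c κ * ∏ i, ((y i ^ (ψ i : ℕ) : Qˣ) : Q) ^ (κ i : ℕ) := by
  choose c hc hce using fun i ↦ exists_zpow_eq_sum_of_prod_eq ε (hm i) (y i) (hy i) (e i)
  refine ⟨fun κ ↦ ∏ i, c i (κ i), fun κ ↦ ?_, fun ψ ↦ ?_⟩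
  · rw [← Fintype.prod_boole, ← Ideal.mem_span_singleton, ← Ideal.Quotient.eq, map_prod, map_prod]
    refine Finset.prod_congr rfl fun i _ ↦ ?_
    rw [Ideal.Quotient.eq, Ideal.mem_span_singleton]
    exact hc i _
  · rw [Finset.prod_congr rfl fun i _ ↦ hce i _ (ψ i).2, Finset.prod_univ_sum, Fintype.piFinset_univ]
    exact Finset.sum_congr rfl fun κ _ ↦ Finset.prod_mul_distrib

lemma IsPrimitiveRoot.prod_range_X_sub_C_pow {k : Type u} [CommRing k] [IsDomain k] {ζ : k} {m : ℕ}
    (hm : 0 < m) (hζ : IsPrimitiveRoot ζ m) :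
    ∏ j ∈ Finset.range m, (Polynomial.X - Polynomial.C (ζ ^ j)) = Polynomial.X ^ m - 1 := by
  rw [Polynomial.X_pow_sub_one_eq_prod hm hζ]
  refine Finset.prod_nbij (fun j ↦ ζ ^ j) (fun j _ ↦ ?_) (fun i hi j hj h ↦ ?_) (fun x hx ↦ ?_)
    (fun _ _ ↦ rfl)
  · rw [Polynomial.mem_nthRootsFinset hm, ← pow_mul, mul_comm, pow_mul, hζ.pow_eq_one, one_pow]
  · exact hζ.pow_inj (Finset.mem_range.1 hi) (Finset.mem_range.1 hj) h
  · have : NeZero m := ⟨hm.ne'⟩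
    obtain ⟨i, hi, rfl⟩ := hζ.eq_pow_of_pow_eq_one
      ((Polynomial.mem_nthRootsFinset hm _).1 (Finset.mem_coe.1 hx))
    exact ⟨i, by simpa using hi, rfl⟩

lemma zpow_finsetSum {A ι : Type*} [CommGroup A] (a : A) (s : Finset ι) (f : ι → ℤ) :
    a ^ (∑ i ∈ s, f i) = ∏ i ∈ s, a ^ f i := by
  classical
  induction s using Finset.induction_on with
  | empty => simp
  | insert i s hi ih => rw [Finset.sum_insert hi, Finset.prod_insert hi, zpow_add, ih]

/-- The characters of a subgroup `K` of a finite abelian group `G`, extended to `G` and deformed.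
They are encoded by the exponents of a deformation `θ` of a root of unity `ζ`. -/
theorem exists_deformed_characters {k : Type u} [CommRing k] [IsDomain k] {Q : Type v} [CommRing Q]
    [Algebra k Q] {ζ : k} {M : ℕ} (hM : 0 < M) (hζ : IsPrimitiveRoot ζ M) (ε : Q) (θ : Qˣ)
    (hθ : ε ∣ (θ : Q) - algebraMap k Q ζ) {G : Type w} [CommGroup G] [Finite G]
    (hG : Monoid.exponent G ∣ M) (K : Subgroup G) [Fintype K] [DecidableEq K] :
    ∃ Ψ : Finset (G → ℤ), Ψ.card = Nat.card K ∧ (∀ e ∈ Ψ, e 1 = 0) ∧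
      (∀ e ∈ Ψ, ∀ e' ∈ Ψ, e ≠ e' → ∃ x ∈ K, e x ≠ e' x) ∧
      ∀ g g', ∃ c : K → Q, (∀ x, ε ∣ c x - if x = 1 then 1 else 0) ∧
        ∀ e ∈ Ψ, ((θ ^ (e g + e g') : Qˣ) : Q) =
          ∑ x : K, c x * ((θ ^ e (g * g' * x) : Qˣ) : Q) := by
  classical
  obtain ⟨ι, _, m, hm, ⟨φ⟩⟩ := CommGroup.equiv_prod_multiplicative_zmod_of_finite K
  have hm0 (i) : 0 < m i := zero_lt_one.trans (hm i)
  have hne (i) : NeZero (m i) := ⟨(hm0 i).ne'⟩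
  have : NeZero M := ⟨hM.ne'⟩
  -- coordinates on `K`
  let κ : K ≃ ((i : ι) → Fin (m i)) := φ.toEquiv.trans (Equiv.piCongrRight fun i ↦
    { toFun a := ⟨(Multiplicative.toAdd a).val, ZMod.val_lt _⟩
      invFun j := Multiplicative.ofAdd ((j : ℕ) : ZMod (m i))
      left_inv a := by simp
      right_inv j := by
        ext
        simp [ZMod.val_cast_of_lt j.2] })
  have hκ (x : K) (i : ι) : (κ x i : ℕ) = (Multiplicative.toAdd (φ x i)).val := rfl
  have hκ' (x : K) (i : ι) : (((κ x i : ℕ) : ZMod (m i))) = Multiplicative.toAdd (φ x i) := by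
    rw [hκ, ZMod.natCast_zmod_val]
  have hκ1 (i : ι) : (κ 1 i : ℕ) = 0 := by simp [hκ]
  let gen (i : ι) : K := φ.symm (Pi.mulSingle i (Multiplicative.ofAdd 1))
  have hgen (i j : ι) : (κ (gen i) j : ℕ) = if j = i then 1 else 0 := by
    rw [hκ, MulEquiv.apply_symm_apply]
    by_cases h : j = i
    · subst h
      have : Fact (1 < m j) := ⟨hm j⟩
      simp [ZMod.val_one]
    · simp [h]
  have hmM (i : ι) : m i ∣ M := by
    have h1 : gen i ^ M = 1 := by
      refine Subtype.ext ?_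
      exact orderOf_dvd_iff_pow_eq_one.1 ((Monoid.order_dvd_exponent _).trans hG)
    have h2 := congrFun (congrArg φ h1) i
    simp only [gen, map_pow, MulEquiv.apply_symm_apply, map_one, Pi.pow_apply, Pi.one_apply,
      Pi.mulSingle_eq_same] at h2
    have h3 := congrArg Multiplicative.toAdd h2
    simpa [ZMod.natCast_eq_zero_iff] using h3
  -- Here `M' i` is M divided by `m i`, so that ζ^(M' i) is a primitive root of order `m i`.
  choose M' hM' using hmM
  have hM'0 (i) : M' i ≠ 0 := by
    intro h
    have := hM' i
    rw [h, mul_zero] at this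
    exact hM.ne' this
  -- extended characters
  have henough : HasEnoughRootsOfUnity k (Monoid.exponent G) := by
    have : HasEnoughRootsOfUnity k M := ⟨⟨ζ, hζ⟩, inferInstance⟩
    exact HasEnoughRootsOfUnity.of_dvd k hG
  let z : kˣ := (hζ.isUnit hM.ne').unit
  have hz : (z : k) = ζ := rfl
  have hz' : IsPrimitiveRoot z M := hζ.isUnit_unit hM.ne'
  have hχ (i : ι) : ∃ χ : G →* kˣ, ∀ x : K, χ x = z ^ (M' i * (κ x i : ℕ)) := by
    let χ0 : K →* kˣ :=
      { toFun x := z ^ (M' i * (κ x i : ℕ))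
        map_one' := by rw [hκ1, mul_zero, pow_zero]
        map_mul' x x' := by
          rw [← pow_add, ← mul_add]
          have h : (κ (x * x') i : ℕ) ≡ (κ x i : ℕ) + (κ x' i : ℕ) [MOD m i] := by
            rw [← ZMod.natCast_eq_natCast_iff]
            push_cast
            rw [hκ', hκ', hκ', map_mul]
            rfl
          rw [pow_eq_pow_iff_modEq, ← hz'.eq_orderOf, hM' i, mul_comm (m i)]
          exact h.mul_left' _ }
    obtain ⟨χ, hχ⟩ := MonoidHom.domRestrict_surjective k K χ0
    exact ⟨χ, fun x ↦ DFunLike.congr_fun hχ x⟩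
  choose χ hχ using hχ
  -- Discrete logarithms of the character values, normalized to be 0 at the identity. This gives `e
  -- 1 = 0` in the end.
  have hlog (i : ι) (g : G) : ∃ a : ℤ, z ^ a = χ i g ∧ (g = 1 → a = 0) := by
    by_cases hg : g = 1
    · exact ⟨0, by simp [hg], fun _ ↦ rfl⟩
    · have h1 : χ i g ^ M = 1 := by
        rw [← map_pow, orderOf_dvd_iff_pow_eq_one.1 ((Monoid.order_dvd_exponent g).trans hG),
          map_one]
      obtain ⟨a, -, ha⟩ := hζ.eq_pow_of_pow_eq_one
        (show (χ i g : k) ^ M = 1 by rw [← Units.val_pow_eq_pow_val, h1, Units.val_one])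
      exact ⟨a, Units.ext (by simpa [hz] using ha), fun h ↦ absurd h hg⟩
  choose lg hlg hlg1 using hlog
  -- coset representatives
  obtain ⟨r, hr, hrK, hr1⟩ : ∃ r : G → G, (∀ g, (r g)⁻¹ * g ∈ K) ∧
      (∀ g, ∀ x ∈ K, r (g * x) = r g) ∧ ∀ x ∈ K, r x = 1 := by
    refine ⟨fun g ↦ if g ∈ K then 1 else Quotient.out (g : G ⧸ K), fun g ↦ ?_, fun g x hx ↦ ?_,
      fun x hx ↦ if_pos hx⟩
    · beta_reduce
      split_ifs with h
      · simpa using h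
      · rw [← QuotientGroup.eq, QuotientGroup.out_eq']
    · beta_reduce
      rw [QuotientGroup.mk_mul_of_mem g hx]
      simp only [K.mul_mem_cancel_right hx]
  let co (g : G) : K := ⟨(r g)⁻¹ * g, hr g⟩
  -- The exponent is one fixed logarithm per coset of `K` plus `M' i` times a coordinate in the
  -- range from 0 to m i - 1. Along a coset only powers of θ^(M' i) below `m i` occur, which is what
  -- remainders of degree below `m i` can reach.
  let E (i : ι) (g : G) : ℤ := lg i (r g) + M' i * (κ (co g) i : ℕ)
  have hE (i : ι) (g : G) : z ^ E i g = χ i g := by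
    have h1 : χ i (co g) = z ^ ((M' i * (κ (co g) i : ℕ) : ℕ) : ℤ) := by
      rw [hχ, zpow_natCast]
    rw [zpow_add, hlg]
    push_cast at h1
    rw [← h1, ← map_mul]
    simp [co]
  have hEK (i : ι) (x : K) : E i x = M' i * (κ x i : ℕ) := by
    have h1 : r x = 1 := hr1 _ x.2
    have h2 : co x = x := by
      ext
      simp [co, h1]
    simp only [E]
    rw [h2, h1, hlg1 i 1 rfl, zero_add]
  have hEmul (i : ι) (g : G) (x : K) : E i (g * x) = lg i (r g) + M' i * (κ (co g * x) i : ℕ) := by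
    have h1 : r (g * x) = r g := hrK _ _ x.2
    have h2 : co (g * x) = co g * x := by
      ext
      simp [co, h1, mul_assoc]
    simp only [E]
    rw [h2, h1]
  let eΨ (ψ : (i : ι) → Fin (m i)) (g : G) : ℤ := ∑ i, (ψ i : ℕ) * E i g
  have hsep (ψ ψ') (h : ψ ≠ ψ') : ∃ x ∈ K, eΨ ψ x ≠ eΨ ψ' x := by
    obtain ⟨i, hi⟩ := Function.ne_iff.1 h
    have h1 (ψ) : eΨ ψ (gen i) = (ψ i : ℕ) * M' i := by
      simp only [eΨ]
      rw [Finset.sum_eq_single i]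
      · rw [hEK, hgen, if_pos rfl, Nat.cast_one, mul_one]
      · intro j _ hj
        rw [hEK, hgen, if_neg hj]
        simp
      · simp
    refine ⟨gen i, (gen i).2, ?_⟩
    rw [h1, h1]
    intro h2
    have h3 := mul_right_cancel₀ (Int.natCast_ne_zero.2 (hM'0 i)) h2
    exact hi (Fin.ext (by exact_mod_cast h3))
  have hinj : Function.Injective eΨ := by
    intro ψ ψ' h
    by_contra hne
    obtain ⟨x, -, hx⟩ := hsep ψ ψ' hne
    exact hx (congrFun h _)
  refine ⟨Finset.univ.image eΨ, ?_, ?_, ?_, ?_⟩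
  · rw [Finset.card_image_of_injective _ hinj, Finset.card_univ, Nat.card_eq_fintype_card]
    exact (Fintype.card_congr κ).symm
  · intro e he
    obtain ⟨ψ, -, rfl⟩ := Finset.mem_image.1 he
    refine Finset.sum_eq_zero fun i _ ↦ ?_
    have := hEK i 1
    rw [hκ1] at this
    simp only [OneMemClass.coe_one] at this
    rw [this]
    simp
  · intro e he e' he' h
    obtain ⟨ψ, -, rfl⟩ := Finset.mem_image.1 he
    obtain ⟨ψ', -, rfl⟩ := Finset.mem_image.1 he'
    exact hsep ψ ψ' fun h' ↦ h (by rw [h'])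
  · intro g g'
    -- Both sides are logarithms of the same character value, so they differ by a multiple of M = m
    -- i * M' i. Hence `N` is determined modulo `m i`.
    have hN (i : ι) : ∃ N : ℤ, E i g + E i g' = lg i (r (g * g')) + M' i * N ∧
        N ≡ (κ (co (g * g')) i : ℕ) [ZMOD m i] := by
      have h1 : z ^ (E i g + E i g') = z ^ E i (g * g') := by
        rw [zpow_add, hE, hE, hE, map_mul]
      rw [← mul_inv_eq_one, ← zpow_neg, ← zpow_add, hz'.zpow_eq_one_iff_dvd, hM' i] at h1
      obtain ⟨n, hn⟩ := h1
      refine ⟨(κ (co (g * g')) i : ℕ) + m i * n, ?_, by simp [Int.ModEq]⟩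
      have h2 : E i (g * g') = lg i (r (g * g')) + M' i * (κ (co (g * g')) i : ℕ) := rfl
      push_cast at hn
      linear_combination hn + h2
    choose N hN hNm using hN
    have hy (i : ι) : (∏ j ∈ Finset.range (m i), (Polynomial.X - Polynomial.C
        (((θ ^ M' i) ^ j : Qˣ) : Q))).map (Ideal.Quotient.mk (Ideal.span {ε})) =
          Polynomial.X ^ m i - 1 := by
      have h1 : Ideal.Quotient.mk (Ideal.span {ε}) (θ : Q) =
          Ideal.Quotient.mk (Ideal.span {ε}) (algebraMap k Q ζ) := by
        rwa [Ideal.Quotient.eq, Ideal.mem_span_singleton]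
      have h2 := congrArg (Polynomial.map ((Ideal.Quotient.mk (Ideal.span {ε})).comp
        (algebraMap k Q))) (IsPrimitiveRoot.prod_range_X_sub_C_pow (hm0 i)
          (hζ.pow hM ((hM' i).trans (mul_comm _ _))))
      rw [Polynomial.map_prod] at h2 ⊢
      simpa [h1] using h2
    obtain ⟨c, hc, hce⟩ := exists_prod_zpow_eq_sum_of_prod_eq ε m hm0 (fun i ↦ θ ^ M' i) hy N
    refine ⟨fun x ↦ c (κ (co (g * g') * x)), fun x ↦ ?_, fun e he ↦ ?_⟩
    · have h1 : (∀ i, ((κ (co (g * g') * x) i : ℕ) : ℤ) ≡ N i [ZMOD m i]) ↔ x = 1 := by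
        constructor
        · intro h
          have h2 : co (g * g') * x = co (g * g') := by
            refine κ.injective (funext fun i ↦ Fin.ext ?_)
            have h3 := (h i).trans (hNm i)
            rw [Int.natCast_modEq_iff] at h3
            exact h3.eq_of_lt_of_lt (κ _ i).2 (κ _ i).2
          simpa using h2
        · rintro rfl i
          rw [mul_one]
          exact (hNm i).symm
      simpa only [h1] using hc (κ (co (g * g') * x))
    · obtain ⟨ψ, -, rfl⟩ := Finset.mem_image.1 he
      -- The contribution of the coset representative of `g * g'` factors out of every term. What
      -- remains is the several-variable identity at the points θ^(M' i).
      have h1 : θ ^ (eΨ ψ g + eΨ ψ g') = (∏ i, θ ^ ((ψ i : ℕ) * lg i (r (g * g')))) *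
          ∏ i, ((θ ^ M' i) ^ (ψ i : ℕ)) ^ N i := by
        simp only [eΨ]
        rw [← Finset.sum_add_distrib, ← Finset.prod_mul_distrib, zpow_finsetSum]
        refine Finset.prod_congr rfl fun i _ ↦ ?_
        rw [← mul_add, hN, ← pow_mul, ← zpow_natCast, ← zpow_mul, ← zpow_add]
        congr 1
        push_cast
        ring
      have h2 (x : K) : θ ^ eΨ ψ (g * g' * x) = (∏ i, θ ^ ((ψ i : ℕ) * lg i (r (g * g')))) *
          ∏ i, ((θ ^ M' i) ^ (ψ i : ℕ)) ^ (κ (co (g * g') * x) i : ℕ) := by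
        simp only [eΨ]
        rw [← Finset.prod_mul_distrib, zpow_finsetSum]
        refine Finset.prod_congr rfl fun i _ ↦ ?_
        rw [hEmul, ← pow_mul, ← pow_mul, ← zpow_natCast, ← zpow_add]
        congr 1
        push_cast
        ring
      have h3 := hce ψ
      rw [← Equiv.sum_comp κ, ← Equiv.sum_comp (Equiv.mulLeft (co (g * g')))] at h3
      rw [h1, Units.val_mul, Units.coe_prod (f := fun i ↦ ((θ ^ M' i) ^ (ψ i : ℕ)) ^ N i), h3,
        Finset.mul_sum]
      refine Finset.sum_congr rfl fun x _ ↦ ?_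
      rw [h2, Units.val_mul, Units.coe_prod
        (f := fun i ↦ ((θ ^ M' i) ^ (ψ i : ℕ)) ^ (κ (co (g * g') * x) i : ℕ))]
      simp only [Equiv.coe_mulLeft, Units.val_pow_eq_pow_val]
      ring

/-- Clearing denominators. Applied to indicators of points, it produces the `D` that brings all
functions into the lattice. -/
lemma exists_smul_mem_span_of_mem_span_localization {k : Type u} [CommRing k] {N : Type v}
    [AddCommGroup N] [Module k⟦X⟧ N] [Module (PrimitiveLocalization k) N]
    [IsScalarTower k⟦X⟧ (PrimitiveLocalization k) N] {s : Set N} {f : N}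
    (hf : f ∈ Submodule.span (PrimitiveLocalization k) s) :
    ∃ d ∈ primitiveSeries k, d • f ∈ Submodule.span k⟦X⟧ s := by
  induction hf using Submodule.span_induction with
  | mem f hf => exact ⟨1, one_mem _, by simpa using Submodule.subset_span hf⟩
  | zero => exact ⟨1, one_mem _, by simp⟩
  | add f g _ _ hf hg =>
    obtain ⟨d, hd, hdf⟩ := hf
    obtain ⟨d', hd', hdg⟩ := hg
    refine ⟨d * d', mul_mem hd hd', ?_⟩
    rw [smul_add]
    refine add_mem ?_ ?_
    · rw [mul_comm, mul_smul]
      exact Submodule.smul_mem _ _ hdf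
    · rw [mul_smul]
      exact Submodule.smul_mem _ _ hdg
  | smul r f _ hf =>
    obtain ⟨d, hd, hdf⟩ := hf
    obtain ⟨⟨a, s⟩, has⟩ := IsLocalization.surj (primitiveSeries k) r
    refine ⟨s * d, mul_mem s.2 hd, ?_⟩
    have h : ((s : k⟦X⟧) * d) • r • f = a • d • f := by
      rw [← algebraMap_smul (PrimitiveLocalization k) a, ← has,
        ← algebraMap_smul (PrimitiveLocalization k) ((s : k⟦X⟧) * d),
        ← algebraMap_smul (PrimitiveLocalization k) d, smul_smul, smul_smul, map_mul]
      congr 1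
      ring
    rw [h]
    exact Submodule.smul_mem _ _ hdf

/-- The unit `z (1 + t D)` of the ring of power series. -/
noncomputable def powerSeriesUnit {k : Type u} [CommRing k] (z : kˣ) (D : k⟦X⟧) : k⟦X⟧ˣ :=
  (isUnit_C_mul_one_add z D).unit

lemma map_powerSeriesUnit {k : Type u} [CommRing k] (z : kˣ) (D : k⟦X⟧) :
    Units.map (algebraMap k⟦X⟧ (PrimitiveLocalization k)) (powerSeriesUnit z D) =
      deformedUnit z D := Units.ext rfl

lemma algebraMap_powerSeriesUnit_zpow {k : Type u} [CommRing k] (z : kˣ) (D : k⟦X⟧) (n : ℤ) :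
    algebraMap k⟦X⟧ (PrimitiveLocalization k) ((powerSeriesUnit z D ^ n : k⟦X⟧ˣ) : k⟦X⟧) =
      ((deformedUnit z D ^ n : (PrimitiveLocalization k)ˣ) : PrimitiveLocalization k) := by
  rw [← map_powerSeriesUnit, ← map_zpow]
  rfl

lemma dvd_powerSeriesUnit_sub {k : Type u} [CommRing k] (z : kˣ) (D : k⟦X⟧) :
    PowerSeries.X * D ∣ (powerSeriesUnit z D : k⟦X⟧) - algebraMap k k⟦X⟧ (z : k) := by
  refine ⟨PowerSeries.C (z : k), ?_⟩
  change PowerSeries.C (z : k) * (1 + PowerSeries.X * D) - PowerSeries.C (z : k) = _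
  ring

/-- The deformed group algebra of `H ^ n`, for a finite abelian group `H`, as a lattice of functions
on a finite set. -/
theorem exists_deformed_functions {k : Type u} [CommRing k] [IsDomain k] {ζ : k} {M : ℕ}
    (hM : 0 < M) (hζ : IsPrimitiveRoot ζ M) (H : Type v) [CommGroup H] [Finite H]
    (hH : Monoid.exponent H ∣ M) (n : ℕ) :
    ∃ (J : Finset (H → ℤ)) (β : (Fin n → H) → (Fin n → J) → PrimitiveLocalization k) (D : k⟦X⟧),
      J.card = Nat.card H ∧ β 1 = 1 ∧
      (∀ h h', ∃ m ∈ Submodule.span k⟦X⟧ (Set.range β),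
        β h * β h' = β (h * h') + (PowerSeries.X : k⟦X⟧) • m) ∧
      (∀ (s : Equiv.Perm (Fin n)) h y, β h (y ∘ s) = β (fun i ↦ h (s⁻¹ i)) y) ∧
      Submodule.span (PrimitiveLocalization k) (Set.range β) = ⊤ ∧ D ∈ primitiveSeries k ∧
      ∀ f : (Fin n → J) → k⟦X⟧, (fun y ↦ algebraMap k⟦X⟧ (PrimitiveLocalization k) (D * f y)) ∈
        Submodule.span k⟦X⟧ (Set.range β) := by
  classical
  have := Fintype.ofFinite H
  let z : kˣ := (hζ.isUnit hM.ne').unit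
  -- For `H` the parameter is t itself, that is θ = ζ(1 + t), and the subgroup is the whole group.
  obtain ⟨J, hJ, hJ1, hJs, hJm⟩ := exists_deformed_characters hM hζ
    (PowerSeries.X * 1 : k⟦X⟧) (powerSeriesUnit z 1) (dvd_powerSeriesUnit_sub z 1) hH ⊤
  let θ : (PrimitiveLocalization k)ˣ := deformedUnit z 1
  let β (h : Fin n → H) (y : Fin n → J) : PrimitiveLocalization k :=
    ∏ i, ((θ ^ (y i : H → ℤ) (h i) : (PrimitiveLocalization k)ˣ) : PrimitiveLocalization k)
  have hβ1 : β 1 = 1 := by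
    ext y
    refine Finset.prod_eq_one fun i _ ↦ ?_
    rw [Pi.one_apply, hJ1 _ (y i).2, zpow_zero, Units.val_one]
  have hβmul (h h') : ∃ m ∈ Submodule.span k⟦X⟧ (Set.range β),
      β h * β h' = β (h * h') + (PowerSeries.X : k⟦X⟧) • m := by
    choose c hc hce using fun i ↦ hJm (h i) (h' i)
    have h1 (x : Fin n → (⊤ : Subgroup H)) : (PowerSeries.X : k⟦X⟧) ∣
        (∏ i, c i (x i)) - if x = 1 then 1 else 0 := by
      have h2 : (if x = 1 then (1 : k⟦X⟧) else 0) = ∏ i, if x i = 1 then 1 else 0 := by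
        rw [Fintype.prod_boole]
        simp [funext_iff]
      rw [h2, ← Ideal.mem_span_singleton, ← Ideal.Quotient.eq, map_prod, map_prod]
      refine Finset.prod_congr rfl fun i _ ↦ ?_
      rw [Ideal.Quotient.eq, Ideal.mem_span_singleton]
      simpa using hc i (x i)
    choose c' hc' using h1
    let v (x : Fin n → (⊤ : Subgroup H)) : Fin n → H := fun i ↦ x i
    have h2 : β h * β h' = ∑ x : Fin n → (⊤ : Subgroup H),
        (∏ i, c i (x i)) • β (h * h' * v x) := by
      ext y
      have h3 (i : Fin n) : ((θ ^ (y i : H → ℤ) (h i) : (PrimitiveLocalization k)ˣ) :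
          PrimitiveLocalization k) * ((θ ^ (y i : H → ℤ) (h' i) : (PrimitiveLocalization k)ˣ) :
          PrimitiveLocalization k) = ∑ x : (⊤ : Subgroup H), algebraMap k⟦X⟧ _ (c i x) *
            ((θ ^ (y i : H → ℤ) (h i * h' i * x) : (PrimitiveLocalization k)ˣ) :
              PrimitiveLocalization k) := by
        have h4 := congrArg (algebraMap k⟦X⟧ (PrimitiveLocalization k)) (hce i (y i) (y i).2)
        rw [algebraMap_powerSeriesUnit_zpow, map_sum] at h4
        rw [← Units.val_mul, ← zpow_add, h4]
        simp only [map_mul, algebraMap_powerSeriesUnit_zpow]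
        rfl
      rw [Pi.mul_apply]
      simp only [β]
      rw [← Finset.prod_mul_distrib, Finset.prod_congr rfl fun i _ ↦ h3 i, Finset.prod_univ_sum,
        Fintype.piFinset_univ, Finset.sum_apply]
      refine Finset.sum_congr rfl fun x _ ↦ ?_
      rw [Finset.prod_mul_distrib, Pi.smul_apply, Algebra.smul_def, map_prod]
      rfl
    refine ⟨∑ x, c' x • β (h * h' * v x),
      sum_mem fun x _ ↦ Submodule.smul_mem _ _ (Submodule.subset_span ⟨_, rfl⟩), ?_⟩
    have h5 : ∑ x : Fin n → (⊤ : Subgroup H),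
        (if x = 1 then (1 : k⟦X⟧) else 0) • β (h * h' * v x) = β (h * h') := by
      rw [Finset.sum_eq_single 1]
      · rw [if_pos rfl, one_smul]
        congr 1
        ext i
        simp [v]
      · intro x _ hx
        rw [if_neg hx, zero_smul]
      · simp
    rw [h2, ← h5, Finset.smul_sum, ← Finset.sum_add_distrib]
    refine Finset.sum_congr rfl fun x _ ↦ ?_
    rw [smul_smul, ← add_smul, ← hc']
    ring_nf
  have hβspan : Submodule.span (PrimitiveLocalization k) (Set.range β) = ⊤ := by
    have hmul (u u') (hu : u ∈ Submodule.span (PrimitiveLocalization k) (Set.range β))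
        (hu' : u' ∈ Submodule.span (PrimitiveLocalization k) (Set.range β)) :
        u * u' ∈ Submodule.span (PrimitiveLocalization k) (Set.range β) := by
      induction hu using Submodule.span_induction with
      | mem u hu =>
        obtain ⟨h, rfl⟩ := hu
        induction hu' using Submodule.span_induction with
        | mem u' hu' =>
          obtain ⟨h', rfl⟩ := hu'
          obtain ⟨m, hm, h⟩ := hβmul h h'
          rw [h]
          refine add_mem (Submodule.subset_span ⟨_, rfl⟩) ?_
          rw [← algebraMap_smul (PrimitiveLocalization k)]
          exact Submodule.smul_mem _ _ (Submodule.span_le_restrictScalars k⟦X⟧ _ _ hm)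
        | zero => simp
        | add y z _ _ hy hz => rw [mul_add]; exact add_mem hy hz
        | smul c y _ hy => rw [mul_smul_comm]; exact Submodule.smul_mem _ _ hy
      | zero => simp
      | add y z _ _ hy hz => rw [add_mul]; exact add_mem hy hz
      | smul c y _ hy => rw [smul_mul_assoc]; exact Submodule.smul_mem _ _ hy
    -- Two points differ in a coordinate i. An element of `H ^ n` supported at i tells them apart by
    -- two distinct powers of θ.
    have htop := Subalgebra.pi_eq_top_of_separates
      ((Submodule.span (PrimitiveLocalization k) (Set.range β)).toSubalgebra
        (hβ1 ▸ Submodule.subset_span ⟨_, rfl⟩) hmul) (fun y y' hy ↦ by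
        obtain ⟨i, hi⟩ := Function.ne_iff.1 hy
        obtain ⟨x, -, hx⟩ := hJs _ (y i).2 _ (y' i).2 fun h ↦ hi (Subtype.ext h)
        have h1 (y : Fin n → J) : β (Pi.mulSingle i x) y =
            ((θ ^ (y i : H → ℤ) x : (PrimitiveLocalization k)ˣ) : PrimitiveLocalization k) := by
          refine (Finset.prod_eq_single i (fun j _ hj ↦ ?_) (by simp)).trans ?_
          · rw [Pi.mulSingle_eq_of_ne hj, hJ1 _ (y j).2, zpow_zero, Units.val_one]
          · rw [Pi.mulSingle_eq_same]
        refine ⟨β (Pi.mulSingle i x), Submodule.subset_span ⟨_, rfl⟩, ?_⟩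
        rw [h1, h1]
        exact isUnit_deformedUnit_zpow_sub_zpow z (one_mem _) hx)
    rw [eq_top_iff]
    rintro f -
    exact htop.ge (Algebra.mem_top (x := f))
  -- A common denominator for the indicator of each point. The product of these finitely many
  -- denominators serves as `D`.
  have hd (y : Fin n → J) : ∃ d ∈ primitiveSeries k,
      d • (Pi.single y 1 : (Fin n → J) → PrimitiveLocalization k) ∈
        Submodule.span k⟦X⟧ (Set.range β) :=
    exists_smul_mem_span_of_mem_span_localization (hβspan ▸ trivial)
  choose d hdS hd using hd
  refine ⟨J, β, ∏ y, d y, hJ.trans ?_, hβ1, hβmul, ?_, hβspan, prod_mem fun y _ ↦ hdS y, ?_⟩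
  · exact Nat.card_congr Subgroup.topEquiv.toEquiv
  · intro s h y
    simp only [β, Function.comp_apply]
    refine (Equiv.prod_comp s fun i ↦ ((θ ^ (y i : H → ℤ) (h (s⁻¹ i)) :
      (PrimitiveLocalization k)ˣ) : PrimitiveLocalization k)).symm.trans ?_ |>.symm
    simp
  · intro f
    have h1 : (fun y ↦ algebraMap k⟦X⟧ (PrimitiveLocalization k) ((∏ y, d y) * f y)) =
        ∑ y, (f y * ∏ y' ∈ Finset.univ.erase y, d y') •
          d y • (Pi.single y 1 : (Fin n → J) → PrimitiveLocalization k) := by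
      ext y
      rw [Finset.sum_apply, Finset.sum_eq_single y]
      · rw [Pi.smul_apply, Pi.smul_apply, Pi.single_eq_same, smul_smul, mul_assoc,
          Finset.prod_erase_mul _ _ (Finset.mem_univ y), mul_comm, Algebra.smul_def, mul_one]
      · intro y' _ hy'
        simp [Pi.single_eq_of_ne hy'.symm]
      · simp
    rw [h1]
    exact sum_mem fun y _ ↦ Submodule.smul_mem _ _ (hd y)

/-! ### Clifford theory for an abelian permuting group. -/

/-- The diagonal matrices that lie in a subalgebra, as a subalgebra of functions. -/
def Subalgebra.diagonalPart {R : Type u} [CommRing R] {X : Type v} [Fintype X] [DecidableEq X]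
    (A : Subalgebra R (Matrix X X R)) : Subalgebra R (X → R) :=
  A.comap (Matrix.diagonalAlgHom R)

lemma Subalgebra.mem_diagonalPart {R : Type u} [CommRing R] {X : Type v} [Fintype X]
    [DecidableEq X] {A : Subalgebra R (Matrix X X R)} {f : X → R} :
    f ∈ A.diagonalPart ↔ Matrix.diagonal f ∈ A := Iff.rfl

/-- Cutting `T` with the diagonal idempotents at `x` and `y` leaves its entry there times the matrix
unit, and the entry can be divided out. -/
lemma Matrix.single_mem_of_unit_entry {R : Type u} [CommRing R] {X : Type v} [Fintype X]
    [DecidableEq X] {A : Subalgebra R (Matrix X X R)} (hA : A.diagonalPart = ⊤) {T : Matrix X X R}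
    (hT : T ∈ A) {x y : X} (h : IsUnit (T x y)) : Matrix.single x y 1 ∈ A := by
  obtain ⟨t, ht⟩ := h
  have hd (f : X → R) : Matrix.diagonal f ∈ A :=
    Subalgebra.mem_diagonalPart.1 (hA ▸ Algebra.mem_top)
  convert A.smul_mem (mul_mem (mul_mem (hd (Pi.single x 1)) hT) (hd (Pi.single y 1)))
    (↑t⁻¹ : R) using 1
  ext a b
  rw [Matrix.smul_apply, Matrix.mul_diagonal, Matrix.diagonal_mul, Matrix.single_apply]
  by_cases ha : a = x
  · by_cases hb : b = y
    · subst ha hb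
      simp [← ht]
    · simp [Ne.symm hb]
  · simp [Ne.symm ha]

/-- The basis vectors are pairs of a point of `J^n` and a deformed character of its stabilizer. The
characters come already extended to `G`, so the induced modules are given by monomial matrices: the
point moves, the character stays, and `g` contributes θ^(e g). The blocks are the orbits of these
pairs. -/
theorem hasSplitGlobalSolution_wreathProduct_of_comm {k : Type} [CommRing k] [IsDomain k] {ζ : k}
    {M : ℕ} (hM : 0 < M) (hζ : IsPrimitiveRoot ζ M) {H : Type u} [CommGroup H] [Finite H]
    (hH : Monoid.exponent H ∣ M) {n : ℕ} {G : Type v} [CommGroup G] [Finite G]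
    (hG : Monoid.exponent G ∣ M) (σ : G →* Equiv.Perm (Fin n)) :
    HasSplitGlobalSolution k (WreathProduct H σ) := by
  classical
  have := Fintype.ofFinite G
  obtain ⟨J, β, D, hJ, hβ1, hβmul, hβact, hβspan, hDS, hD⟩ := exists_deformed_functions hM hζ H hH n
  let z : kˣ := (hζ.isUnit hM.ne').unit
  choose Ψ hΨ hΨ1 hΨs hΨm using fun K : Subgroup G ↦ exists_deformed_characters hM hζ
    (PowerSeries.X * D : k⟦X⟧) (powerSeriesUnit z D) (dvd_powerSeriesUnit_sub z D) hG K
  let θ : (PrimitiveLocalization k)ˣ := deformedUnit z D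
  have hmul (K : Subgroup G) (g g' : G) : ∃ c : G → k⟦X⟧, (∀ x ∉ K, c x = 0) ∧ ∀ e ∈ Ψ K,
      ((θ ^ (e g + e g') : (PrimitiveLocalization k)ˣ) : PrimitiveLocalization k) =
        ((θ ^ e (g * g') : (PrimitiveLocalization k)ˣ) : PrimitiveLocalization k) +
        ∑ x, algebraMap k⟦X⟧ _ (PowerSeries.X * D * c x) *
          ((θ ^ e (g * g' * x) : (PrimitiveLocalization k)ˣ) : PrimitiveLocalization k) := by
    obtain ⟨c, hc, hce⟩ := hΨm K g g'
    choose c' hc' using hc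
    -- Extension by zero lets one sum over `G` serve all stabilizers simultaneously.
    refine ⟨fun x ↦ if h : x ∈ K then c' ⟨x, h⟩ else 0, fun x hx ↦ dif_neg hx, fun e he ↦ ?_⟩
    have h1 := congrArg (algebraMap k⟦X⟧ (PrimitiveLocalization k)) (hce e he)
    rw [algebraMap_powerSeriesUnit_zpow, map_sum] at h1
    simp only [map_mul, algebraMap_powerSeriesUnit_zpow] at h1
    rw [h1]
    have h2 : ∑ x, algebraMap k⟦X⟧ (PrimitiveLocalization k) (PowerSeries.X * D *
        if h : x ∈ K then c' ⟨x, h⟩ else 0) *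
          ((θ ^ e (g * g' * x) : (PrimitiveLocalization k)ˣ) : PrimitiveLocalization k) =
        ∑ x : K, algebraMap k⟦X⟧ (PrimitiveLocalization k) (PowerSeries.X * D * c' x) *
          ((θ ^ e (g * g' * x) : (PrimitiveLocalization k)ˣ) : PrimitiveLocalization k) := by
      rw [← Finset.sum_subset (Finset.subset_univ (Finset.univ.filter (· ∈ K)))]
      · rw [Finset.sum_subtype (p := (· ∈ K)) _ (by simp)]
        refine Finset.sum_congr rfl fun x _ ↦ ?_
        rw [dif_pos x.2]
      · intro x _ hx
        rw [dif_neg (by simpa using hx)]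
        simp
    have h3 : ((θ ^ e (g * g') : (PrimitiveLocalization k)ˣ) : PrimitiveLocalization k) =
        ∑ x : K, algebraMap k⟦X⟧ (PrimitiveLocalization k) (if x = 1 then 1 else 0) *
          ((θ ^ e (g * g' * x) : (PrimitiveLocalization k)ˣ) : PrimitiveLocalization k) := by
      rw [Finset.sum_eq_single 1]
      · simp
      · intro x _ hx
        simp [hx]
      · simp
    rw [h2, h3, ← Finset.sum_add_distrib]
    refine Finset.sum_congr rfl fun x _ ↦ ?_
    rw [← add_mul, ← map_add, ← hc']
    simp [θ]
  -- the action of `G` on functions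
  let Y := Fin n → J
  let K (y : Y) : Subgroup G :=
    { carrier := {g | y ∘ σ g = y}
      one_mem' := by simp
      mul_mem' {g g'} hg hg' := by
        change y ∘ σ (g * g') = y
        rw [map_mul, Equiv.Perm.coe_mul, ← Function.comp_assoc, hg, hg']
      inv_mem' {g} hg := by
        change y ∘ σ g⁻¹ = y
        conv_lhs => rw [← show y ∘ σ g = y from hg]
        rw [Function.comp_assoc, ← Equiv.Perm.coe_mul, ← map_mul, mul_inv_cancel, map_one]
        rfl }
  -- Stabilizers along an orbit are conjugate, hence equal because `G` is commutative. So an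
  -- exponent function admissible at one point is admissible on its whole orbit.
  have hK (y : Y) (g : G) : K (y ∘ σ g) = K y := by
    ext x
    change (y ∘ σ g) ∘ σ x = y ∘ σ g ↔ y ∘ σ x = y
    rw [Function.comp_assoc, ← Equiv.Perm.coe_mul, ← map_mul, mul_comm, map_mul, Equiv.Perm.coe_mul,
      ← Function.comp_assoc]
    exact (σ g).surjective.injective_comp_right.eq_iff
  let X := Σ e : (Finset.univ.biUnion fun y ↦ Ψ (K y) : Finset (G → ℤ)),
    {y : Y // (e : G → ℤ) ∈ Ψ (K y)}
  let act : MulAction G X :=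
    { smul g x := ⟨x.1, x.2.1 ∘ σ g, by rw [hK]; exact x.2.2⟩
      one_smul x := by
        refine Sigma.ext rfl (heq_of_eq (Subtype.ext ?_))
        change x.2.1 ∘ σ 1 = x.2.1
        simp
      mul_smul g g' x := by
        refine Sigma.ext rfl (heq_of_eq (Subtype.ext ?_))
        change x.2.1 ∘ σ (g * g') = (x.2.1 ∘ σ g') ∘ σ g
        rw [mul_comm, map_mul]
        rfl }
  have hsm (g : G) (x : X) : (g • x).2.1 = x.2.1 ∘ σ g := rfl
  have hsm1 (g : G) (x : X) : (g • x).1 = x.1 := rfl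
  have hXext (x x' : X) (h1 : x.1 = x'.1) (h2 : x.2.1 = x'.2.1) : x = x' := by
    obtain ⟨e, y⟩ := x
    obtain ⟨e', y'⟩ := x'
    obtain rfl : e = e' := h1
    exact congrArg (Sigma.mk e) (Subtype.ext h2)
  have hstab (x : X) (g : G) : g • x = x ↔ g ∈ K x.2.1 :=
    ⟨fun h ↦ congrArg (fun x : X ↦ x.2.1) h, fun h ↦ hXext _ _ rfl h⟩
  let T (g : G) : Matrix X X (PrimitiveLocalization k) :=
    Matrix.of fun x x' ↦ if x' = g • x then
      ((θ ^ (x.1 : G → ℤ) g : (PrimitiveLocalization k)ˣ) : PrimitiveLocalization k) else 0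
  have hT (g : G) (x x' : X) : T g x x' = if x' = g • x then
      ((θ ^ (x.1 : G → ℤ) g : (PrimitiveLocalization k)ˣ) : PrimitiveLocalization k) else 0 := rfl
  have hTne (g : G) (x x' : X) (h : T g x x' ≠ 0) : x' = g • x := by
    by_contra h'
    exact h (by rw [hT, if_neg h'])
  refine hasSplitGlobalSolution_wreathProduct σ β hβ1 hβmul (fun g ↦ hβact (σ g)) hβspan D hD
    (fun x : X ↦ x.2.1) (fun x ↦ MulAction.orbit G x) T ?_ ?_ ?_ ?_ ?_ ?_
  · ext x x'
    rw [hT, one_smul, Matrix.one_apply, hΨ1 _ _ x.2.2, zpow_zero, Units.val_one]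
    simp only [eq_comm]
  · intro g x x' h
    rw [hTne g x x' h]
    exact (MulAction.orbit_eq_iff.2 (MulAction.mem_orbit _ _)).symm
  · intro g x x' h
    rw [hTne g x x' h]
    rfl
  · intro g g'
    choose c hc hce using fun y ↦ hmul (K y) g g'
    refine ⟨∑ a, Matrix.diagonal (fun x : X ↦ algebraMap k⟦X⟧ (PrimitiveLocalization k)
      (c x.2.1 a)) * T (g * g' * a), sum_mem fun a _ ↦ Submodule.subset_span
        ⟨fun y ↦ c y a, g * g' * a, rfl⟩, ?_⟩
    ext x x'
    have h1 : (T g * T g') x x' = if x' = (g * g') • x then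
        ((θ ^ ((x.1 : G → ℤ) g + (x.1 : G → ℤ) g') : (PrimitiveLocalization k)ˣ) :
          PrimitiveLocalization k) else 0 := by
      rw [Matrix.mul_apply, Finset.sum_eq_single (g • x)]
      · rw [hT, hT, if_pos rfl, hsm1, smul_smul, mul_comm g', mul_ite, mul_zero, ← Units.val_mul,
          ← zpow_add]
      · intro a _ ha
        rw [hT, if_neg ha, zero_mul]
      · simp
    rw [h1, Matrix.add_apply, Matrix.smul_apply, Matrix.sum_apply, Finset.smul_sum]
    simp only [Matrix.diagonal_mul]
    have h2 (a : G) : (PowerSeries.X * D : k⟦X⟧) • (algebraMap k⟦X⟧ (PrimitiveLocalization k)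
        (c x.2.1 a) * T (g * g' * a) x x') = if x' = (g * g') • x then
          algebraMap k⟦X⟧ (PrimitiveLocalization k) (PowerSeries.X * D * c x.2.1 a) *
          ((θ ^ (x.1 : G → ℤ) (g * g' * a) : (PrimitiveLocalization k)ˣ) :
            PrimitiveLocalization k) else 0 := by
      -- The correction by an element of the stabilizer does not move `x`, so all error terms have
      -- the support of `T (g * g')`.
      by_cases ha : a ∈ K x.2.1
      · rw [hT, mul_smul (g * g') a x, (hstab x a).2 ha, Algebra.smul_def, ← mul_assoc, ← map_mul,
          mul_ite, mul_zero]
      · rw [hc _ _ ha]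
        simp
    rw [Finset.sum_congr rfl fun a _ ↦ h2 a, hT]
    split_ifs with h
    · exact hce _ _ x.2.2
    · simp
  · have hfib (x : X) : Nat.card {x' : X // MulAction.orbit G x = MulAction.orbit G x'} =
        Nat.card G / Nat.card (K x.2.1) := by
      have h1 : MulAction.stabilizer G x = K x.2.1 := by
        ext g
        rw [MulAction.mem_stabilizer_iff, hstab]
      have h2 : Nat.card {x' : X // MulAction.orbit G x = MulAction.orbit G x'} =
          Nat.card (MulAction.orbit G x) :=
        Nat.card_congr (Equiv.subtypeEquivRight fun x' ↦ by rw [eq_comm, MulAction.orbit_eq_iff])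
      rw [h2, Nat.card_congr (MulAction.orbitEquivQuotientStabilizer G x), h1,
        (K x.2.1).card_eq_card_quotient_mul_card_subgroup, Nat.mul_div_cancel _ Nat.card_pos]
    have hcard (y : Y) : (Finset.univ.filter fun x : X ↦ x.2.1 = y).card = Nat.card (K y) := by
      rw [← hΨ]
      refine Finset.card_bij (fun x _ ↦ x.1) (fun x hx ↦ ?_) (fun x hx x' hx' h ↦ ?_)
        fun e he ↦ ⟨⟨⟨e, Finset.mem_biUnion.2 ⟨y, Finset.mem_univ _, he⟩⟩, ⟨y, he⟩⟩, by simp, rfl⟩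
      · rw [← (Finset.mem_filter.1 hx).2]
        exact x.2.2
      · exact hXext _ _ (Subtype.ext h)
          ((Finset.mem_filter.1 hx).2.trans (Finset.mem_filter.1 hx').2.symm)
    rw [Nat.card_congr (Equiv.subtypeProdEquivSigmaSubtype
      fun x x' : X ↦ MulAction.orbit G x = MulAction.orbit G x'), Nat.card_sigma,
      Finset.sum_congr rfl fun x _ ↦ hfib x, ← Finset.sum_fiberwise (s := Finset.univ)
        (g := fun x : X ↦ x.2.1)]
    -- Over each point there are |K y| characters, each in an orbit of size |G|/|K y|, so every
    -- point contributes |G| to the count.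
    have h3 (y : Y) : ∑ x : X with x.2.1 = y, Nat.card G / Nat.card (K x.2.1) = Nat.card G := by
      rw [Finset.sum_congr rfl fun x hx ↦ by rw [(Finset.mem_filter.1 hx).2], Finset.sum_const,
        hcard, smul_eq_mul]
      exact Nat.mul_div_cancel' (K y).card_subgroup_dvd_card
    rw [Finset.sum_congr rfl fun y _ ↦ h3 y, Finset.sum_const, Finset.card_univ, smul_eq_mul,
      Fintype.card_fun, Fintype.card_fin, Fintype.card_coe, hJ]
  · intro A hAd hAT x x' hxx'
    have hd : A.diagonalPart = ⊤ := by
      refine Subalgebra.pi_eq_top_of_separates _ fun x x' hxx' ↦ ?_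
      by_cases hy : x.2.1 = x'.2.1
      · have he : (x.1 : G → ℤ) ≠ x'.1 := fun h ↦ hxx' (hXext _ _ (Subtype.ext h) hy)
        obtain ⟨a, ha, hae⟩ := hΨs _ _ x.2.2 _ (hy ▸ x'.2.2) he
        -- Two characters over the same point are separated by some `a` in its stabilizer.
        -- Restricted to the rows over that point, `T a` is diagonal and shows their values at `a`.
        let f (x₁ : X) : PrimitiveLocalization k := if x₁.2.1 = x.2.1 then
          ((θ ^ (x₁.1 : G → ℤ) a : (PrimitiveLocalization k)ˣ) : PrimitiveLocalization k) else 0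
        refine ⟨f, Subalgebra.mem_diagonalPart.2 ?_, ?_⟩
        · convert mul_mem (hAd (Pi.single x.2.1 1)) (hAT a) using 1
          ext x₁ x₂
          rw [Matrix.diagonal_mul, hT, Matrix.diagonal_apply, Function.comp_apply]
          by_cases h1 : x₁.2.1 = x.2.1
          · rw [h1, Pi.single_eq_same, (hstab x₁ a).2 (h1 ▸ ha), one_mul]
            simp only [f, h1, if_true]
            exact if_congr eq_comm rfl rfl
          · simp [f, h1]
        · simp only [f, if_pos rfl, if_pos hy.symm]
          exact isUnit_deformedUnit_zpow_sub_zpow z hDS hae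
      · refine ⟨Pi.single x.2.1 1 ∘ fun x ↦ x.2.1, Subalgebra.mem_diagonalPart.2 (hAd _), ?_⟩
        simp [Pi.single_eq_of_ne (Ne.symm hy)]
    obtain ⟨g, rfl⟩ := MulAction.orbit_eq_iff.1 hxx'.symm
    refine Matrix.single_mem_of_unit_entry hd (hAT g) ?_
    rw [hT, if_pos rfl]
    exact Units.isUnit _

/-! ### Maya diagrams and standard words. -/

/-- The position following `u`. -/
def nextBox {J : Type u} (u : J × ℤ) : J × ℤ := (u.1, u.2 + 1)

/-- The states are the Maya diagrams of multipartitions: adding a box of content `c` to the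
component `j` moves a bead from `(j, c)` to `(j, c + 1)`. -/
def moveBead {J : Type u} [DecidableEq J] (u : J × ℤ) (M : J × ℤ → Bool) : J × ℤ → Bool :=
  M ∘ Equiv.swap u (nextBox u)

/-- The Maya diagram of the empty multipartition. -/
def emptyDiagram (J : Type u) : J × ℤ → Bool := fun u ↦ decide (u.2 ≤ 0)

def Addable {J : Type u} (u : J × ℤ) (M : J × ℤ → Bool) : Prop := M u = true ∧ M (nextBox u) = false

def Removable {J : Type u} (u : J × ℤ) (M : J × ℤ → Bool) : Prop :=
  M u = false ∧ M (nextBox u) = true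

/-- Two boxes are far apart if their contents differ by at least two, or they lie in different
components. -/
def FarApart {J : Type u} (u v : J × ℤ) : Prop := u ≠ v ∧ v ≠ nextBox u ∧ u ≠ nextBox v

lemma FarApart.symm {J : Type u} {u v : J × ℤ} (h : FarApart u v) : FarApart v u :=
  ⟨h.1.symm, h.2.2, h.2.1⟩

lemma nextBox_injective {J : Type u} : Function.Injective (nextBox (J := J)) := by
  rintro ⟨a, b⟩ ⟨c, d⟩ h
  simpa [nextBox] using h

lemma nextBox_ne {J : Type u} (u : J × ℤ) : nextBox u ≠ u := by
  intro h
  have := congrArg Prod.snd h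
  simp [nextBox] at this

section Diagrams

variable {J : Type u} {u v : J × ℤ} {M : J × ℤ → Bool}

/-- If one position followed the other, their common position would have to be occupied and empty at
the same time. -/
lemma farApart_of_removable_of_removable (hne : u ≠ v) (hu : Removable u M) (hv : Removable v M) :
    FarApart u v := by
  refine ⟨hne, ?_, ?_⟩
  · rintro rfl
    exact absurd (hu.2.symm.trans hv.1) (by simp)
  · rintro rfl
    exact absurd (hv.2.symm.trans hu.1) (by simp)

/-- Exchange of two consecutive letters of a word that are far apart. -/
def WordStep (n : ℕ) (w w' : ℕ → J × ℤ) : Prop :=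
  ∃ i, i + 1 < n ∧ FarApart (w i) (w (i + 1)) ∧ w' = w ∘ Equiv.swap i (i + 1)

lemma WordStep.mono {m n : ℕ} (h : m ≤ n) {w w' : ℕ → J × ℤ} (hw : WordStep m w w') :
    WordStep n w w' := by
  obtain ⟨i, hi, h'⟩ := hw
  exact ⟨i, by omega, h'⟩
lemma not_removable_emptyDiagram (u : J × ℤ) : ¬ Removable u (emptyDiagram J) := by
  rintro ⟨h1, h2⟩
  have h3 : ¬ u.2 ≤ 0 := of_decide_eq_false h1
  have h4 : u.2 + 1 ≤ 0 := of_decide_eq_true h2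
  omega

variable [DecidableEq J]

lemma moveBead_self (u : J × ℤ) (M : J × ℤ → Bool) : moveBead u M u = M (nextBox u) := by
  simp [moveBead]

lemma moveBead_next (u : J × ℤ) (M : J × ℤ → Bool) : moveBead u M (nextBox u) = M u := by
  simp [moveBead]

lemma moveBead_of_ne (h : v ≠ u) (h' : v ≠ nextBox u) : moveBead u M v = M v := by
  simp [moveBead, Equiv.swap_apply_of_ne_of_ne h h']

lemma moveBead_moveBead (u : J × ℤ) (M : J × ℤ → Bool) : moveBead u (moveBead u M) = M := by
  ext v
  simp [moveBead]

lemma moveBead_injective (u : J × ℤ) : Function.Injective (moveBead u) :=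
  Function.LeftInverse.injective (moveBead_moveBead u)

lemma addable_moveBead : Addable u (moveBead u M) ↔ Removable u M := by
  simp only [Addable, Removable, moveBead_self, moveBead_next]
  exact and_comm

lemma removable_moveBead : Removable u (moveBead u M) ↔ Addable u M := by
  simp only [Addable, Removable, moveBead_self, moveBead_next]
  exact and_comm

lemma FarApart.moveBead_apply (h : FarApart u v) : moveBead v M u = M u :=
  moveBead_of_ne h.1 h.2.2

lemma FarApart.moveBead_apply_next (h : FarApart u v) :
    moveBead v M (nextBox u) = M (nextBox u) :=
  moveBead_of_ne h.2.1.symm fun h' ↦ h.1 (nextBox_injective h')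

lemma FarApart.addable_iff (h : FarApart u v) : Addable u (moveBead v M) ↔ Addable u M := by
  rw [Addable, Addable, h.moveBead_apply, h.moveBead_apply_next]

lemma FarApart.removable_iff (h : FarApart u v) : Removable u (moveBead v M) ↔ Removable u M := by
  rw [Removable, Removable, h.moveBead_apply, h.moveBead_apply_next]

lemma FarApart.moveBead_comm (h : FarApart u v) (M : J × ℤ → Bool) :
    moveBead u (moveBead v M) = moveBead v (moveBead u M) := by
  ext x
  by_cases h1 : x = u
  · subst h1
    rw [h.moveBead_apply, moveBead_self, moveBead_self, h.moveBead_apply_next]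
  by_cases h2 : x = nextBox u
  · subst h2
    rw [h.moveBead_apply_next, moveBead_next, moveBead_next, h.moveBead_apply]
  rw [moveBead_of_ne h1 h2]
  by_cases h3 : x = v
  · subst h3
    rw [moveBead_self, moveBead_self, h.symm.moveBead_apply_next]
  by_cases h4 : x = nextBox v
  · subst h4
    rw [moveBead_next, moveBead_next, h.symm.moveBead_apply]
  rw [moveBead_of_ne h3 h4, moveBead_of_ne h3 h4, moveBead_of_ne h1 h2]

lemma farApart_of_addable_of_removable (hne : u ≠ v) (hu : Addable u M)
    (hv : Removable v (moveBead u M)) : FarApart u v :=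
  farApart_of_removable_of_removable hne (removable_moveBead.2 hu) hv

/-- For different boxes, adding and removing commute as partial operations. This cancels all mixed
terms when the two orders are compared in `sum_addable_sum_removable`. -/
lemma addable_and_removable_iff (hne : u ≠ v) :
    Addable u M ∧ Removable v (moveBead u M) ↔ Removable v M ∧ Addable u (moveBead v M) := by
  constructor
  · rintro ⟨hu, hv⟩
    have h := farApart_of_addable_of_removable hne hu hv
    exact ⟨h.symm.removable_iff.1 hv, h.addable_iff.2 hu⟩
  · rintro ⟨hv, hu⟩
    have h : FarApart u v := by
      refine ⟨hne, ?_, ?_⟩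
      · rintro rfl
        have := hu.2
        rw [moveBead_self, hv.2] at this
        simp at this
      · rintro rfl
        have := hu.1
        rw [moveBead_next, hv.1] at this
        simp at this
    exact ⟨h.addable_iff.1 hu, h.symm.removable_iff.2 hv⟩

lemma Addable.ne_of_addable (hu : Addable u M) (hv : Addable v (moveBead u M)) : u ≠ v := by
  rintro rfl
  have := hv.1
  rw [moveBead_self, hu.2] at this
  simp at this

/-- To add the same box again, the step in between would have to refill `u` and also vacate `nextBox
u`. A single move cannot do both. Thus three consecutive letters are distinct, as the braid relation
requires. -/
lemma Addable.ne_of_addable_of_addable {x : J × ℤ} (hu : Addable u M)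
    (hv : Addable v (moveBead u M)) (hx : Addable x (moveBead v (moveBead u M))) : u ≠ x := by
  rintro rfl
  have hne := hu.ne_of_addable hv
  have h1 := hx.1
  have h2 := hx.2
  have h3 : u = nextBox v := by
    by_contra h
    rw [moveBead_of_ne hne h, moveBead_self, hu.2] at h1
    simp at h1
  have h4 : nextBox u = v := by
    by_contra h
    rw [moveBead_of_ne h fun h' ↦ hne (nextBox_injective h'), moveBead_next, hu.1] at h2
    simp at h2
  have h5 := congrArg Prod.snd h3
  have h6 := congrArg Prod.snd h4
  simp only [nextBox] at h5 h6
  omega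

/-- The diagram reached after adding the first `m` boxes of the word `w`. -/
def wordDiagram (w : ℕ → J × ℤ) : ℕ → (J × ℤ → Bool)
  | 0 => emptyDiagram J
  | m + 1 => moveBead (w m) (wordDiagram w m)

lemma wordDiagram_succ (w : ℕ → J × ℤ) (m : ℕ) :
    wordDiagram w (m + 1) = moveBead (w m) (wordDiagram w m) := rfl

/-- The first `n` letters of `w` are the boxes of a standard multitableau. -/
def IsStandardWord (n : ℕ) (w : ℕ → J × ℤ) : Prop := ∀ m < n, Addable (w m) (wordDiagram w m)

lemma wordDiagram_congr {w w' : ℕ → J × ℤ} {n : ℕ} (h : ∀ m < n, w m = w' m) :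
    wordDiagram w n = wordDiagram w' n := by
  induction n with
  | zero => rfl
  | succ n ih =>
    rw [wordDiagram, wordDiagram, ih fun m hm ↦ h m (by omega), h n (by omega)]

lemma wordDiagram_congr_of_le {w w' : ℕ → J × ℤ} {a n : ℕ}
    (h0 : wordDiagram w a = wordDiagram w' a) (h : ∀ m, a ≤ m → w m = w' m) (han : a ≤ n) :
    wordDiagram w n = wordDiagram w' n := by
  induction n, han using Nat.le_induction with
  | base => exact h0
  | succ n hn ih => rw [wordDiagram, wordDiagram, ih, h n hn]

lemma wordDiagram_swap_of_le (w : ℕ → J × ℤ) {i m : ℕ} (h : m ≤ i) :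
    wordDiagram (w ∘ Equiv.swap i (i + 1)) m = wordDiagram w m :=
  wordDiagram_congr fun a ha ↦ by
    rw [Function.comp_apply, Equiv.swap_apply_of_ne_of_ne (by omega) (by omega)]

lemma wordDiagram_swap_of_ge (w : ℕ → J × ℤ) {i m : ℕ} (hf : FarApart (w i) (w (i + 1)))
    (h : i + 2 ≤ m) : wordDiagram (w ∘ Equiv.swap i (i + 1)) m = wordDiagram w m := by
  refine wordDiagram_congr_of_le ?_ (fun a ha ↦ by
    rw [Function.comp_apply, Equiv.swap_apply_of_ne_of_ne (by omega) (by omega)]) h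
  rw [wordDiagram, wordDiagram, wordDiagram, wordDiagram, wordDiagram_swap_of_le w le_rfl]
  simp only [Function.comp_apply, Equiv.swap_apply_left, Equiv.swap_apply_right]
  exact hf.moveBead_comm _

lemma IsStandardWord.swap {w : ℕ → J × ℤ} {n i : ℕ} (hw : IsStandardWord n w) (hi : i + 1 < n)
    (hf : FarApart (w i) (w (i + 1))) : IsStandardWord n (w ∘ Equiv.swap i (i + 1)) := by
  intro m hm
  rw [Function.comp_apply]
  rcases lt_trichotomy m i with h | rfl | h
  · rw [Equiv.swap_apply_of_ne_of_ne (by omega) (by omega), wordDiagram_swap_of_le w h.le]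
    exact hw m hm
  · rw [Equiv.swap_apply_left, wordDiagram_swap_of_le w le_rfl]
    exact hf.symm.addable_iff.1 (hw (m + 1) hi)
  · rcases (show i + 1 ≤ m by omega).eq_or_lt with rfl | h'
    · rw [Equiv.swap_apply_right, wordDiagram, wordDiagram_swap_of_le w le_rfl,
        Function.comp_apply, Equiv.swap_apply_left]
      exact hf.addable_iff.2 (hw i (by omega))
    · rw [Equiv.swap_apply_of_ne_of_ne (by omega) (by omega), wordDiagram_swap_of_ge w hf h']
      exact hw m hm

lemma IsStandardWord.ne {w : ℕ → J × ℤ} {n i : ℕ} (hw : IsStandardWord n w) (hi : i + 1 < n) :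
    w i ≠ w (i + 1) :=
  (hw i (by omega)).ne_of_addable (hw (i + 1) hi)

lemma IsStandardWord.ne_add_two {w : ℕ → J × ℤ} {n i : ℕ} (hw : IsStandardWord n w)
    (hi : i + 2 < n) : w i ≠ w (i + 2) :=
  (hw i (by omega)).ne_of_addable_of_addable (hw (i + 1) (by omega)) (hw (i + 2) hi)

lemma IsStandardWord.mono {w : ℕ → J × ℤ} {m n : ℕ} (hw : IsStandardWord n w) (h : m ≤ n) :
    IsStandardWord m w := fun a ha ↦ hw a (by omega)

/-- Every removable box is the last one of some standard word. -/
lemma exists_standardWord_of_removable {n : ℕ} {w : ℕ → J × ℤ} (hw : IsStandardWord n w)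
    {v : J × ℤ} (hv : Removable v (wordDiagram w n)) :
    ∃ n' w', n = n' + 1 ∧ IsStandardWord n w' ∧ wordDiagram w' n = wordDiagram w n ∧ w' n' = v ∧
      ∀ m, n ≤ m → w' m = w m := by
  induction n generalizing w with
  | zero => exact absurd hv (not_removable_emptyDiagram v)
  | succ n ih =>
    by_cases h : w n = v
    · exact ⟨n, w, rfl, hw, rfl, h, fun _ _ ↦ rfl⟩
    -- The last box is far from `v`, so `v` was removable before it was added. Make `v` the last
    -- letter of the shorter word, then exchange the two.
    · have hf := farApart_of_addable_of_removable h (hw n (by omega)) hv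
      obtain ⟨n', w', rfl, hw', hd, hv', he⟩ := ih (hw.mono (by omega))
        (hf.symm.removable_iff.1 hv)
      have hst : IsStandardWord (n' + 1 + 1) w' := by
        intro m hm
        rcases (show m ≤ n' + 1 by omega).eq_or_lt with rfl | h'
        · rw [hd, he _ le_rfl]
          exact hw _ hm
        · exact hw' m h'
      have hf' : FarApart (w' n') (w' (n' + 1)) := by
        rw [hv', he _ le_rfl]
        exact hf.symm
      refine ⟨n' + 1, w' ∘ Equiv.swap n' (n' + 1), rfl, hst.swap (by omega) hf', ?_, ?_, ?_⟩
      · rw [wordDiagram_swap_of_ge _ hf' le_rfl, wordDiagram_succ, hd, he _ le_rfl,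
          ← wordDiagram_succ]
      · rw [Function.comp_apply, Equiv.swap_apply_right, hv']
      · intro m hm
        rw [Function.comp_apply, Equiv.swap_apply_of_ne_of_ne (by omega) (by omega),
          he m (by omega)]

/-- Standard words with the same shape are connected by exchanges of letters. -/
theorem wordStep_connected {n : ℕ} {w w' : ℕ → J × ℤ} (hw : IsStandardWord n w)
    (hw' : IsStandardWord n w') (hd : wordDiagram w n = wordDiagram w' n)
    (he : ∀ m, n ≤ m → w m = w' m) : Relation.ReflTransGen (WordStep n) w w' := by
  induction n generalizing w w' with
  | zero =>
    obtain rfl : w = w' := funext fun m ↦ he m (by omega)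
    exact .refl
  | succ n ih =>
    have key {w w' : ℕ → J × ℤ} (hw : IsStandardWord (n + 1) w)
        (hw' : IsStandardWord (n + 1) w') (hd : wordDiagram w (n + 1) = wordDiagram w' (n + 1))
        (he : ∀ m, n ≤ m → w m = w' m) : Relation.ReflTransGen (WordStep (n + 1)) w w' := by
      refine Relation.ReflTransGen.mono (fun _ _ ↦ WordStep.mono n.le_succ) _ _
        (ih (hw.mono (by omega)) (hw'.mono (by omega)) ?_ he)
      rw [wordDiagram_succ, wordDiagram_succ, he n le_rfl] at hd
      exact moveBead_injective _ hd
    by_cases h : w n = w' n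
    · refine key hw hw' hd fun m hm ↦ ?_
      rcases hm.eq_or_lt with rfl | hm
      · exact h
      · exact he m hm
    · have hr' : Removable (w' n) (wordDiagram w (n + 1)) := by
        rw [hd]
        exact removable_moveBead.2 (hw' n (by omega))
      -- If the last letters differ, both boxes are removable from the common shape and far apart.
      -- An intermediate word has `w' n` just before `w n`. It is connected to `w` by induction and,
      -- after one exchange, to `w'`.
      have hf := farApart_of_addable_of_removable h (hw n (by omega)) hr'
      obtain ⟨n', w₁, rfl, hw₁, hd₁, hv₁, he₁⟩ :=
        exists_standardWord_of_removable (hw.mono (by omega)) (hf.symm.removable_iff.1 hr')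
      have hst : IsStandardWord (n' + 1 + 1) w₁ := by
        intro m hm
        rcases (show m ≤ n' + 1 by omega).eq_or_lt with rfl | h'
        · rw [hd₁, he₁ _ le_rfl]
          exact hw _ hm
        · exact hw₁ m h'
      have hd₂ : wordDiagram w₁ (n' + 1 + 1) = wordDiagram w (n' + 1 + 1) := by
        rw [wordDiagram_succ, hd₁, he₁ _ le_rfl, ← wordDiagram_succ]
      have hf' : FarApart (w₁ n') (w₁ (n' + 1)) := by
        rw [hv₁, he₁ _ le_rfl]
        exact hf.symm
      refine (key hw hst hd₂.symm fun m hm ↦ (he₁ m hm).symm).trans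
        (.head ⟨n', by omega, hf', rfl⟩ (key (hst.swap (by omega) hf') hw' ?_ fun m hm ↦ ?_))
      · rw [wordDiagram_swap_of_ge _ hf' le_rfl, hd₂, hd]
      · rw [Function.comp_apply]
        rcases hm.eq_or_lt with rfl | hm
        · rw [Equiv.swap_apply_right, hv₁]
        · rw [Equiv.swap_apply_of_ne_of_ne (by omega) (by omega), he₁ _ (by omega),
            he m (by omega)]

end Diagrams

/-! ### Counting pairs of standard words of equal shape. -/

section Counting

open scoped Classical

variable {J : Type u} {u : J × ℤ} {M : J × ℤ → Bool}

/-- The diagram differs from the empty one in finitely many positions only. -/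
def IsTame (M : J × ℤ → Bool) : Prop := {u | M u ≠ emptyDiagram J u}.Finite

lemma isTame_emptyDiagram : IsTame (emptyDiagram J) := by simp [IsTame]

lemma IsTame.exists_bound (hM : IsTame M) :
    ∃ K : ℕ, ∀ u : J × ℤ, (u.2 ≤ -K → M u = true) ∧ (K < u.2 → M u = false) := by
  obtain ⟨K, hK⟩ := (hM.image fun u ↦ u.2.natAbs).bddAbove
  refine ⟨K + 1, fun u ↦ ?_⟩
  have h (hu : K < u.2.natAbs) : M u = emptyDiagram J u := by
    by_contra h
    exact absurd (hK ⟨u, h, rfl⟩) (by simpa using hu)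
  refine ⟨fun hu ↦ ?_, fun hu ↦ ?_⟩
  · rw [h (by omega)]
    exact decide_eq_true (by omega)
  · rw [h (by omega)]
    exact decide_eq_false (by omega)

lemma IsTame.mem_of_ne (hM : IsTame M) : ∃ K : ℕ, (∀ j, M (j, -K) = true) ∧
    (∀ j, M (j, K + 1) = false) ∧ ∀ u, M u ≠ M (nextBox u) → u.2 ∈ Finset.Ico (-K : ℤ) (K + 1) := by
  obtain ⟨K, hK⟩ := hM.exists_bound
  refine ⟨K, fun j ↦ (hK (j, -K)).1 le_rfl, fun j ↦ (hK (j, K + 1)).2 (by simp), fun u hu ↦ ?_⟩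
  by_contra h
  rw [Finset.mem_Ico, not_and_or, not_le, not_lt] at h
  have h2 : (nextBox u).2 = u.2 + 1 := rfl
  rcases h with h | h
  · exact hu (((hK u).1 (by omega)).trans ((hK _).1 (by omega)).symm)
  · exact hu (((hK u).2 (by omega)).trans ((hK _).2 (by omega)).symm)

lemma Addable.apply_ne {u : J × ℤ} (h : Addable u M) : M u ≠ M (nextBox u) := by
  rw [h.1, h.2]; simp

lemma Removable.apply_ne {u : J × ℤ} (h : Removable u M) : M u ≠ M (nextBox u) := by
  rw [h.1, h.2]; simp

section

variable [DecidableEq J]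

lemma IsTame.moveBead (hM : IsTame M) (u : J × ℤ) : IsTame (moveBead u M) := by
  refine (hM.union (Set.toFinite {u, nextBox u})).subset fun v hv ↦ ?_
  by_cases h : v = u ∨ v = nextBox u
  · exact Or.inr h
  · rw [not_or] at h
    left
    rwa [Set.mem_ofPred_eq, moveBead_of_ne h.1 h.2] at hv

lemma isTame_wordDiagram (w : ℕ → J × ℤ) (n : ℕ) : IsTame (wordDiagram w n) := by
  induction n with
  | zero => exact isTame_emptyDiagram
  | succ n ih => exact ih.moveBead _

end

variable [Fintype J]

lemma IsTame.finite_ne (hM : IsTame M) : {u | M u ≠ M (nextBox u)}.Finite := by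
  obtain ⟨K, -, -, hK⟩ := hM.mem_of_ne
  refine ((Finset.univ ×ˢ Finset.Ico (-K : ℤ) (K + 1) : Finset (J × ℤ)).finite_toSet).subset
    fun u hu ↦ ?_
  simpa using hK u hu

/-- The finite set of boxes that can be added to a diagram. -/
noncomputable def addableBoxes (M : J × ℤ → Bool) : Finset (J × ℤ) :=
  if h : {u | Addable u M}.Finite then h.toFinset else ∅

/-- The finite set of boxes that can be removed from a diagram. -/
noncomputable def removableBoxes (M : J × ℤ → Bool) : Finset (J × ℤ) :=
  if h : {u | Removable u M}.Finite then h.toFinset else ∅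

lemma IsTame.mem_addableBoxes (hM : IsTame M) : u ∈ addableBoxes M ↔ Addable u M := by
  have h : {u | Addable u M}.Finite := hM.finite_ne.subset fun _ h ↦ Addable.apply_ne h
  rw [addableBoxes, dif_pos h]
  exact h.mem_toFinset

lemma IsTame.mem_removableBoxes (hM : IsTame M) : u ∈ removableBoxes M ↔ Removable u M := by
  have h : {u | Removable u M}.Finite := hM.finite_ne.subset fun _ h ↦ Removable.apply_ne h
  rw [removableBoxes, dif_pos h]
  exact h.mem_toFinset

lemma sum_Ico_sub_int (f : ℤ → ℤ) (a : ℤ) (n : ℕ) :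
    ∑ c ∈ Finset.Ico a (a + n), (f c - f (c + 1)) = f a - f (a + n) := by
  induction n with
  | zero => simp
  | succ n ih =>
    have h : Finset.Ico a (a + (n + 1 : ℕ)) = insert (a + n) (Finset.Ico a (a + n)) := by
      ext c
      simp only [Finset.mem_Ico, Finset.mem_insert]
      omega
    rw [h, Finset.sum_insert (by simp), ih]
    push_cast
    ring_nf

/-- In each component the diagram passes from occupied to empty, so drops exceed rises by exactly
one. The sum telescopes over a window of contents from -K to K. -/
lemma IsTame.card_addableBoxes (hM : IsTame M) :
    (addableBoxes M).card = (removableBoxes M).card + Fintype.card J := by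
  obtain ⟨K, hK1, hK2, hK⟩ := hM.mem_of_ne
  set s : Finset (J × ℤ) := Finset.univ ×ˢ Finset.Ico (-K : ℤ) (K + 1) with hs
  have hadd : addableBoxes M = s.filter fun u ↦ M u = true ∧ M (nextBox u) = false := by
    ext u
    rw [hM.mem_addableBoxes, Finset.mem_filter]
    exact ⟨fun h ↦ ⟨by simpa [hs] using hK u h.apply_ne, h⟩, fun h ↦ h.2⟩
  have hrem : removableBoxes M = s.filter fun u ↦ M u = false ∧ M (nextBox u) = true := by
    ext u
    rw [hM.mem_removableBoxes, Finset.mem_filter]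
    exact ⟨fun h ↦ ⟨by simpa [hs] using hK u h.apply_ne, h⟩, fun h ↦ h.2⟩
  have h1 : ((addableBoxes M).card : ℤ) - (removableBoxes M).card =
      ∑ u ∈ s, ((if M u then (1 : ℤ) else 0) - if M (nextBox u) then 1 else 0) := by
    rw [hadd, hrem, Finset.card_filter, Finset.card_filter]
    push_cast
    rw [← Finset.sum_sub_distrib]
    refine Finset.sum_congr rfl fun u _ ↦ ?_
    cases M u <;> cases M (nextBox u) <;> simp
  have h2 : ∑ u ∈ s, ((if M u then (1 : ℤ) else 0) - if M (nextBox u) then 1 else 0) =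
      Fintype.card J := by
    rw [hs, Finset.sum_product, Finset.sum_congr rfl fun j _ ↦ ?_]
    · rw [Finset.sum_const, Finset.card_univ, nsmul_one]
    · have h3 := sum_Ico_sub_int (fun c ↦ if M (j, c) then 1 else 0) (-K) (2 * K + 1)
      have h4 : (-K : ℤ) + ((2 * K + 1 : ℕ) : ℤ) = K + 1 := by push_cast; ring
      rw [h4] at h3
      refine h3.trans ?_
      simp [hK1, hK2]
  omega

variable [DecidableEq J]

/-- The number of standard words of length `n` with final diagram `M`. -/
noncomputable def wordCount : ℕ → (J × ℤ → Bool) → ℕ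
  | 0, M => if M = emptyDiagram J then 1 else 0
  | n + 1, M => ∑ u ∈ removableBoxes M, wordCount n (moveBead u M)

/-- Adding a box and then removing one is, up to `card J` times the identity, the same as removing
a box and then adding one. -/
lemma sum_addable_sum_removable (hM : IsTame M) (f : (J × ℤ → Bool) → ℕ) :
    ∑ u ∈ addableBoxes M, ∑ v ∈ removableBoxes (moveBead u M), f (moveBead v (moveBead u M)) =
      ∑ v ∈ removableBoxes M, ∑ u ∈ addableBoxes (moveBead v M), f (moveBead u (moveBead v M)) +
        Fintype.card J * f M := by
  have h1 (u) (hu : u ∈ addableBoxes M) :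
      ∑ v ∈ removableBoxes (moveBead u M), f (moveBead v (moveBead u M)) =
        f M + ∑ v ∈ (removableBoxes (moveBead u M)).erase u, f (moveBead v (moveBead u M)) := by
    rw [← Finset.add_sum_erase _ _ ((hM.moveBead u).mem_removableBoxes.2
      (removable_moveBead.2 (hM.mem_addableBoxes.1 hu))), moveBead_moveBead]
  have h2 (v) (hv : v ∈ removableBoxes M) :
      ∑ u ∈ addableBoxes (moveBead v M), f (moveBead u (moveBead v M)) =
        f M + ∑ u ∈ (addableBoxes (moveBead v M)).erase v, f (moveBead u (moveBead v M)) := by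
    rw [← Finset.add_sum_erase _ _ ((hM.moveBead v).mem_addableBoxes.2
      (addable_moveBead.2 (hM.mem_removableBoxes.1 hv))), moveBead_moveBead]
  rw [Finset.sum_congr rfl h1, Finset.sum_congr rfl h2, Finset.sum_add_distrib,
    Finset.sum_add_distrib, Finset.sum_const, Finset.sum_const, hM.card_addableBoxes]
  have h3 : ∑ u ∈ addableBoxes M, ∑ v ∈ (removableBoxes (moveBead u M)).erase u,
      f (moveBead v (moveBead u M)) = ∑ v ∈ removableBoxes M,
        ∑ u ∈ (addableBoxes (moveBead v M)).erase v, f (moveBead v (moveBead u M)) := by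
    refine Finset.sum_comm' fun u v ↦ ?_
    rw [Finset.mem_erase, Finset.mem_erase, hM.mem_addableBoxes, hM.mem_removableBoxes,
      (hM.moveBead u).mem_removableBoxes, (hM.moveBead v).mem_addableBoxes]
    by_cases h : u = v
    · simp [h]
    · have := addable_and_removable_iff (M := M) h
      have h' : v ≠ u := Ne.symm h
      tauto
  have h4 : ∑ v ∈ removableBoxes M, ∑ u ∈ (addableBoxes (moveBead v M)).erase v,
      f (moveBead v (moveBead u M)) = ∑ v ∈ removableBoxes M,
        ∑ u ∈ (addableBoxes (moveBead v M)).erase v, f (moveBead u (moveBead v M)) := by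
    refine Finset.sum_congr rfl fun v hv ↦ Finset.sum_congr rfl fun u hu ↦ ?_
    rw [Finset.mem_erase, (hM.moveBead v).mem_addableBoxes] at hu
    rw [hM.mem_removableBoxes] at hv
    have h5 := (addable_and_removable_iff (M := M) hu.1).2 ⟨hv, hu.2⟩
    rw [(farApart_of_addable_of_removable hu.1 h5.1 h5.2).moveBead_comm]
  rw [h3, h4]
  simp only [smul_eq_mul]
  ring

/-- The commutation relation of adding and removing behaves like that of differentiation and
multiplication by x, and this is the rule for the derivative of x^(n+1). In the base case nothing
can be removed from the empty diagram. -/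
lemma sum_addable_wordCount (n : ℕ) (hM : IsTame M) :
    ∑ u ∈ addableBoxes M, wordCount (n + 1) (moveBead u M) =
      Fintype.card J * (n + 1) * wordCount n M := by
  induction n generalizing M with
  | zero =>
    simp only [wordCount]
    rw [sum_addable_sum_removable hM (fun M ↦ if M = emptyDiagram J then 1 else 0),
      Finset.sum_eq_zero fun v hv ↦ Finset.sum_eq_zero fun u hu ↦ ?_]
    · simp
    · rw [if_neg]
      intro h
      have h1 := removable_moveBead.2 ((hM.moveBead v).mem_addableBoxes.1 hu)
      rw [h] at h1
      exact not_removable_emptyDiagram u h1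
  | succ n ih =>
    have h1 (n : ℕ) (M : J × ℤ → Bool) : wordCount (n + 1) M =
      ∑ u ∈ removableBoxes M, wordCount n (moveBead u M) := rfl
    simp only [h1 (n + 1)]
    rw [sum_addable_sum_removable hM (wordCount (n + 1)),
      Finset.sum_congr rfl fun v _ ↦ ih (hM.moveBead v), ← Finset.mul_sum, ← h1]
    ring

/-- The finite set of standard words of length `n`, continued by the constant `u₀`. -/
noncomputable def standardWords (u₀ : J × ℤ) : ℕ → Finset (ℕ → J × ℤ)
  | 0 => {fun _ ↦ u₀}
  | n + 1 => ((standardWords u₀ n).sigma fun w ↦ addableBoxes (wordDiagram w n)).image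
      fun p ↦ Function.update p.1 n p.2

lemma mem_standardWords {u₀ : J × ℤ} {n : ℕ} {w : ℕ → J × ℤ} :
    w ∈ standardWords u₀ n ↔ IsStandardWord n w ∧ ∀ m, n ≤ m → w m = u₀ := by
  induction n generalizing w with
  | zero =>
    rw [standardWords, Finset.mem_singleton]
    exact ⟨fun h ↦ ⟨fun m hm ↦ absurd hm (by omega), fun m _ ↦ by rw [h]⟩,
      fun h ↦ funext fun m ↦ h.2 m (by omega)⟩
  | succ n ih =>
    rw [standardWords, Finset.mem_image]
    constructor
    · rintro ⟨⟨w, u⟩, hp, rfl⟩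
      rw [Finset.mem_sigma, ih, (isTame_wordDiagram w n).mem_addableBoxes] at hp
      obtain ⟨⟨hw, hw0⟩, hu⟩ := hp
      dsimp only at hw hw0 hu ⊢
      have h1 (m) (hm : m ≤ n) : wordDiagram (Function.update w n u) m = wordDiagram w m :=
        wordDiagram_congr fun a ha ↦ Function.update_of_ne (by omega) _ _
      refine ⟨fun m hm ↦ ?_, fun m hm ↦ ?_⟩
      · rw [h1 m (by omega)]
        rcases (show m ≤ n by omega).eq_or_lt with rfl | h
        · rwa [Function.update_self]
        · rw [Function.update_of_ne h.ne]
          exact hw m h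
      · rw [Function.update_of_ne (by omega)]
        exact hw0 m (by omega)
    · rintro ⟨hw, hw0⟩
      have h1 (m) (hm : m ≤ n) : wordDiagram (Function.update w n u₀) m = wordDiagram w m :=
        wordDiagram_congr fun a ha ↦ Function.update_of_ne (by omega) _ _
      refine ⟨⟨Function.update w n u₀, w n⟩, ?_, by simp⟩
      rw [Finset.mem_sigma, ih, (isTame_wordDiagram _ n).mem_addableBoxes]
      dsimp only
      refine ⟨⟨fun m hm ↦ ?_, fun m hm ↦ ?_⟩, ?_⟩
      · rw [h1 m hm.le, Function.update_of_ne hm.ne]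
        exact hw m (by omega)
      · rcases hm.eq_or_lt with rfl | hm
        · rw [Function.update_self]
        · rw [Function.update_of_ne hm.ne']
          exact hw0 m hm
      · rw [h1 n le_rfl]
        exact hw n (by omega)

lemma sum_standardWords_succ (u₀ : J × ℤ) (n : ℕ) (f : (J × ℤ → Bool) → ℕ) :
    ∑ w ∈ standardWords u₀ (n + 1), f (wordDiagram w (n + 1)) =
      ∑ w ∈ standardWords u₀ n, ∑ u ∈ addableBoxes (wordDiagram w n),
        f (moveBead u (wordDiagram w n)) := by
  rw [standardWords, Finset.sum_image, Finset.sum_sigma]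
  · refine Finset.sum_congr rfl fun w _ ↦ Finset.sum_congr rfl fun u _ ↦ ?_
    have h : wordDiagram (Function.update w n u) n = wordDiagram w n :=
      wordDiagram_congr fun a ha ↦ Function.update_of_ne ha.ne _ _
    rw [wordDiagram_succ, Function.update_self, h]
  · rintro ⟨w, u⟩ hp ⟨w', u'⟩ hp' h
    rw [Finset.mem_coe, Finset.mem_sigma, mem_standardWords] at hp hp'
    dsimp only at h hp hp'
    have h1 : u = u' := by simpa using congrFun h n
    have h2 : w = w' := by
      ext1 m
      by_cases hm : m = n
      · rw [hm, hp.1.2 n le_rfl, hp'.1.2 n le_rfl]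
      · simpa [Function.update_of_ne hm] using congrFun h m
    rw [h1, h2]

lemma card_filter_standardWords (u₀ : J × ℤ) (n : ℕ) (hM : IsTame M) :
    ((standardWords u₀ n).filter fun w ↦ wordDiagram w n = M).card = wordCount n M := by
  induction n generalizing M with
  | zero =>
    rw [standardWords, wordCount, Finset.filter_singleton]
    simp only [wordDiagram, eq_comm]
    split_ifs <;> rfl
  | succ n ih =>
    rw [Finset.card_filter, sum_standardWords_succ u₀ n fun N ↦ if N = M then 1 else 0]
    have h1 : wordCount (n + 1) M = ∑ u ∈ removableBoxes M, wordCount n (moveBead u M) := rfl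
    rw [h1, Finset.sum_congr rfl fun u _ ↦ (ih (hM.moveBead u)).symm]
    simp only [← Finset.card_filter]
    simp only [Finset.card_eq_sum_ones]
    refine Finset.sum_comm' fun w u ↦ ?_
    rw [Finset.mem_filter, Finset.mem_filter, (isTame_wordDiagram w n).mem_addableBoxes,
      hM.mem_removableBoxes]
    constructor
    · rintro ⟨hw, hu, rfl⟩
      exact ⟨⟨hw, (moveBead_moveBead _ _).symm⟩, removable_moveBead.2 hu⟩
    · rintro ⟨⟨hw, h⟩, hu⟩
      rw [h, addable_moveBead, moveBead_moveBead]
      exact ⟨hw, hu, rfl⟩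

/-- The number of pairs of standard words of the same shape. -/
theorem sum_wordCount_standardWords (u₀ : J × ℤ) (n : ℕ) :
    ∑ w ∈ standardWords u₀ n, wordCount n (wordDiagram w n) = Fintype.card J ^ n * n.factorial := by
  induction n with
  | zero => simp [standardWords, wordDiagram, wordCount]
  | succ n ih =>
    rw [sum_standardWords_succ u₀ n (wordCount (n + 1)), Finset.sum_congr rfl fun w _ ↦
      sum_addable_wordCount n (isTame_wordDiagram w n), ← Finset.mul_sum, ih, Nat.factorial_succ]
    ring

end Counting

/-! ### Young's seminormal form. -/

section Seminormal

open scoped Classical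

variable {R : Type u} [CommRing R] {J : Type v}

/-- The diagonal coefficient of Young's seminormal form. -/
noncomputable def seminormalDiag (q : Rˣ) (u v : J × ℤ) : R :=
  if u.1 = v.1 then ((q : R) - 1) * Ring.inverse (1 - ((q ^ (u.2 - v.2) : Rˣ) : R)) else 0

/-- The off-diagonal coefficient of Young's seminormal form. -/
noncomputable def seminormalOff (q : Rˣ) (u v : J × ℤ) : R :=
  if FarApart u v then 1 + seminormalDiag q u v else 0

lemma seminormalDiag_of_ne (q : Rˣ) {u v : J × ℤ} (h : u.1 ≠ v.1) : seminormalDiag q u v = 0 :=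
  if_neg h

lemma isUnit_zpow_sub_zpow {q : Rˣ} (hq : ∀ m : ℤ, m ≠ 0 → IsUnit (((q ^ m : Rˣ) : R) - 1))
    {m n : ℤ} (h : m ≠ n) : IsUnit (((q ^ m : Rˣ) : R) - ((q ^ n : Rˣ) : R)) := by
  have h1 := (q ^ n).isUnit.mul (hq (m - n) (sub_ne_zero.2 h))
  rwa [mul_sub, ← Units.val_mul, ← zpow_add, add_sub_cancel, mul_one] at h1

lemma snd_ne_of_ne {u v : J × ℤ} (h1 : u.1 = v.1) (h : u ≠ v) : u.2 ≠ v.2 :=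
  fun h2 ↦ h (Prod.ext h1 h2)

lemma seminormalDiag_mul {q : Rˣ} (hq : ∀ m : ℤ, m ≠ 0 → IsUnit (((q ^ m : Rˣ) : R) - 1))
    {u v : J × ℤ} (h1 : u.1 = v.1) (h : u ≠ v) :
    seminormalDiag q u v * (((q ^ v.2 : Rˣ) : R) - ((q ^ u.2 : Rˣ) : R)) =
      ((q : R) - 1) * ((q ^ v.2 : Rˣ) : R) := by
  have hu : IsUnit (1 - ((q ^ (u.2 - v.2) : Rˣ) : R)) := by
    have := (hq (u.2 - v.2) (sub_ne_zero.2 (snd_ne_of_ne h1 h))).neg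
    rwa [neg_sub] at this
  have h2 : ((q ^ v.2 : Rˣ) : R) - ((q ^ u.2 : Rˣ) : R) =
      (1 - ((q ^ (u.2 - v.2) : Rˣ) : R)) * ((q ^ v.2 : Rˣ) : R) := by
    rw [sub_mul, one_mul, ← Units.val_mul, ← zpow_add, sub_add_cancel]
  rw [seminormalDiag, if_pos h1, h2]
  linear_combination ((q : R) - 1) * ((q ^ v.2 : Rˣ) : R) * Ring.inverse_mul_cancel _ hu

lemma seminormalDiag_add {q : Rˣ} (hq : ∀ m : ℤ, m ≠ 0 → IsUnit (((q ^ m : Rˣ) : R) - 1))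
    {u v : J × ℤ} (h1 : u.1 = v.1) (h : u ≠ v) :
    seminormalDiag q u v + seminormalDiag q v u = q - 1 := by
  refine (isUnit_zpow_sub_zpow hq (snd_ne_of_ne h1 h).symm).mul_right_cancel ?_
  linear_combination seminormalDiag_mul hq h1 h - seminormalDiag_mul hq h1.symm h.symm

lemma seminormalDiag_next {q : Rˣ} (hq : ∀ m : ℤ, m ≠ 0 → IsUnit (((q ^ m : Rˣ) : R) - 1))
    (u : J × ℤ) : seminormalDiag q (nextBox u) u = -1 := by
  have h := seminormalDiag_mul hq (u := nextBox u) (v := u) rfl (nextBox_ne u)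
  have h1 : (nextBox u).2 ≠ u.2 := snd_ne_of_ne (u := nextBox u) (v := u) rfl (nextBox_ne u)
  refine (isUnit_zpow_sub_zpow hq h1.symm).mul_right_cancel ?_
  rw [h]
  have h2 : ((q ^ (nextBox u).2 : Rˣ) : R) = q * ((q ^ u.2 : Rˣ) : R) := by
    rw [← Units.val_mul, ← zpow_one_add, add_comm]
    rfl
  rw [h2]
  ring

/-- For neighbouring boxes one of the two diagonal coefficients is -1, so the right side vanishes
together with the left. -/
lemma seminormalOff_mul {q : Rˣ} (hq : ∀ m : ℤ, m ≠ 0 → IsUnit (((q ^ m : Rˣ) : R) - 1))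
    {u v : J × ℤ} (h : u ≠ v) : seminormalOff q u v * seminormalOff q v u =
      (1 + seminormalDiag q u v) * (1 + seminormalDiag q v u) := by
  by_cases hf : FarApart u v
  · rw [seminormalOff, seminormalOff, if_pos hf, if_pos hf.symm]
  · rw [seminormalOff, if_neg hf, zero_mul]
    by_cases h1 : v = nextBox u
    · rw [h1, seminormalDiag_next hq]
      simp
    · have h2 : u = nextBox v := by
        by_contra h2
        exact hf ⟨h, h1, h2⟩
      rw [h2, seminormalDiag_next hq]
      simp

/-- In one component, 1 plus the diagonal coefficient is (q^(v.2+1) - q^u.2)/(q^v.2 - q^u.2), whose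
numerator is invertible because `u` is not the box following `v`. -/
lemma isUnit_seminormalOff {q : Rˣ} (hq : ∀ m : ℤ, m ≠ 0 → IsUnit (((q ^ m : Rˣ) : R) - 1))
    {u v : J × ℤ} (h : FarApart u v) : IsUnit (seminormalOff q u v) := by
  rw [seminormalOff, if_pos h]
  by_cases h1 : u.1 = v.1
  · have h2 := seminormalDiag_mul hq h1 h.1
    have h3 : u.2 ≠ v.2 + 1 := fun h' ↦ h.2.2 (Prod.ext h1 h')
    have h4 := isUnit_zpow_sub_zpow hq h3.symm
    have h5 : (1 + seminormalDiag q u v) * (((q ^ v.2 : Rˣ) : R) - ((q ^ u.2 : Rˣ) : R)) =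
        ((q ^ (v.2 + 1) : Rˣ) : R) - ((q ^ u.2 : Rˣ) : R) := by
      rw [zpow_add_one, Units.val_mul]
      linear_combination h2
    rw [← h5] at h4
    exact isUnit_of_mul_isUnit_left h4
  · rw [seminormalDiag_of_ne q h1, add_zero]
    exact isUnit_one

/-- A partial fraction identity in the three powers of `q`, checked after multiplication by their
invertible differences. If the boxes do not all share a component, the surviving terms cancel. -/
lemma seminormalDiag_triple {q : Rˣ} (hq : ∀ m : ℤ, m ≠ 0 → IsUnit (((q ^ m : Rˣ) : R) - 1))
    {u v x : J × ℤ} (huv : u ≠ v) (hvx : v ≠ x) (hux : u ≠ x) :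
    seminormalDiag q u v * seminormalDiag q v x + seminormalDiag q u x * seminormalDiag q v u =
      seminormalDiag q v x * seminormalDiag q u x := by
  by_cases h1 : u.1 = v.1
  · by_cases h2 : v.1 = x.1
    · have h3 := h1.trans h2
      have e1 := seminormalDiag_mul hq h1 huv
      have e2 := seminormalDiag_mul hq h2 hvx
      have e3 := seminormalDiag_mul hq h3 hux
      have e4 := seminormalDiag_mul hq h1.symm huv.symm
      have u1 := isUnit_zpow_sub_zpow hq (snd_ne_of_ne h1 huv).symm
      have u2 := isUnit_zpow_sub_zpow hq (snd_ne_of_ne h2 hvx).symm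
      have u3 := isUnit_zpow_sub_zpow hq (snd_ne_of_ne h3 hux).symm
      generalize seminormalDiag q u v = a at *
      generalize seminormalDiag q v x = b at *
      generalize seminormalDiag q u x = c at *
      generalize seminormalDiag q v u = d at *
      generalize ((q ^ u.2 : Rˣ) : R) = X at *
      generalize ((q ^ v.2 : Rˣ) : R) = Y at *
      generalize ((q ^ x.2 : Rˣ) : R) = Z at *
      refine ((u1.mul u2).mul u3).mul_right_cancel ?_
      linear_combination b * (Z - Y) * (Z - X) * e1 + ((q : R) - 1) * Y * (Z - X) * e2 -
        d * (X - Y) * (Z - Y) * e3 - ((q : R) - 1) * Z * (Z - Y) * e4 -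
        c * (Y - X) * (Z - X) * e2 - ((q : R) - 1) * Z * (Y - X) * e3
    · rw [seminormalDiag_of_ne q h2, seminormalDiag_of_ne q fun h ↦ h2 (h1.symm.trans h)]
      ring
  · rw [seminormalDiag_of_ne q h1, seminormalDiag_of_ne q (Ne.symm h1)]
    by_cases h2 : v.1 = x.1
    · rw [seminormalDiag_of_ne (u := u) (v := x) q fun h ↦ h1 (h.trans h2.symm)]
      ring
    · rw [seminormalDiag_of_ne q h2]
      ring

lemma seminormal_braid {q : Rˣ} (hq : ∀ m : ℤ, m ≠ 0 → IsUnit (((q ^ m : Rˣ) : R) - 1))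
    {u v x : J × ℤ} (huv : u ≠ v) (hvx : v ≠ x) (hux : u ≠ x) :
    seminormalDiag q u v ^ 2 * seminormalDiag q v x +
        seminormalOff q u v * seminormalOff q v u * seminormalDiag q u x =
      seminormalDiag q v x ^ 2 * seminormalDiag q u v +
        seminormalOff q v x * seminormalOff q x v * seminormalDiag q u x := by
  rw [seminormalOff_mul hq huv, seminormalOff_mul hq hvx]
  have ht := seminormalDiag_triple hq huv hvx hux
  by_cases h1 : u.1 = v.1
  · by_cases h2 : v.1 = x.1
    · have e1 := seminormalDiag_add hq h1 huv
      have e2 := seminormalDiag_add hq h2 hvx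
      rw [← eq_sub_iff_add_eq'] at e1 e2
      rw [e1] at ht
      rw [e1, e2]
      linear_combination (seminormalDiag q u v - seminormalDiag q v x) * ht
    · rw [seminormalDiag_of_ne q h2, seminormalDiag_of_ne q fun h ↦ h2 (h1.symm.trans h)]
      ring
  · rw [seminormalDiag_of_ne q h1, seminormalDiag_of_ne q (Ne.symm h1)]
    by_cases h2 : v.1 = x.1
    · rw [seminormalDiag_of_ne (u := u) (v := x) q fun h ↦ h1 (h.trans h2.symm)]
      ring
    · rw [seminormalDiag_of_ne q h2, seminormalDiag_of_ne q (Ne.symm h2)]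

lemma seminormalDiag_triple' {q : Rˣ} (hq : ∀ m : ℤ, m ≠ 0 → IsUnit (((q ^ m : Rˣ) : R) - 1))
    {u v x : J × ℤ} (huv : u ≠ v) (hvx : v ≠ x) (hux : u ≠ x) :
    seminormalDiag q u v * seminormalDiag q u x =
      seminormalDiag q v x * seminormalDiag q u v + seminormalDiag q u x * seminormalDiag q x v := by
  have ht := seminormalDiag_triple hq huv hvx hux
  by_cases h1 : u.1 = v.1
  · by_cases h2 : v.1 = x.1
    · have e1 := seminormalDiag_add hq h1 huv
      have e2 := seminormalDiag_add hq h2 hvx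
      rw [← eq_sub_iff_add_eq'] at e1 e2
      rw [e1] at ht
      rw [e2]
      linear_combination -ht
    · rw [seminormalDiag_of_ne q h2, seminormalDiag_of_ne q fun h ↦ h2 (h1.symm.trans h)]
      ring
  · rw [seminormalDiag_of_ne q h1]
    by_cases h2 : v.1 = x.1
    · rw [seminormalDiag_of_ne (u := u) (v := x) q fun h ↦ h1 (h.trans h2.symm)]
      ring
    · rw [seminormalDiag_of_ne q (Ne.symm h2)]
      ring

lemma seminormal_quadratic {q : Rˣ} (hq : ∀ m : ℤ, m ≠ 0 → IsUnit (((q ^ m : Rˣ) : R) - 1))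
    {u v : J × ℤ} (h : u ≠ v) : seminormalDiag q u v ^ 2 +
      seminormalOff q u v * seminormalOff q v u =
      1 + ((q : R) - 1) * (if u.1 = v.1 then 1 else 0) * (1 + seminormalDiag q u v) := by
  rw [seminormalOff_mul hq h]
  by_cases h1 : u.1 = v.1
  · rw [if_pos h1]
    linear_combination (1 + seminormalDiag q u v) * seminormalDiag_add hq h1 h
  · rw [if_neg h1, seminormalDiag_of_ne q h1, seminormalDiag_of_ne q (Ne.symm h1)]
    ring

/-- The seminormal operator on functions of words that exchanges the letters `i` and `i + 1`. -/
noncomputable def seminormalOp (q : Rˣ) (i : ℕ) (F : (ℕ → J × ℤ) → R) (w : ℕ → J × ℤ) : R :=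
  seminormalDiag q (w i) (w (i + 1)) * F w +
    seminormalOff q (w i) (w (i + 1)) * F (w ∘ Equiv.swap i (i + 1))

/-- Compare the coefficients of `F` at the six rearrangements of three letters. Only those at `w`
and its two neighbours need an identity: `seminormal_braid` for the first and the two triple
identities for the others. -/
lemma seminormalOp_braid {q : Rˣ} (hq : ∀ m : ℤ, m ≠ 0 → IsUnit (((q ^ m : Rˣ) : R) - 1))
    (i : ℕ) (F : (ℕ → J × ℤ) → R) {w : ℕ → J × ℤ} (h1 : w i ≠ w (i + 1))
    (h2 : w (i + 1) ≠ w (i + 2)) (h3 : w i ≠ w (i + 2)) :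
    seminormalOp q i (seminormalOp q (i + 1) (seminormalOp q i F)) w =
      seminormalOp q (i + 1) (seminormalOp q i (seminormalOp q (i + 1) F)) w := by
  have e1 : ((w ∘ Equiv.swap i (i + 1)) ∘ Equiv.swap i (i + 1)) = w := by ext1; simp
  have e2 : ((w ∘ Equiv.swap (i + 1) (i + 1 + 1)) ∘ Equiv.swap (i + 1) (i + 1 + 1)) = w := by
    ext1; simp
  have e3 : (((w ∘ Equiv.swap (i + 1) (i + 1 + 1)) ∘ Equiv.swap i (i + 1)) ∘
      Equiv.swap (i + 1) (i + 1 + 1)) = (((w ∘ Equiv.swap i (i + 1)) ∘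
        Equiv.swap (i + 1) (i + 1 + 1)) ∘ Equiv.swap i (i + 1)) := by
    have : Equiv.swap (i + 1) (i + 1 + 1) * Equiv.swap i (i + 1) * Equiv.swap (i + 1) (i + 1 + 1) =
        Equiv.swap i (i + 1) * Equiv.swap (i + 1) (i + 1 + 1) * Equiv.swap i (i + 1) := by
      rw [Equiv.swap_mul_swap_mul_swap (by omega) (by omega), Equiv.swap_comm i,
        Equiv.swap_comm (i + 1) (i + 1 + 1), Equiv.swap_mul_swap_mul_swap (by omega) (by omega),
        Equiv.swap_comm]
    have h := congrArg (fun s : Equiv.Perm ℕ ↦ w ∘ s) this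
    simpa only [Equiv.Perm.coe_mul, ← Function.comp_assoc] using h
  have s1 : Equiv.swap i (i + 1) (i + 1 + 1) = i + 1 + 1 :=
    Equiv.swap_apply_of_ne_of_ne (by omega) (by omega)
  have s2 : Equiv.swap (i + 1) (i + 1 + 1) i = i :=
    Equiv.swap_apply_of_ne_of_ne (by omega) (by omega)
  simp only [seminormalOp, e1, e2, e3, Function.comp_apply, s1, s2, Equiv.swap_apply_left,
    Equiv.swap_apply_right]
  have b1 := seminormal_braid hq h1 h2 h3
  have b2 := seminormalDiag_triple hq h1 h2 h3
  have b3 := seminormalDiag_triple' hq h1 h2 h3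
  linear_combination F w * b1 + seminormalOff q (w i) (w (i + 1)) *
    F (w ∘ Equiv.swap i (i + 1)) * b2 + seminormalOff q (w (i + 1)) (w (i + 2)) *
    F (w ∘ Equiv.swap (i + 1) (i + 1 + 1)) * b3

lemma seminormalOp_comm (q : Rˣ) {i j : ℕ} (hij : i + 1 < j) (F : (ℕ → J × ℤ) → R)
    (w : ℕ → J × ℤ) : seminormalOp q i (seminormalOp q j F) w =
      seminormalOp q j (seminormalOp q i F) w := by
  have e : ((w ∘ Equiv.swap i (i + 1)) ∘ Equiv.swap j (j + 1)) =
      ((w ∘ Equiv.swap j (j + 1)) ∘ Equiv.swap i (i + 1)) := by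
    have hd : Equiv.Perm.Disjoint (Equiv.swap i (i + 1)) (Equiv.swap j (j + 1)) := by
      intro x
      by_cases h : x = i ∨ x = i + 1
      · exact Or.inr (Equiv.swap_apply_of_ne_of_ne (by omega) (by omega))
      · exact Or.inl (Equiv.swap_apply_of_ne_of_ne (by omega) (by omega))
    have h := congrArg (fun s : Equiv.Perm ℕ ↦ w ∘ s) hd.commute.eq
    simpa only [Equiv.Perm.coe_mul, ← Function.comp_assoc] using h
  have s1 : Equiv.swap i (i + 1) j = j := Equiv.swap_apply_of_ne_of_ne (by omega) (by omega)
  have s2 : Equiv.swap i (i + 1) (j + 1) = j + 1 :=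
    Equiv.swap_apply_of_ne_of_ne (by omega) (by omega)
  have s3 : Equiv.swap j (j + 1) i = i := Equiv.swap_apply_of_ne_of_ne (by omega) (by omega)
  have s4 : Equiv.swap j (j + 1) (i + 1) = i + 1 :=
    Equiv.swap_apply_of_ne_of_ne (by omega) (by omega)
  simp only [seminormalOp, e, Function.comp_apply, s1, s2, s3, s4]
  ring

lemma seminormalOp_sq {q : Rˣ} (hq : ∀ m : ℤ, m ≠ 0 → IsUnit (((q ^ m : Rˣ) : R) - 1)) (i : ℕ)
    (F : (ℕ → J × ℤ) → R) {w : ℕ → J × ℤ} (h : w i ≠ w (i + 1)) :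
    seminormalOp q i (seminormalOp q i F) w = F w +
      ((q : R) - 1) * (if (w i).1 = (w (i + 1)).1 then 1 else 0) * (F w + seminormalOp q i F w) := by
  have e1 : ((w ∘ Equiv.swap i (i + 1)) ∘ Equiv.swap i (i + 1)) = w := by ext1; simp
  simp only [seminormalOp, e1, Function.comp_apply, Equiv.swap_apply_left, Equiv.swap_apply_right]
  have h1 := seminormal_quadratic hq h
  have h2 : seminormalDiag q (w i) (w (i + 1)) + seminormalDiag q (w (i + 1)) (w i) =
      ((q : R) - 1) * (if (w i).1 = (w (i + 1)).1 then 1 else 0) := by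
    split_ifs with h3
    · rw [seminormalDiag_add hq h3 h, mul_one]
    · rw [seminormalDiag_of_ne q h3, seminormalDiag_of_ne q (Ne.symm h3), mul_zero, add_zero]
  linear_combination F w * h1 + seminormalOff q (w i) (w (i + 1)) *
    F (w ∘ Equiv.swap i (i + 1)) * h2

end Seminormal

/-! ### Hecke generators as matrices on standard words. -/

section HeckeMatrix

open scoped Classical

variable {R : Type u} [CommRing R] {J : Type v}

/-- The matrix of the seminormal operator on the functions of standard words. -/
noncomputable def heckeMatrix (q : Rˣ) (u₀ : J × ℤ) (n i : ℕ) :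
    Matrix (standardWords u₀ n) (standardWords u₀ n) R := fun w w' ↦
  (if w' = w then seminormalDiag q (w.1 i) (w.1 (i + 1)) else 0) +
    if w'.1 = w.1 ∘ Equiv.swap i (i + 1) then seminormalOff q (w.1 i) (w.1 (i + 1)) else 0

/-- The components of the boxes of a standard word. -/
def wordComponents (u₀ : J × ℤ) (n : ℕ) (w : standardWords u₀ n) (i : Fin n) : J := (w.1 i).1

variable {q : Rˣ} {u₀ : J × ℤ} {n i : ℕ}

lemma heckeMatrix_apply_ne_zero {w w' : standardWords u₀ n} (h : heckeMatrix q u₀ n i w w' ≠ 0) :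
    w' = w ∨ FarApart (w.1 i) (w.1 (i + 1)) ∧ w'.1 = w.1 ∘ Equiv.swap i (i + 1) := by
  by_contra! hc
  refine h ?_
  rw [heckeMatrix, if_neg hc.1, zero_add]
  by_cases hf : FarApart (w.1 i) (w.1 (i + 1))
  · rw [if_neg (hc.2 hf)]
  · rw [seminormalOff, if_neg hf, ite_self]

lemma heckeMatrix_apply_swap {w w' : standardWords u₀ n} (h : w.1 i ≠ w.1 (i + 1))
    (h' : w'.1 = w.1 ∘ Equiv.swap i (i + 1)) :
    heckeMatrix q u₀ n i w w' = seminormalOff q (w.1 i) (w.1 (i + 1)) := by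
  have hne : w' ≠ w := by
    rintro rfl
    refine h ?_
    have := congrFun h' i
    rwa [Function.comp_apply, Equiv.swap_apply_left] at this
  rw [heckeMatrix, if_neg hne, if_pos h', zero_add]

lemma wordDiagram_eq_of_heckeMatrix (hi : i + 1 < n) {w w' : standardWords u₀ n}
    (h : heckeMatrix q u₀ n i w w' ≠ 0) : wordDiagram w.1 n = wordDiagram w'.1 n := by
  obtain rfl | ⟨hf, h'⟩ := heckeMatrix_apply_ne_zero h
  · rfl
  · rw [h', wordDiagram_swap_of_ge _ hf (by omega)]

/-- A nonzero entry either exchanges the letters or is diagonal. In the latter case both letters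
have the same component, so the exchange is invisible there. -/
lemma wordComponents_of_heckeMatrix (hi : i + 1 < n) {w w' : standardWords u₀ n}
    (h : heckeMatrix q u₀ n i w w' ≠ 0) : wordComponents u₀ n w' =
      wordComponents u₀ n w ∘ Equiv.swap (⟨i, by omega⟩ : Fin n) ⟨i + 1, hi⟩ := by
  by_cases h1 : w'.1 = w.1 ∘ Equiv.swap i (i + 1)
  · ext m
    have h2 : ((Equiv.swap (⟨i, by omega⟩ : Fin n) ⟨i + 1, hi⟩ m : Fin n) : ℕ) =
        Equiv.swap i (i + 1) (m : ℕ) := by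
      rw [Equiv.swap_apply_def, Equiv.swap_apply_def]
      simp only [Fin.ext_iff]
      split_ifs <;> rfl
    rw [wordComponents, h1, Function.comp_apply, Function.comp_apply, wordComponents, h2]
  · rw [heckeMatrix, if_neg h1, add_zero] at h
    obtain rfl : w' = w := by
      by_contra hne
      exact h (if_neg hne)
    rw [if_pos rfl] at h
    have h2 : (w'.1 i).1 = (w'.1 (i + 1)).1 := by
      by_contra hne
      exact h (seminormalDiag_of_ne q hne)
    ext m
    rw [Function.comp_apply, Equiv.swap_apply_def]
    split_ifs with h3 h4
    · rw [h3]
      exact h2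
    · rw [h4]
      exact h2.symm
    · rfl

variable [Fintype J]

lemma swap_mem_standardWords {w : ℕ → J × ℤ} (hw : w ∈ standardWords u₀ n) (hi : i + 1 < n)
    (hf : FarApart (w i) (w (i + 1))) : w ∘ Equiv.swap i (i + 1) ∈ standardWords u₀ n := by
  rw [mem_standardWords] at hw ⊢
  refine ⟨hw.1.swap hi hf, fun m hm ↦ ?_⟩
  rw [Function.comp_apply, Equiv.swap_apply_of_ne_of_ne (by omega) (by omega), hw.2 m hm]

/-- The values of `F` outside the standard words are irrelevant: if the letters are not far apart,
the off-diagonal coefficient is zero. Relations between matrices thus reduce to relations between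
operators on all words. -/
lemma heckeMatrix_mulVec (hi : i + 1 < n) (f : standardWords u₀ n → R)
    (F : (ℕ → J × ℤ) → R) (hF : ∀ w : standardWords u₀ n, F w = f w) (w : standardWords u₀ n) :
    (heckeMatrix q u₀ n i).mulVec f w = seminormalOp q i F w := by
  rw [Matrix.mulVec, dotProduct, seminormalOp]
  simp only [heckeMatrix, add_mul, Finset.sum_add_distrib, ite_mul, zero_mul]
  congr 1
  · rw [Finset.sum_ite_eq' Finset.univ w, if_pos (Finset.mem_univ w), hF]
  · by_cases hf : FarApart (w.1 i) (w.1 (i + 1))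
    · let w' : standardWords u₀ n := ⟨_, swap_mem_standardWords w.2 hi hf⟩
      have h (x : standardWords u₀ n) : x.1 = w.1 ∘ Equiv.swap i (i + 1) ↔ x = w' :=
        (Subtype.ext_iff (a1 := x) (a2 := w')).symm
      simp only [h]
      rw [Finset.sum_ite_eq' Finset.univ w', if_pos (Finset.mem_univ w'), ← hF w']
    · simp [seminormalOff, hf]

lemma heckeMatrix_braid (hq : ∀ m : ℤ, m ≠ 0 → IsUnit (((q ^ m : Rˣ) : R) - 1))
    (hi : i + 2 < n) : heckeMatrix q u₀ n i * heckeMatrix q u₀ n (i + 1) * heckeMatrix q u₀ n i =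
      heckeMatrix q u₀ n (i + 1) * heckeMatrix q u₀ n i * heckeMatrix q u₀ n (i + 1) := by
  refine Matrix.mulVec_injective (funext fun f ↦ funext fun w ↦ ?_)
  obtain ⟨F, hF⟩ : ∃ F : (ℕ → J × ℤ) → R, ∀ w : standardWords u₀ n, F w = f w :=
    ⟨fun w ↦ if h : w ∈ standardWords u₀ n then f ⟨w, h⟩ else 0, fun w ↦ dif_pos w.2⟩
  have hi0 : i + 1 < n := by omega
  simp only [← Matrix.mulVec_mulVec]
  have hw := (mem_standardWords.1 w.2).1
  rw [heckeMatrix_mulVec hi0 _ _ fun w ↦ (heckeMatrix_mulVec hi _ _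
      (fun w ↦ (heckeMatrix_mulVec hi0 _ F hF w).symm) w).symm,
    heckeMatrix_mulVec hi _ _ fun w ↦ (heckeMatrix_mulVec hi0 _ _
      (fun w ↦ (heckeMatrix_mulVec hi _ F hF w).symm) w).symm]
  exact seminormalOp_braid hq i F (hw.ne hi0) (hw.ne hi) (hw.ne_add_two hi)

lemma heckeMatrix_comm {j : ℕ} (hij : i + 1 < j) (hj : j + 1 < n) :
    heckeMatrix q u₀ n i * heckeMatrix q u₀ n j = heckeMatrix q u₀ n j * heckeMatrix q u₀ n i := by
  refine Matrix.mulVec_injective (funext fun f ↦ funext fun w ↦ ?_)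
  obtain ⟨F, hF⟩ : ∃ F : (ℕ → J × ℤ) → R, ∀ w : standardWords u₀ n, F w = f w :=
    ⟨fun w ↦ if h : w ∈ standardWords u₀ n then f ⟨w, h⟩ else 0, fun w ↦ dif_pos w.2⟩
  have hi : i + 1 < n := by omega
  simp only [← Matrix.mulVec_mulVec]
  rw [heckeMatrix_mulVec hi _ _ fun w ↦ (heckeMatrix_mulVec hj _ F hF w).symm,
    heckeMatrix_mulVec hj _ _ fun w ↦ (heckeMatrix_mulVec hi _ F hF w).symm]
  exact seminormalOp_comm q hij F w

lemma heckeMatrix_sq (hq : ∀ m : ℤ, m ≠ 0 → IsUnit (((q ^ m : Rˣ) : R) - 1)) (hi : i + 1 < n) :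
    heckeMatrix q u₀ n i * heckeMatrix q u₀ n i = 1 + ((q : R) - 1) •
      (Matrix.diagonal (fun w : standardWords u₀ n ↦
        if (w.1 i).1 = (w.1 (i + 1)).1 then (1 : R) else 0) * (1 + heckeMatrix q u₀ n i)) := by
  refine Matrix.mulVec_injective (funext fun f ↦ funext fun w ↦ ?_)
  obtain ⟨F, hF⟩ : ∃ F : (ℕ → J × ℤ) → R, ∀ w : standardWords u₀ n, F w = f w :=
    ⟨fun w ↦ if h : w ∈ standardWords u₀ n then f ⟨w, h⟩ else 0, fun w ↦ dif_pos w.2⟩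
  have hw := (mem_standardWords.1 w.2).1
  simp only [← Matrix.mulVec_mulVec, Matrix.add_mulVec, Matrix.smul_mulVec, Matrix.one_mulVec,
    Pi.add_apply, Pi.smul_apply, Matrix.mulVec_diagonal, smul_eq_mul]
  rw [heckeMatrix_mulVec hi _ _ fun w ↦ (heckeMatrix_mulVec hi _ F hF w).symm,
    heckeMatrix_mulVec hi _ F hF, seminormalOp_sq hq i F (hw.ne hi), hF w, mul_assoc]

end HeckeMatrix

/-! ### Normal forms under the braid relations. -/

section NormalForms

variable {M : Type*} [Monoid M]

/-- The product `T j * T (j + 1) * ⋯ * T (m - 1)`. -/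
def ascendingProd (T : ℕ → M) (j : ℕ) : ℕ → M
  | 0 => 1
  | m + 1 => if j ≤ m then ascendingProd T j m * T m else 1

/-- The normal form with code `c`: it is `T (c m) * ⋯ * T (m - 1)` times the normal form of
length `m`. -/
def normalForm (T : ℕ → M) (c : ℕ → ℕ) : ℕ → M
  | 0 => 1
  | m + 1 => ascendingProd T (c m) m * normalForm T c m

lemma ascendingProd_of_le (T : ℕ → M) {j m : ℕ} (h : m ≤ j) : ascendingProd T j m = 1 := by
  cases m with
  | zero => rfl
  | succ m => exact if_neg (by omega)

lemma ascendingProd_succ (T : ℕ → M) {j m : ℕ} (h : j ≤ m) :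
    ascendingProd T j (m + 1) = ascendingProd T j m * T m := if_pos h

lemma mul_ascendingProd (T : ℕ → M) {j m : ℕ} (h : j < m) :
    T j * ascendingProd T (j + 1) m = ascendingProd T j m := by
  induction m, h using Nat.le_induction with
  | base => rw [ascendingProd_of_le T le_rfl, ascendingProd_succ T le_rfl,
      ascendingProd_of_le T le_rfl, one_mul, mul_one]
  | succ m hm ih =>
    rw [ascendingProd_succ T hm, ascendingProd_succ T (by omega), ← mul_assoc, ih]

lemma map_ascendingProd {N : Type*} [Monoid N] (f : M →* N) (T : ℕ → M) (j m : ℕ) :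
    f (ascendingProd T j m) = ascendingProd (f ∘ T) j m := by
  induction m with
  | zero => exact map_one f
  | succ m ih =>
    rw [ascendingProd, ascendingProd]
    split_ifs
    · rw [map_mul, ih]
      rfl
    · exact map_one f

lemma map_normalForm {N : Type*} [Monoid N] (f : M →* N) (T : ℕ → M) (c : ℕ → ℕ) (m : ℕ) :
    f (normalForm T c m) = normalForm (f ∘ T) c m := by
  induction m with
  | zero => exact map_one f
  | succ m ih => rw [normalForm, normalForm, map_mul, ih, map_ascendingProd]

lemma normalForm_congr (T : ℕ → M) {c c' : ℕ → ℕ} {m : ℕ} (h : ∀ l < m, c l = c' l) :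
    normalForm T c m = normalForm T c' m := by
  induction m with
  | zero => rfl
  | succ m ih =>
    rw [normalForm, normalForm, ih fun l hl ↦ h l (by omega), h m (by omega)]

lemma normalForm_update_succ (T : ℕ → M) (c : ℕ → ℕ) (m j : ℕ) :
    normalForm T (Function.update c m j) (m + 1) = ascendingProd T j m * normalForm T c m := by
  rw [normalForm, Function.update_self,
    normalForm_congr T fun l hl ↦ Function.update_of_ne (by omega) j c]

lemma normalForm_id (T : ℕ → M) (m : ℕ) : normalForm T id m = 1 := by
  induction m with
  | zero => rfl
  | succ m ih => rw [normalForm, ih, ascendingProd_of_le T (j := id m) (m := m) le_rfl, one_mul]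

lemma normalForm_update_id (T : ℕ → M) {i m : ℕ} (h : i + 1 < m) :
    normalForm T (Function.update id (i + 1) i) m = T i := by
  induction m, h using Nat.le_induction with
  | base =>
    rw [normalForm_update_succ, normalForm_id, ascendingProd_succ T le_rfl,
      ascendingProd_of_le T le_rfl, one_mul, mul_one]
  | succ m hm ih =>
    rw [normalForm, ih, Function.update_of_ne (by omega), ascendingProd_of_le T (by simp), one_mul]

lemma ascendingProd_mem (Q : Submonoid M) {T : ℕ → M} {m : ℕ} (hT : ∀ i < m, T i ∈ Q) (j : ℕ) :
    ascendingProd T j m ∈ Q := by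
  induction m with
  | zero => exact Q.one_mem
  | succ m ih =>
    rw [ascendingProd]
    split_ifs
    · exact Q.mul_mem (ih fun i hi ↦ hT i (by omega)) (hT m (by omega))
    · exact Q.one_mem

lemma normalForm_mem (Q : Submonoid M) {T : ℕ → M} {m : ℕ} (hT : ∀ i, i + 1 < m → T i ∈ Q)
    (c : ℕ → ℕ) : normalForm T c m ∈ Q := by
  induction m with
  | zero => exact Q.one_mem
  | succ m ih =>
    exact Q.mul_mem (ascendingProd_mem Q (fun i hi ↦ hT i (by omega)) _)
      (ih fun i hi ↦ hT i (by omega))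

/-- The braid relations between `n - 1` elements. -/
structure BraidRelations (T : ℕ → M) (n : ℕ) : Prop where
  braid : ∀ i, i + 2 < n → T i * T (i + 1) * T i = T (i + 1) * T i * T (i + 1)
  comm : ∀ i j, i + 1 < j → j + 1 < n → T i * T j = T j * T i

lemma BraidRelations.mul_ascendingProd_of_lt {T : ℕ → M} {n : ℕ} (h : BraidRelations T n)
    {i j m : ℕ} (hij : i + 1 < j) (hm : m < n) :
    T i * ascendingProd T j m = ascendingProd T j m * T i := by
  induction m with
  | zero => rw [ascendingProd_of_le T (by omega), one_mul, mul_one]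
  | succ m ih =>
    rw [ascendingProd]
    split_ifs
    · rw [← mul_assoc, ih (by omega), mul_assoc, mul_assoc, h.comm i m (by omega) hm]
    · rw [one_mul, mul_one]

lemma BraidRelations.mul_ascendingProd_of_gt {T : ℕ → M} {n : ℕ} (h : BraidRelations T n)
    {i j m : ℕ} (hm : m < i) (hi : i + 1 < n) :
    T i * ascendingProd T j m = ascendingProd T j m * T i := by
  induction m with
  | zero => rw [ascendingProd_of_le T (by omega), one_mul, mul_one]
  | succ m ih =>
    rw [ascendingProd]
    split_ifs
    · rw [← mul_assoc, ih (by omega), mul_assoc, mul_assoc, h.comm m i hm hi]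
    · rw [one_mul, mul_one]

/-- The generator commutes past the factors before `T i`, meets `T i * T (i + 1)` where the braid
relation lowers its index by one, and commutes past the rest. -/
lemma BraidRelations.succ_mul_ascendingProd {T : ℕ → M} {n : ℕ} (h : BraidRelations T n)
    {i j m : ℕ} (hji : j ≤ i) (him : i + 1 < m) (hm : m < n) :
    T (i + 1) * ascendingProd T j m = ascendingProd T j m * T i := by
  induction m, him using Nat.le_induction with
  | base =>
    rw [ascendingProd_succ T (by omega), ascendingProd_succ T hji]
    rw [← mul_assoc, ← mul_assoc, h.mul_ascendingProd_of_gt (m := i) (by omega) hm]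
    simp only [mul_assoc]
    congr 1
    have := h.braid i (by omega)
    simp only [mul_assoc] at this
    exact this.symm
  | succ m hm' ih =>
    rw [ascendingProd_succ T (by omega), ← mul_assoc, ih (by omega), mul_assoc, mul_assoc,
      h.comm i m (by omega) hm]

end NormalForms

/-! ### Straightening products and deforming the symmetric group. -/

section Straightening

variable {S : Type u} {A : Type v} [CommRing S] [Ring A] [Algebra S A] {G : Type w} [Group G]

/-- The span of the products of an element of `D` and a normal form of length `m`. -/
def normalFormSpan (D : Subalgebra S A) (T : ℕ → A) (m : ℕ) : Submodule S A :=
  Submodule.span S {x | ∃ d ∈ D, ∃ c : ℕ → ℕ, (∀ l, c l ≤ l) ∧ x = d * normalForm T c m}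

variable {D : Subalgebra S A} {T : ℕ → A}

lemma mul_mem_normalFormSpan {d x : A} {m : ℕ} (hd : d ∈ D) (hx : x ∈ normalFormSpan D T m) :
    d * x ∈ normalFormSpan D T m := by
  induction hx using Submodule.span_induction with
  | mem x hx =>
    obtain ⟨d', hd', c, hc, rfl⟩ := hx
    exact Submodule.subset_span ⟨d * d', D.mul_mem hd hd', c, hc, (mul_assoc _ _ _).symm⟩
  | zero => rw [mul_zero]; exact zero_mem _
  | add y z _ _ hy hz => rw [mul_add]; exact add_mem hy hz
  | smul s y _ hy => rw [mul_smul_comm]; exact Submodule.smul_mem _ _ hy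

lemma ascendingProd_mul_mem_normalFormSpan {m j : ℕ}
    (hTD : ∀ i < m, ∀ d ∈ D, ∃ d' ∈ D, T i * d = d' * T i) (hj : j ≤ m) {x : A}
    (hx : x ∈ normalFormSpan D T m) : ascendingProd T j m * x ∈ normalFormSpan D T (m + 1) := by
  have h1 (l : ℕ) (hl : l ≤ m) (d : A) (hd : d ∈ D) :
      ∃ d' ∈ D, ascendingProd T j l * d = d' * ascendingProd T j l := by
    induction l generalizing d with
    | zero => exact ⟨d, hd, by rw [ascendingProd, one_mul, mul_one]⟩
    | succ l ih =>
      rw [ascendingProd]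
      split_ifs
      · obtain ⟨d1, hd1, h1⟩ := hTD l hl d hd
        obtain ⟨d2, hd2, h2⟩ := ih (by omega) d1 hd1
        exact ⟨d2, hd2, by rw [mul_assoc, h1, ← mul_assoc, h2, mul_assoc]⟩
      · exact ⟨d, hd, by rw [one_mul, mul_one]⟩
  induction hx using Submodule.span_induction with
  | mem x hx =>
    obtain ⟨d, hd, c, hc, rfl⟩ := hx
    obtain ⟨d', hd', h⟩ := h1 m le_rfl d hd
    refine Submodule.subset_span ⟨d', hd', Function.update c m j, fun l ↦ ?_, ?_⟩
    · rcases eq_or_ne l m with rfl | hl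
      · rwa [Function.update_self]
      · rw [Function.update_of_ne hl]
        exact hc l
    · rw [normalForm_update_succ, ← mul_assoc, h, mul_assoc]
  | zero => rw [mul_zero]; exact zero_mem _
  | add y z _ _ hy hz => rw [mul_add]; exact add_mem hy hz
  | smul s y _ hy => rw [mul_smul_comm]; exact Submodule.smul_mem _ _ hy

/-- Multiplying a normal form by a generator gives a normal form up to a multiple of `z`, and the
same normal form in a group that satisfies the Coxeter relations. -/
lemma exists_mul_normalForm_eq {n : ℕ} (hT : BraidRelations T n)
    (hTD : ∀ i, i + 1 < n → ∀ d ∈ D, ∃ d' ∈ D, T i * d = d' * T i) (z : S)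
    (hsq : ∀ i, i + 1 < n → ∃ d ∈ D, T i * T i = 1 + z • (d * (1 + T i)))
    {s : ℕ → G} (hs : BraidRelations s n) (hssq : ∀ i, i + 1 < n → s i * s i = 1)
    {m i : ℕ} (him : i + 1 < m) (hm : m ≤ n) {c : ℕ → ℕ} (hc : ∀ l, c l ≤ l) :
    ∃ c' : ℕ → ℕ, (∀ l, c' l ≤ l) ∧ normalForm s c' m = s i * normalForm s c m ∧
      ∃ e ∈ normalFormSpan D T m, T i * normalForm T c m = normalForm T c' m + z • e := by
  induction m generalizing i c with
  | zero => omega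
  | succ m ih =>
    have hu (c : ℕ → ℕ) (hc : ∀ l, c l ≤ l) (j : ℕ) (hj : j ≤ m) (l : ℕ) :
        Function.update c m j l ≤ l := by
      rcases eq_or_ne l m with rfl | hl
      · rwa [Function.update_self]
      · rw [Function.update_of_ne hl]
        exact hc l
    have hcm := hc m
    have slide (i' : ℕ) (hi' : i' + 1 < m)
        (h1 : T i * ascendingProd T (c m) m = ascendingProd T (c m) m * T i')
        (h2 : s i * ascendingProd s (c m) m = ascendingProd s (c m) m * s i') :
        ∃ c' : ℕ → ℕ, (∀ l, c' l ≤ l) ∧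
          normalForm s c' (m + 1) = s i * normalForm s c (m + 1) ∧
          ∃ e ∈ normalFormSpan D T (m + 1),
            T i * normalForm T c (m + 1) = normalForm T c' (m + 1) + z • e := by
      obtain ⟨c', hc', h3, e, he, h4⟩ := ih hi' (by omega) hc
      refine ⟨Function.update c' m (c m), hu c' hc' _ hcm, ?_, ascendingProd T (c m) m * e,
        ascendingProd_mul_mem_normalFormSpan (fun i hi ↦ hTD i (by omega)) hcm he, ?_⟩
      · rw [normalForm_update_succ, h3, normalForm, ← mul_assoc, ← mul_assoc, h2]
      · rw [normalForm_update_succ, normalForm, ← mul_assoc, h1, mul_assoc, h4, mul_add,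
          mul_smul_comm]
    -- Below `i`, the generator slides through with index lowered. At `i` the quadratic relation
    -- applies and creates the multiple of `z`. At `i + 1` it prolongs the ascending product. Above
    -- that it commutes through.
    rcases lt_trichotomy (c m) i with h | h | h
    · obtain ⟨i, rfl⟩ : ∃ i', i = i' + 1 := ⟨i - 1, by omega⟩
      exact slide i (by omega) (hT.succ_mul_ascendingProd (by omega) (by omega) (by omega))
        (hs.succ_mul_ascendingProd (by omega) (by omega) (by omega))
    · have hi : i + 1 < n := by omega
      obtain ⟨d, hd, h1⟩ := hsq i hi
      refine ⟨Function.update c m (i + 1), hu c hc _ (by omega), ?_,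
        d * normalForm T (Function.update c m (i + 1)) (m + 1) + d * normalForm T c (m + 1),
        add_mem (Submodule.subset_span ⟨d, hd, _, hu c hc _ (by omega), rfl⟩)
          (Submodule.subset_span ⟨d, hd, c, hc, rfl⟩), ?_⟩
      · rw [normalForm_update_succ, normalForm, h, ← mul_ascendingProd s (by omega : i < m),
          ← mul_assoc, ← mul_assoc, hssq i hi, one_mul]
      · rw [normalForm_update_succ, normalForm, h, ← mul_ascendingProd T (by omega : i < m),
          ← mul_assoc, ← mul_assoc, h1]
        simp only [add_mul, mul_add, one_mul, mul_one, smul_mul_assoc, smul_add, mul_assoc]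
    · rcases Nat.lt_or_ge (i + 1) (c m) with h' | h'
      · exact slide i (by omega) (hT.mul_ascendingProd_of_lt h' (by omega))
          (hs.mul_ascendingProd_of_lt h' (by omega))
      · obtain h'' : c m = i + 1 := by omega
        refine ⟨Function.update c m i, hu c hc _ (by omega), ?_, 0, zero_mem _, ?_⟩
        · rw [normalForm_update_succ, normalForm, h'', ← mul_assoc,
            mul_ascendingProd s (by omega : i < m)]
        · rw [normalForm_update_succ, normalForm, h'', ← mul_assoc,
            mul_ascendingProd T (by omega : i < m), smul_zero, add_zero]

/-- The transposition of `i` and `i + 1`. -/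
def adjacentSwap (n i : ℕ) : Equiv.Perm (Fin n) :=
  if h : i + 1 < n then Equiv.swap ⟨i, by omega⟩ ⟨i + 1, h⟩ else 1

lemma adjacentSwap_of_lt {n i : ℕ} (h : i + 1 < n) :
    adjacentSwap n i = Equiv.swap ⟨i, by omega⟩ ⟨i + 1, h⟩ := dif_pos h

lemma adjacentSwap_mul_self (n i : ℕ) : adjacentSwap n i * adjacentSwap n i = 1 := by
  rw [adjacentSwap]
  split_ifs
  · exact Equiv.swap_mul_self _ _
  · exact one_mul 1

lemma braidRelations_adjacentSwap (n : ℕ) : BraidRelations (adjacentSwap n) n where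
  braid i hi := by
    have h1 : (⟨i, by omega⟩ : Fin n) ≠ ⟨i + 1, by omega⟩ := by simp
    have h2 : (⟨i + 1, by omega⟩ : Fin n) ≠ ⟨i + 2, hi⟩ := by simp
    have h3 : (⟨i, by omega⟩ : Fin n) ≠ ⟨i + 2, hi⟩ := by simp
    rw [adjacentSwap_of_lt (by omega), adjacentSwap_of_lt hi]
    have e1 := Equiv.swap_mul_swap_mul_swap h1 h3
    have e2 := Equiv.swap_mul_swap_mul_swap h2.symm h3.symm
    rw [Equiv.swap_comm (⟨i + 1, _⟩ : Fin n) ⟨i, _⟩, Equiv.swap_comm (⟨i + 2, _⟩ : Fin n)] at e2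
    rw [Equiv.swap_comm (⟨i + 2, _⟩ : Fin n)] at e1
    exact e2.trans e1.symm
  comm i j hij hj := by
    rw [adjacentSwap_of_lt (by omega), adjacentSwap_of_lt hj]
    refine Equiv.Perm.Disjoint.commute fun x ↦ ?_
    by_cases h : (x : ℕ) = i ∨ (x : ℕ) = i + 1
    · refine Or.inr (Equiv.swap_apply_of_ne_of_ne ?_ ?_) <;> rw [Ne, Fin.ext_iff] <;>
        dsimp only <;> omega
    · refine Or.inl (Equiv.swap_apply_of_ne_of_ne ?_ ?_) <;> rw [Ne, Fin.ext_iff] <;>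
        dsimp only <;> omega

lemma closure_adjacentSwap (n : ℕ) :
    Submonoid.closure {s | ∃ i, i + 1 < n ∧ s = adjacentSwap n i} = ⊤ := by
  cases n with
  | zero => exact Subsingleton.elim _ _
  | succ n =>
    rw [eq_top_iff, ← Equiv.Perm.mclosure_swap_castSucc_succ, Submonoid.closure_le]
    rintro _ ⟨i, rfl⟩
    refine Submonoid.subset_closure ⟨i, by omega, ?_⟩
    rw [adjacentSwap_of_lt (by omega)]
    rfl

/-- Straightening in the group itself, with the algebra part trivialized by `T = 1` and `z = 0`:
normal forms are stable under left multiplication by generators. -/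
lemma exists_normalForm_eq {n : ℕ} (g : Equiv.Perm (Fin n)) :
    ∃ c : ℕ → ℕ, (∀ l, c l ≤ l) ∧ normalForm (adjacentSwap n) c n = g := by
  have hg : g ∈ Submonoid.closure {s | ∃ i, i + 1 < n ∧ s = adjacentSwap n i} :=
    closure_adjacentSwap n ▸ Submonoid.mem_top g
  induction hg using Submonoid.closure_induction_left with
  | one => exact ⟨id, fun l ↦ le_rfl, normalForm_id _ _⟩
  | mul_left x hx y hy ih =>
    obtain ⟨i, hi, rfl⟩ := hx
    obtain ⟨c, hc, rfl⟩ := ih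
    obtain ⟨c', hc', h, -⟩ := exists_mul_normalForm_eq (S := ℤ) (A := ℤ) (D := ⊤) (T := 1)
      (n := n) ⟨fun _ _ ↦ rfl, fun _ _ _ _ ↦ rfl⟩ (fun _ _ d hd ↦ ⟨d, hd, by simp⟩) 0
      (fun _ _ ↦ ⟨0, zero_mem _, by simp⟩) (braidRelations_adjacentSwap n)
      (fun i _ ↦ adjacentSwap_mul_self n i) hi le_rfl hc
    exact ⟨c', hc', h⟩

/-- There are n! codes up to length `n`, so surjectivity onto the permutations forces injectivity.
-/
lemma code_eq_of_normalForm_eq {n : ℕ} {c c' : ℕ → ℕ} (hc : ∀ l, c l ≤ l) (hc' : ∀ l, c' l ≤ l)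
    (h : normalForm (adjacentSwap n) c n = normalForm (adjacentSwap n) c' n) :
    ∀ l < n, c l = c' l := by
  let Φ (a : (m : Fin n) → Fin (m + 1)) : Equiv.Perm (Fin n) :=
    normalForm (adjacentSwap n) (fun l ↦ if hl : l < n then a ⟨l, hl⟩ else 0) n
  let r (c : ℕ → ℕ) (hc : ∀ l, c l ≤ l) (m : Fin n) : Fin (m + 1) :=
    ⟨c m, Nat.lt_succ_of_le (hc m)⟩
  have hr (c : ℕ → ℕ) (hc : ∀ l, c l ≤ l) : Φ (r c hc) = normalForm (adjacentSwap n) c n :=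
    normalForm_congr _ fun l hl ↦ dif_pos hl
  have hsurj : Function.Surjective Φ := fun g ↦ by
    obtain ⟨c, hc, h⟩ := exists_normalForm_eq g
    exact ⟨r c hc, (hr c hc).trans h⟩
  have hcard : Fintype.card ((m : Fin n) → Fin (m + 1)) = Fintype.card (Equiv.Perm (Fin n)) := by
    rw [Fintype.card_pi, Fintype.card_perm, Fintype.card_fin]
    simp only [Fintype.card_fin]
    rw [Fin.prod_univ_eq_prod_range (fun i ↦ i + 1) n, Finset.prod_range_add_one_eq_factorial]
  have hinj := ((Fintype.bijective_iff_surjective_and_card Φ).2 ⟨hsurj, hcard⟩).1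
  intro l hl
  have h1 : r c hc = r c' hc' := hinj ((hr c hc).trans (h.trans (hr c' hc').symm))
  exact congrArg Fin.val (congrFun h1 ⟨l, hl⟩)

/-- The basis of normal forms of the algebra generated by `D` and by a deformation of the
Coxeter generators of the symmetric group. -/
theorem exists_deformed_perm_basis {n : ℕ} (hT : BraidRelations T n)
    (hTD : ∀ i, i + 1 < n → ∀ d ∈ D, ∃ d' ∈ D, T i * d = d' * T i) (z : S)
    (hsq : ∀ i, i + 1 < n → ∃ d ∈ D, T i * T i = 1 + z • (d * (1 + T i))) :
    ∃ τ : Equiv.Perm (Fin n) → A, τ 1 = 1 ∧ (∀ i, i + 1 < n → τ (adjacentSwap n i) = T i) ∧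
      (∀ Q : Submonoid (Equiv.Perm (Fin n) × A),
        (∀ i, i + 1 < n → (adjacentSwap n i, T i) ∈ Q) → ∀ g, (g, τ g) ∈ Q) ∧
      ∀ g g', ∃ e ∈ Submodule.span S {x | ∃ d ∈ D, ∃ g, x = d * τ g},
        τ g * τ g' = τ (g * g') + z • e := by
  choose code hcode hcode' using exists_normalForm_eq (n := n)
  have hτ (c : ℕ → ℕ) (hc : ∀ l, c l ≤ l) :
      normalForm T (code (normalForm (adjacentSwap n) c n)) n = normalForm T c n :=
    normalForm_congr T (code_eq_of_normalForm_eq (hcode _) hc (hcode' _))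
  have hspan : normalFormSpan D T n =
      Submodule.span S {x | ∃ d ∈ D, ∃ g, x = d * normalForm T (code g) n} := by
    refine congrArg _ (Set.ext fun x ↦ ⟨?_, ?_⟩)
    · rintro ⟨d, hd, c, hc, rfl⟩
      exact ⟨d, hd, normalForm (adjacentSwap n) c n, by rw [hτ c hc]⟩
    · rintro ⟨d, hd, g, rfl⟩
      exact ⟨d, hd, code g, hcode g, rfl⟩
  -- Evaluate one and the same word in the product monoid. Properties of pairs stable under products
  -- thereby pass from generators to all `g`.
  have hQ (Q : Submonoid (Equiv.Perm (Fin n) × A))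
      (hQ : ∀ i, i + 1 < n → (adjacentSwap n i, T i) ∈ Q) (g : Equiv.Perm (Fin n)) :
      (g, normalForm T (code g) n) ∈ Q := by
    have h := normalForm_mem Q (T := fun i ↦ (adjacentSwap n i, T i)) (m := n) hQ (code g)
    have h1 := map_normalForm (MonoidHom.fst (Equiv.Perm (Fin n)) A)
      (fun i ↦ (adjacentSwap n i, T i)) (code g) n
    have h2 := map_normalForm (MonoidHom.snd (Equiv.Perm (Fin n)) A)
      (fun i ↦ (adjacentSwap n i, T i)) (code g) n
    convert h using 1
    exact Prod.ext ((hcode' g).symm.trans h1.symm) h2.symm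
  have hmul (i : ℕ) (hi : i + 1 < n) (c : ℕ → ℕ) (hc : ∀ l, c l ≤ l) :=
    exists_mul_normalForm_eq hT hTD z hsq (braidRelations_adjacentSwap n)
      (fun i _ ↦ adjacentSwap_mul_self n i) hi le_rfl hc
  refine ⟨fun g ↦ normalForm T (code g) n, ?_, fun i hi ↦ ?_, hQ, ?_⟩
  · have h := hτ id fun l ↦ le_rfl
    rwa [normalForm_id, normalForm_id] at h
  · have h := hτ (Function.update id (i + 1) i) fun l ↦ by
      rcases eq_or_ne l (i + 1) with rfl | hl
      · simp
      · rw [Function.update_of_ne hl]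
        rfl
    rwa [normalForm_update_id _ hi, normalForm_update_id _ hi] at h
  · rw [← hspan]
    -- The pairs whose second entry preserves the span and acts on normal forms like the first entry
    -- modulo `z`. Preserving the span keeps the errors under control in a product.
    let Q : Submonoid (Equiv.Perm (Fin n) × A) :=
      { carrier := {p | (∀ x ∈ normalFormSpan D T n, p.2 * x ∈ normalFormSpan D T n) ∧
          ∀ g, ∃ e ∈ normalFormSpan D T n, p.2 * normalForm T (code g) n =
            normalForm T (code (p.1 * g)) n + z • e}
        one_mem' := ⟨fun x hx ↦ by simpa using hx, fun g ↦ ⟨0, zero_mem _, by simp⟩⟩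
        mul_mem' := by
          rintro ⟨g1, a1⟩ ⟨g2, a2⟩ ⟨h1, h1'⟩ ⟨h2, h2'⟩
          refine ⟨fun x hx ↦ ?_, fun g ↦ ?_⟩
          · rw [Prod.mk_mul_mk, mul_assoc]
            exact h1 _ (h2 x hx)
          · obtain ⟨e2, he2, h4⟩ := h2' g
            obtain ⟨e1, he1, h3⟩ := h1' (g2 * g)
            refine ⟨e1 + a1 * e2, add_mem he1 (h1 _ he2), ?_⟩
            dsimp only at h3 h4
            rw [Prod.mk_mul_mk, mul_assoc, h4, mul_add, h3, mul_smul_comm, smul_add, mul_assoc,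
              add_assoc] }
    refine fun g g' ↦ (hQ Q (fun i hi ↦ ⟨fun x hx ↦ ?_, fun g ↦ ?_⟩) g).2 g'
    · induction hx using Submodule.span_induction with
      | mem x hx =>
        obtain ⟨d, hd, c, hc, rfl⟩ := hx
        obtain ⟨d', hd', h⟩ := hTD i hi d hd
        obtain ⟨c', hc', -, e, he, h1⟩ := hmul i hi c hc
        dsimp only
        rw [← mul_assoc, h, mul_assoc, h1, mul_add, mul_smul_comm]
        exact add_mem (Submodule.subset_span ⟨d', hd', c', hc', rfl⟩)
          (Submodule.smul_mem _ _ (mul_mem_normalFormSpan hd' he))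
      | zero => rw [mul_zero]; exact zero_mem _
      | add y z _ _ hy hz => rw [mul_add]; exact add_mem hy hz
      | smul s y _ hy => rw [mul_smul_comm]; exact Submodule.smul_mem _ _ hy
    · obtain ⟨c', hc', h, e, he, h1⟩ := hmul i hi (code g) (hcode g)
      refine ⟨e, he, ?_⟩
      rw [hcode'] at h
      dsimp only
      rw [h1, ← h, hτ c' hc']

end Straightening

/-! ### Jucys-Murphy elements and matrix units. -/

section JucysMurphy

open scoped Classical

variable {R : Type u} [CommRing R] {J : Type v} [Fintype J] {q : Rˣ} {u₀ : J × ℤ} {n : ℕ}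

/-- The recursion for Jucys-Murphy elements: contents at position `i + 1` come from those at `i`, up
to a factor `q` when the components agree. -/
lemma heckeMatrix_mul_diagonal_mul (hq : ∀ m : ℤ, m ≠ 0 → IsUnit (((q ^ m : Rˣ) : R) - 1)) {i : ℕ}
    (hi : i + 1 < n) : heckeMatrix q u₀ n i *
      Matrix.diagonal (fun w : standardWords u₀ n ↦ ((q ^ (w.1 i).2 : Rˣ) : R)) *
        heckeMatrix q u₀ n i = Matrix.diagonal (fun w : standardWords u₀ n ↦
          (if (w.1 i).1 = (w.1 (i + 1)).1 then (q : R) else 1) *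
            ((q ^ (w.1 (i + 1)).2 : Rˣ) : R)) := by
  refine Matrix.mulVec_injective (funext fun f ↦ funext fun w ↦ ?_)
  obtain ⟨F, hF⟩ : ∃ F : (ℕ → J × ℤ) → R, ∀ w : standardWords u₀ n, F w = f w :=
    ⟨fun w ↦ if h : w ∈ standardWords u₀ n then f ⟨w, h⟩ else 0, fun w ↦ dif_pos w.2⟩
  have hw := (mem_standardWords.1 w.2).1.ne hi
  simp only [← Matrix.mulVec_mulVec]
  rw [heckeMatrix_mulVec hi _ (fun w ↦ ((q ^ (w i).2 : Rˣ) : R) * seminormalOp q i F w) fun w ↦ by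
    rw [Matrix.mulVec_diagonal, heckeMatrix_mulVec hi _ F hF w], Matrix.mulVec_diagonal, ← hF]
  have e1 : ((w.1 ∘ Equiv.swap i (i + 1)) ∘ Equiv.swap i (i + 1)) = w.1 := by ext1; simp
  simp only [seminormalOp, e1, Function.comp_apply, Equiv.swap_apply_left, Equiv.swap_apply_right]
  have h1 := seminormal_quadratic hq hw
  split_ifs at h1 ⊢ with h
  · have h2 := seminormalDiag_mul hq h hw
    have h3 := seminormalDiag_add hq h hw
    linear_combination F w.1 * ((q ^ (w.1 (i + 1)).2 : Rˣ) : R) * h1 -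
      F w.1 * seminormalDiag q (w.1 i) (w.1 (i + 1)) * h2 +
      seminormalOff q (w.1 i) (w.1 (i + 1)) * F (w.1 ∘ Equiv.swap i (i + 1)) *
        (((q ^ (w.1 (i + 1)).2 : Rˣ) : R) * h3 - h2)
  · have h2 := seminormalDiag_of_ne (R := R) q h
    have h3 := seminormalDiag_of_ne (R := R) q (Ne.symm h)
    rw [h2] at h1 ⊢
    rw [h3]
    linear_combination F w.1 * ((q ^ (w.1 (i + 1)).2 : Rˣ) : R) * h1

/-- The seminormal matrices and the functions of the components generate all diagonal matrices. -/
lemma diagonalPart_eq_top_of_heckeMatrix_mem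
    (hq : ∀ m : ℤ, m ≠ 0 → IsUnit (((q ^ m : Rˣ) : R) - 1))
    {A : Subalgebra R (Matrix (standardWords u₀ n) (standardWords u₀ n) R)}
    (hd : ∀ f : (Fin n → J) → R, Matrix.diagonal (f ∘ wordComponents u₀ n) ∈ A)
    (hT : ∀ i, i + 1 < n → heckeMatrix q u₀ n i ∈ A) : A.diagonalPart = ⊤ := by
  -- The first box has content 0. Each later content follows from the recursion, after a function of
  -- the components has removed the spurious factor `q`. Contents and components together separate
  -- standard words.
  have hL (i : ℕ) (hi : i < n) :
      Matrix.diagonal (fun w : standardWords u₀ n ↦ ((q ^ (w.1 i).2 : Rˣ) : R)) ∈ A := by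
    induction i with
    | zero =>
      convert A.one_mem
      rw [← Matrix.diagonal_one]
      congr 1
      ext w
      obtain ⟨h1, h2⟩ := (mem_standardWords.1 w.2).1 0 hi
      have h3 : (w.1 0).2 ≤ 0 := of_decide_eq_true h1
      have h4 : ¬ (w.1 0).2 + 1 ≤ 0 := of_decide_eq_false h2
      rw [show (w.1 0).2 = 0 by omega, zpow_zero, Units.val_one]
    | succ i ih =>
      have h1 := A.mul_mem (hd fun y ↦ if y ⟨i, by omega⟩ = y ⟨i + 1, hi⟩ then
        ((q⁻¹ : Rˣ) : R) else 1) (A.mul_mem (A.mul_mem (hT i hi) (ih (by omega))) (hT i hi))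
      rw [heckeMatrix_mul_diagonal_mul hq hi, Matrix.diagonal_mul_diagonal] at h1
      convert h1 using 3 with w
      rw [Function.comp_apply]
      change _ = (if (w.1 i).1 = (w.1 (i + 1)).1 then _ else _) * _
      split_ifs
      · rw [← mul_assoc, Units.inv_mul, one_mul]
      · rw [one_mul, one_mul]
  refine Subalgebra.pi_eq_top_of_separates _ fun x y hxy ↦ ?_
  obtain ⟨i, hi⟩ : ∃ i, x.1 i ≠ y.1 i := by
    by_contra! h
    exact hxy (Subtype.ext (funext h))
  have hin : i < n := by
    by_contra hin
    rw [(mem_standardWords.1 x.2).2 i (by omega), (mem_standardWords.1 y.2).2 i (by omega)] at hi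
    exact hi rfl
  by_cases h : (x.1 i).1 = (y.1 i).1
  · exact ⟨_, Subalgebra.mem_diagonalPart.2 (hL i hin),
      isUnit_zpow_sub_zpow hq (snd_ne_of_ne h hi)⟩
  · refine ⟨_, Subalgebra.mem_diagonalPart.2
      (hd fun c ↦ if c ⟨i, hin⟩ = (x.1 i).1 then 1 else 0), ?_⟩
    rw [Function.comp_apply, Function.comp_apply]
    change IsUnit ((if (x.1 i).1 = (x.1 i).1 then (1 : R) else 0) -
      if (y.1 i).1 = (x.1 i).1 then 1 else 0)
    rw [if_pos rfl, if_neg (Ne.symm h), sub_zero]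
    exact isUnit_one

/-- Words of one shape are joined by exchanges of far-apart letters. Each exchange has an invertible
entry in some Hecke matrix, hence gives a matrix unit; multiply these along the path. -/
lemma single_mem_of_heckeMatrix_mem
    (hq : ∀ m : ℤ, m ≠ 0 → IsUnit (((q ^ m : Rˣ) : R) - 1))
    {A : Subalgebra R (Matrix (standardWords u₀ n) (standardWords u₀ n) R)}
    (hd : ∀ f : (Fin n → J) → R, Matrix.diagonal (f ∘ wordComponents u₀ n) ∈ A)
    (hT : ∀ i, i + 1 < n → heckeMatrix q u₀ n i ∈ A) {x y : standardWords u₀ n}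
    (h : wordDiagram x.1 n = wordDiagram y.1 n) : Matrix.single x y 1 ∈ A := by
  have hA := diagonalPart_eq_top_of_heckeMatrix_mem hq hd hT
  have hx := mem_standardWords.1 x.2
  have hy := mem_standardWords.1 y.2
  have key (w : ℕ → J × ℤ) (hw : Relation.ReflTransGen (WordStep n) x.1 w) :
      ∃ h : w ∈ standardWords u₀ n, Matrix.single x ⟨w, h⟩ 1 ∈ A := by
    induction hw with
    | refl =>
      refine ⟨x.2, ?_⟩
      exact Matrix.single_mem_of_unit_entry hA A.one_mem (by simp)
    | tail _ hs ih =>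
      obtain ⟨hb, hm⟩ := ih
      obtain ⟨i, hi, hf, rfl⟩ := hs
      refine ⟨swap_mem_standardWords hb hi hf, ?_⟩
      have h1 := A.mul_mem hm (Matrix.single_mem_of_unit_entry hA (hT i hi)
        (x := ⟨_, hb⟩) (y := ⟨_, swap_mem_standardWords hb hi hf⟩) (by
          rw [heckeMatrix_apply_swap hf.1 rfl]
          exact isUnit_seminormalOff hq hf))
      rwa [Matrix.single_mul_single_same, one_mul] at h1
  obtain ⟨_, h2⟩ := key y.1 (wordStep_connected hx.1 hy.1 h fun m hm ↦ by
    rw [hx.2 m hm, hy.2 m hm])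
  exact h2

end JucysMurphy

/-! ### The symmetric group case and the conclusion. -/

section Symmetric

open scoped Classical

lemma card_pairs_standardWords {J : Type v} [Fintype J] (u₀ : J × ℤ) (n : ℕ) :
    Nat.card {p : standardWords u₀ n × standardWords u₀ n //
      wordDiagram p.1.1 n = wordDiagram p.2.1 n} = Fintype.card J ^ n * n.factorial := by
  have e : {p : standardWords u₀ n × standardWords u₀ n //
      wordDiagram p.1.1 n = wordDiagram p.2.1 n} ≃
      (w : standardWords u₀ n) × {w' : standardWords u₀ n //
        wordDiagram w'.1 n = wordDiagram w.1 n} :=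
    { toFun p := ⟨p.1.1, p.1.2, p.2.symm⟩
      invFun p := ⟨(p.1, p.2.1), p.2.2.symm⟩
      left_inv _ := rfl
      right_inv _ := rfl }
  rw [Nat.card_congr e, Nat.card_sigma, ← sum_wordCount_standardWords u₀ n,
    ← Finset.sum_coe_sort (standardWords u₀ n) fun w ↦ wordCount n (wordDiagram w n)]
  refine Finset.sum_congr rfl fun w _ ↦ ?_
  rw [← card_filter_standardWords u₀ n (isTame_wordDiagram w.1 n), Nat.card_eq_fintype_card,
    ← Fintype.card_coe]
  refine Fintype.card_congr
    { toFun p := ⟨p.1.1, Finset.mem_filter.2 ⟨p.1.2, p.2⟩⟩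
      invFun p := ⟨⟨p.1, (Finset.mem_filter.1 p.2).1⟩, (Finset.mem_filter.1 p.2).2⟩
      left_inv _ := rfl
      right_inv _ := rfl }

/-- With q = 1 + tD, the quadratic error is tD times an indicator function of the components times 1
+ T. All straightening errors are therefore of the form that `diagonalSpan` allows. -/
theorem hasSplitGlobalSolution_wreathProduct_perm {k : Type} [CommRing k] [IsDomain k] {n : ℕ}
    {H : Type u} [Group H] [Finite H] {J : Type v} [Fintype J] (hJ : Fintype.card J = Nat.card H)
    (β : (Fin n → H) → (Fin n → J) → PrimitiveLocalization k) (hβ1 : β 1 = 1)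
    (hβmul : ∀ h h', ∃ m ∈ Submodule.span k⟦X⟧ (Set.range β),
      β h * β h' = β (h * h') + (PowerSeries.X : k⟦X⟧) • m)
    (hβact : ∀ (s : Equiv.Perm (Fin n)) h y, β h (y ∘ s) = β (fun i ↦ h (s⁻¹ i)) y)
    (hβspan : Submodule.span (PrimitiveLocalization k) (Set.range β) = ⊤)
    {D : k⟦X⟧} (hDS : D ∈ primitiveSeries k) (hD : ∀ f : (Fin n → J) → k⟦X⟧,
      (fun y ↦ algebraMap k⟦X⟧ (PrimitiveLocalization k) (D * f y)) ∈
        Submodule.span k⟦X⟧ (Set.range β)) :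
    HasSplitGlobalSolution k (WreathProduct H (MonoidHom.id (Equiv.Perm (Fin n)))) := by
  have : Nonempty J := Fintype.card_pos_iff.1 (hJ ▸ Nat.card_pos)
  let u₀ : J × ℤ := (Classical.arbitrary J, 0)
  let q : (PrimitiveLocalization k)ˣ := deformedUnit 1 D
  have hq (m : ℤ) (hm : m ≠ 0) :
      IsUnit (((q ^ m : (PrimitiveLocalization k)ˣ) : PrimitiveLocalization k) - 1) :=
    isUnit_deformedUnit_zpow_sub_one 1 hDS hm
  have hq1 : (q : PrimitiveLocalization k) - 1 = algebraMap k⟦X⟧ _ (PowerSeries.X * D) := by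
    rw [val_deformedUnit]
    simp
  let X := standardWords u₀ n
  let π : X → (Fin n → J) := wordComponents u₀ n
  let T (i : ℕ) : Matrix X X (PrimitiveLocalization k) := heckeMatrix q u₀ n i
  let δ (f : (Fin n → J) → k⟦X⟧) : Matrix X X (PrimitiveLocalization k) :=
    Matrix.diagonal (fun x ↦ algebraMap k⟦X⟧ (PrimitiveLocalization k) (f (π x)))
  let 𝒟 : Subalgebra k⟦X⟧ (Matrix X X (PrimitiveLocalization k)) :=
    { carrier := Set.range δ
      mul_mem' := by
        rintro _ _ ⟨f, rfl⟩ ⟨g, rfl⟩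
        exact ⟨f * g, by simp [δ, Matrix.diagonal_mul_diagonal]⟩
      add_mem' := by
        rintro _ _ ⟨f, rfl⟩ ⟨g, rfl⟩
        exact ⟨f + g, by simp [δ, Matrix.diagonal_add]⟩
      algebraMap_mem' r := ⟨fun _ ↦ r, rfl⟩ }
  have hTπ (i : ℕ) (hi : i + 1 < n) (x x' : X) (h : T i x x' ≠ 0) :
      π x' = π x ∘ adjacentSwap n i := by
    rw [adjacentSwap_of_lt hi]
    exact wordComponents_of_heckeMatrix hi h
  obtain ⟨τ, hτ1, hτs, hτQ, hτmul⟩ := exists_deformed_perm_basis (n := n) (T := T) (D := 𝒟)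
    ⟨fun i hi ↦ heckeMatrix_braid hq hi, fun i j hij hj ↦ heckeMatrix_comm hij hj⟩
    (by
      rintro i hi _ ⟨f, rfl⟩
      exact ⟨_, ⟨f ∘ fun y ↦ y ∘ adjacentSwap n i, rfl⟩, Matrix.mul_diagonal_comp_eq π
        (fun y ↦ y ∘ adjacentSwap n i) (T i) (hTπ i hi) fun y ↦ algebraMap k⟦X⟧ _ (f y)⟩)
    (PowerSeries.X * D) (by
      intro i hi
      refine ⟨_, ⟨fun y ↦ if y ⟨i, by omega⟩ = y ⟨i + 1, hi⟩ then 1 else 0, rfl⟩, ?_⟩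
      refine (heckeMatrix_sq hq hi).trans ?_
      rw [hq1, algebraMap_smul]
      congr 4
      ext w
      change _ = algebraMap k⟦X⟧ (PrimitiveLocalization k)
        (if (w.1 i).1 = (w.1 (i + 1)).1 then 1 else 0)
      split_ifs <;> simp)
  -- Support conditions on shape and components are stable under products, so checking the
  -- generators is enough.
  let Q : Submonoid (Equiv.Perm (Fin n) × Matrix X X (PrimitiveLocalization k)) :=
    { carrier := {p | ∀ x x', p.2 x x' ≠ 0 →
        wordDiagram x.1 n = wordDiagram x'.1 n ∧ π x' = π x ∘ p.1}
      one_mem' := fun x x' h ↦ by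
        obtain rfl : x = x' := by
          by_contra hne
          exact h (Matrix.one_apply_ne hne)
        exact ⟨rfl, rfl⟩
      mul_mem' := by
        rintro ⟨g1, a1⟩ ⟨g2, a2⟩ h1 h2 x x' h
        obtain ⟨y, -, hy⟩ := Finset.exists_ne_zero_of_sum_ne_zero h
        obtain ⟨h3, h4⟩ := h1 x y (left_ne_zero_of_mul hy)
        obtain ⟨h5, h6⟩ := h2 y x' (right_ne_zero_of_mul hy)
        exact ⟨h3.trans h5, by rw [h6, h4]; rfl⟩ }
  have hQ := hτQ Q fun i hi x x' h ↦ ⟨wordDiagram_eq_of_heckeMatrix hi h, hTπ i hi x x' h⟩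
  refine hasSplitGlobalSolution_wreathProduct (MonoidHom.id _) β hβ1 hβmul
    (fun g h y ↦ hβact g h y) hβspan D hD π (fun w ↦ wordDiagram w.1 n) τ hτ1
    (fun g x x' h ↦ (hQ g x x' h).1) (fun g x x' h ↦ (hQ g x x' h).2) ?_ ?_ ?_
  · intro g g'
    obtain ⟨e, he, h⟩ := hτmul g g'
    refine ⟨e, ?_, h⟩
    refine Submodule.span_mono ?_ he
    rintro _ ⟨_, ⟨f, rfl⟩, g, rfl⟩
    exact ⟨f, g, rfl⟩
  · rw [card_pairs_standardWords, hJ, Nat.card_eq_fintype_card (α := Equiv.Perm _),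
      Fintype.card_perm, Fintype.card_fin]
  · intro A hA hτA x y h
    refine single_mem_of_heckeMatrix_mem hq hA (fun i hi ↦ ?_) h
    have h1 := hτA (adjacentSwap n i)
    rwa [hτs i hi] at h1

end Symmetric

lemma exists_finite_subalgebra_isPrimitiveRoot {M : ℕ} (hM : M ≠ 0) :
    ∃ (k : Subalgebra ℤ ℂ) (ζ : k), Module.Finite ℤ k ∧ IsPrimitiveRoot ζ M := by
  have h := Complex.isPrimitiveRoot_exp M hM
  set ζ := Complex.exp (2 * Real.pi * Complex.I / M)
  refine ⟨Algebra.adjoin ℤ {ζ}, ⟨ζ, Algebra.subset_adjoin rfl⟩, ?_, ?_⟩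
  · exact Module.Finite.of_fg (h.isIntegral (Nat.pos_of_ne_zero hM)).fg_adjoin_singleton
  · exact IsPrimitiveRoot.coe_submonoidClass_iff.1 h

theorem theorem7 (H : Type u) [CommGroup H] [Finite H] (n : ℕ) :
    (∀ (G : Type v) [CommGroup G] [Finite G] (σ : G →* Equiv.Perm (Fin n)),
      DonaldFlaniganSplitSolvable (WreathProduct H σ)) ∧
    DonaldFlaniganSplitSolvable (WreathProduct H (MonoidHom.id (Equiv.Perm (Fin n)))) := by
  have hH : Monoid.exponent H ≠ 0 := Monoid.exponent_ne_zero_of_finite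
  constructor
  · intro G _ _ σ
    -- One root of unity has to serve the characters of both groups. In the symmetric case the
    -- exponent of `H` is enough, since the seminormal form needs only q = 1 + tD.
    have hM : Monoid.exponent H * Monoid.exponent G ≠ 0 :=
      mul_ne_zero hH Monoid.exponent_ne_zero_of_finite
    obtain ⟨k, ζ, hk, hζ⟩ := exists_finite_subalgebra_isPrimitiveRoot hM
    exact ⟨k, hk, hasSplitGlobalSolution_wreathProduct_of_comm (Nat.pos_of_ne_zero hM) hζ
      (dvd_mul_right _ _) (dvd_mul_left _ _) σ⟩
  · obtain ⟨k, ζ, hk, hζ⟩ := exists_finite_subalgebra_isPrimitiveRoot hH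
    obtain ⟨J, β, D, hJ, hβ1, hβmul, hβact, hβspan, hDS, hD⟩ :=
      exists_deformed_functions (Nat.pos_of_ne_zero hH) hζ H dvd_rfl n
    exact ⟨k, hk, hasSplitGlobalSolution_wreathProduct_perm ((Fintype.card_coe J).trans hJ) β hβ1
      hβmul hβact hβspan hDS hD⟩
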